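/- \textbf{Setting.} Let $px$ be a non-degenerate symmetric bilinear form on $\mathbb{R}^d$ and let $K\nearrow\mathbb{R}^d$ be a family of (coordinate-parallel) cuboids centered at zero, all of whose edge lengths tend to infinity. For a bounded continuous function $g$ on $\mathbb{R}^d$ let $\tilde g(p)=(2\pi)^{-d/2}\int e^{-ipx}g(x)\,d^dx$ be its Fourier transform as a tempered distribution. \textbf{Spectral notions.} Let $x\mapsto\gamma_x$ be a group of isometries of a Banach space $X$, indexed by $\mathbb{R}^d$, and let $X_*$ be a linear space of bounded functionals on $X$ such that the functions $g_{\varphi,A}(x):=\varphi(\gamma_x(A))$, $A\in X$, $\varphi\in X_*$, are continuous; let $\hat X_*\subset X_*$ be a norm dense subspace. For a subspace $Y\subset X$ put $\mathrm{Sp}\,\gamma|_Y:=\overline{\bigcup_{A\in Y,\varphi\in X_*}\mathrm{supp}\,\tilde g_{\varphi,A}}$, $\mathrm{Sp}\,\gamma:=\mathrm{Sp}\,\gamma|_X$, and define \begin{itemize} \item $\mathrm{Sp}_{\mathrm{pp}}\gamma$ as the set of all $q\in\mathrm{Sp}\,\gamma$ for which there is $0\neq A\in X$ with $\mathrm{supp}\,\tilde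 g_{\varphi,A}\subset\{q\}$ for all $\varphi\in X_*$; \item $X_{\mathrm c}:=\{A\in X\mid \lim_{K\nearrow\mathbb{R}^d}|K|^{-1}\int_K e^{-iqx}\varphi(\gamma_x(A))\,d^dx=0\ \ \forall q\in\mathbb{R}^d,\varphi\in X_*\}$ and $\mathrm{Sp}_{\mathrm c}\gamma:=\mathrm{Sp}\,\gamma|_{X_{\mathrm c}}$; \item $X_{\mathrm{ac}}$ as the norm closure of $\{A\in X_{\mathrm c}\mid \tilde g_{\varphi,A}\in L^1(\mathbb{R}^d)\ \forall\varphi\in\hat X_*\}$ and $\mathrm{Sp}_{\mathrm{ac}}\gamma:=\mathrm{Sp}\,\gamma|_{X_{\mathrm{ac}}}$; \item $X_{\mathrm{sc}}:=X_{\mathrm c}/X_{\mathrm{ac}}$ and $\mathrm{Sp}_{\mathrm{sc}}\gamma:=\overline{\bigcup_{A\in X_{\mathrm c},\,\varphi\in X_{\mathrm{sc}}^*}\mathrm{supp}\,\tilde h_{\varphi,A}}$, where $h_{\varphi,A}(x)=\varphi([\gamma_x(A)])$. \end{itemize} \textbf{Theorem.} Let $\mathfrak{A}$ be a unital C*-algebra,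 $\mathbb{R}^d\ni x\mapsto\alpha_x$ a strongly continuous group of automorphisms of $\mathfrak{A}$, $\omega_0$ a pure state on $\mathfrak{A}$ with GNS representation $(\pi,\mathcal{H},\Omega)$, and let $\mathfrak{A}_*\subset\mathfrak{A}^*$ be the predual of this representation, i.e. the norm closed linear span of the functionals $(\Psi|\pi(\,\cdot\,)\Phi)$, $\Psi,\Phi\in\mathcal{H}$. Assume that $\|A\|=\sup\{|\varphi(A)| : \varphi\in\mathfrak{A}_*,\|\varphi\|\leq 1\}$ for all $A\in\mathfrak{A}$ (i.e. $\pi$ is faithful) and that $\ker\omega_0\subset\mathfrak{A}_{\mathrm c}$. Let $\hat{\mathfrak{A}}\subset\mathfrak{A}$ be a norm dense subspace and let $\hat{\mathfrak{A}}_*\subset\mathfrak{A}_*$ be a norm dense subspace which is self-adjoint (with $\varphi$ it contains $\overline{\varphi}$, $\overline{\varphi}(A)=\overline{\varphi(A^*)}$) and contains all the functionals $(\Psi|\pi(\,\cdot\,)\Omega)$ with $\Psi$ in some dense subspace of $\mathcal{H}$. The spectra of $\alpha$ are defined with $X=\mathfrak{A}$, $X_*=\mathfrak{A}_*$, $\hat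 X_*=\hat{\mathfrak{A}}_*$; those of the transposed action $\alpha^*_x\varphi=\varphi\circ\alpha_x$ with $X=\mathfrak{A}_*$, $X_*=\mathfrak{A}$, $\hat X_*=\hat{\mathfrak{A}}$ (acting by evaluation); those of a unitary group $U$ on $\mathcal{H}$ with $X=\mathcal{H}$, $X_*=\hat X_*=\mathcal{H}^*$. Then there is a unique strongly continuous group of unitaries $\mathbb{R}^d\ni x\mapsto U(x)$ on $\mathcal{H}$ with $\pi(\alpha_x(A))=U(x)\pi(A)U(x)^{-1}$ and $U(x)\Omega=\Omega$ for all $x\in\mathbb{R}^d$, $A\in\mathfrak{A}$, and there hold the relations: \begin{enumerate} \item[(a)] $\mathrm{Sp}_{\mathrm{pp}}U=\mathrm{Sp}_{\mathrm{pp}}\alpha=\mathrm{Sp}_{\mathrm{pp}}\alpha^*=\{0\}$; \item[(b)] $\mathrm{Sp}_{\mathrm c}U-\mathrm{Sp}_{\mathrm c}U\subset\mathrm{Sp}_{\mathrm c}\alpha$; \item[(c)] $\pm\mathrm{Sp}_{\mathrm{ac}}U\subset\mathrm{Sp}_{\mathrm{ac}}\alpha^*$; \item[(d)] $\pm\mathrm{Sp}_{\mathrm{sc}}U\subset\mathrm{Sp}_{\mathrm{sc}}\alpha$.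 \end{enumerate} -/

import Mathlib

open MeasureTheory Filter Topology
open scoped ComplexOrder InnerProductSpace SchwartzMap Pointwise

noncomputable section

namespace ArvesonSpectral

/-- The group `ℝ^d` (and the space of momenta). -/
abbrev E (d : ℕ) : Type := EuclideanSpace ℝ (Fin d)

/-! ### Fourier transforms of functions `x ↦ φ(α_x(A))` as tempered distributions -/

/-- The distributional Fourier transform
`g̃(p) = (2π)^{-d/2} ∫ e^{-ipx} g(x) dx` of a bounded continuous function `g`, evaluated on the
test function `f`; here `px = β p x`. -/
def fourierPairing {d : ℕ} (β : LinearMap.BilinForm ℝ (E d)) (g : E d → ℂ) (f : 𝓢(E d, ℂ)) : ℂ :=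
  (((2 * Real.pi) ^ (-(d : ℝ) / 2) : ℝ) : ℂ) *
    ∫ x, g x * ∫ p, Complex.exp (-(Complex.I * (β p x : ℂ))) * f p

/-- The support of the distribution `g̃`. -/
def fourierSupport {d : ℕ} (β : LinearMap.BilinForm ℝ (E d)) (g : E d → ℂ) : Set (E d) :=
  Distribution.dsupport (fourierPairing β g)

/-- The distribution `g̃` is (given by) a function in `L¹(ℝ^d, d^dp)`. -/
def FourierInL1 {d : ℕ} (β : LinearMap.BilinForm ℝ (E d)) (g : E d → ℂ) : Prop :=
  ∃ h : E d → ℂ, Integrable h ∧ ∀ f : 𝓢(E d, ℂ), fourierPairing β g f = ∫ p, h p * f p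

/-! ### Families of cuboids -/

/-- The cuboid centered at zero with edge lengths `2 L i`. -/
def cuboid {d : ℕ} (L : Fin d → ℝ) : Set (E d) := {x | ∀ i, |x i| ≤ L i}

/-- A family of cuboids `K ↗ ℝ^d`, centered at zero, all of whose edge lengths tend to infinity;
it is recorded by the filter generated by the tails of the family on the space of half edge
lengths. -/
structure CuboidFamily (d : ℕ) where
  filter : Filter (Fin d → ℝ)
  neBot : filter.NeBot
  tendsto_atTop : ∀ i, Tendsto (fun L : Fin d → ℝ => L i) filter atTop

/-- The average of `g` over the cuboid with half edge lengths `L`. -/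
def cuboidMean {d : ℕ} (L : Fin d → ℝ) (g : E d → ℂ) : ℂ :=
  ((volume.real (cuboid L))⁻¹ : ℝ) * ∫ x in cuboid L, g x

/-! ### Groups of isometries -/

/-- A group of isometries `ℝ^d ∋ x ↦ act x` of `X`, together with a subspace `fn` of functionals
with respect to which it is weakly continuous. -/
structure IsometricFlow (d : ℕ) (X : Type*) [NormedAddCommGroup X] [NormedSpace ℂ X] where
  act : E d → X →ₗᵢ[ℂ] X
  act_zero : ∀ A, act 0 A = A
  act_add : ∀ x y A, act (x + y) A = act x (act y A)
  fn : Submodule ℂ (StrongDual ℂ X)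
  continuous_fn : ∀ φ ∈ fn, ∀ A, Continuous fun x => φ (act x A)

/-! Helper facts, needed for the continuous subspace to be an invariant linear subspace. -/

lemma isClosed_cuboid {d : ℕ} (L : Fin d → ℝ) : IsClosed (cuboid L) := by
  simp only [cuboid, Set.ofPred_forall]
  exact isClosed_iInter fun i => isClosed_le (by fun_prop) continuous_const

lemma cuboid_eq_preimage {d : ℕ} (L : Fin d → ℝ) :
    cuboid L = (@WithLp.ofLp 2 (Fin d → ℝ)) ⁻¹' Set.Icc (-L) L := by
  ext x
  simp [cuboid, abs_le, Pi.le_def, forall_and]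

lemma isCompact_cuboid {d : ℕ} (L : Fin d → ℝ) : IsCompact (cuboid L) := by
  rw [cuboid_eq_preimage]
  exact (PiLp.homeomorph 2 (fun _ : Fin d => ℝ)).isCompact_preimage.2 isCompact_Icc

lemma volume_cuboid {d : ℕ} {L : Fin d → ℝ} (hL : ∀ i, 0 ≤ L i) :
    volume.real (cuboid L) = ∏ i, (2 * L i) := by
  rw [cuboid_eq_preimage, Measure.real,
    (PiLp.volume_preserving_ofLp (Fin d)).measure_preimage measurableSet_Icc.nullMeasurableSet,
    Real.volume_Icc_pi_toReal (fun i => by have := hL i; simp; linarith)]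
  refine Finset.prod_congr rfl fun i _ => ?_
  simp; ring

lemma integrableOn_cuboid {d : ℕ} (L : Fin d → ℝ) {g : E d → ℂ} (hg : Continuous g) :
    IntegrableOn g (cuboid L) := hg.continuousOn.integrableOn_compact (isCompact_cuboid L)

lemma cuboidMean_add {d : ℕ} (L : Fin d → ℝ) {g h : E d → ℂ} (hg : Continuous g)
    (hh : Continuous h) :
    cuboidMean L (fun x => g x + h x) = cuboidMean L g + cuboidMean L h := by
  simp only [cuboidMean]
  rw [integral_add (integrableOn_cuboid L hg) (integrableOn_cuboid L hh), mul_add]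

lemma cuboidMean_const_mul {d : ℕ} (L : Fin d → ℝ) (c : ℂ) (g : E d → ℂ) :
    cuboidMean L (fun x => c * g x) = c * cuboidMean L g := by
  simp only [cuboidMean]
  rw [integral_const_mul]; ring

/-- Translations do not change the limit of the means of a bounded function. -/
lemma tendsto_cuboidMean_translate {d : ℕ} (K : CuboidFamily d) {g : E d → ℂ} (hg : Continuous g)
    {C : ℝ} (hC : ∀ x, ‖g x‖ ≤ C) (h0 : Tendsto (fun L => cuboidMean L g) K.filter (𝓝 0))
    (y : E d) : Tendsto (fun L => cuboidMean L (fun x => g (x + y))) K.filter (𝓝 0) := by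
  have hratio : Tendsto (fun L : Fin d → ℝ => 2 * C * (1 - ∏ i, (1 - |y i| * (L i)⁻¹)))
      K.filter (𝓝 0) := by
    have h1 : ∀ i, Tendsto (fun L : Fin d → ℝ => 1 - |y i| * (L i)⁻¹) K.filter (𝓝 1) := by
      intro i
      simpa using tendsto_const_nhds.sub
        ((tendsto_inv_atTop_zero.comp (K.tendsto_atTop i)).const_mul |y i|)
    have h2 := tendsto_finsetProd Finset.univ fun i _ => h1 i
    simpa using ((tendsto_const_nhds (x := (1 : ℝ))).sub h2).const_mul (2 * C)
  have hdiff : Tendsto (fun L => cuboidMean L (fun x => g (x + y)) - cuboidMean L g)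
      K.filter (𝓝 0) := by
    refine squeeze_zero_norm' ?_ hratio
    have hev : ∀ᶠ L in K.filter, ∀ i, |y i| + 1 ≤ L i :=
      eventually_all.2 fun i => (K.tendsto_atTop i).eventually_ge_atTop _
    filter_upwards [hev] with L hL
    have hLpos : ∀ i, 0 < L i := fun i => by have := hL i; have := abs_nonneg (y i); linarith
    set L' : Fin d → ℝ := fun i => L i - |y i| with hL'
    have hL'0 : ∀ i, 0 ≤ L' i := fun i => by have := hL i; simp only [hL']; linarith
    set T : Set (E d) := (fun x => x + y) '' cuboid L with hT
    have hTpre : T = (fun x => x - y) ⁻¹' cuboid L := by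
      simp [hT, sub_eq_add_neg]
    have hTc : IsCompact T := (isCompact_cuboid L).image (by fun_prop)
    have hTm : MeasurableSet T := hTc.measurableSet
    have hKm : MeasurableSet (cuboid L) := (isClosed_cuboid L).measurableSet
    have hK'm : MeasurableSet (cuboid L') := (isClosed_cuboid L').measurableSet
    have hTvol : volume.real T = volume.real (cuboid L) := by
      rw [hTpre, Measure.real, Measure.real]
      congr 1
      exact (measurePreserving_sub_right volume y).measure_preimage hKm.nullMeasurableSet
    have hsubK : cuboid L' ⊆ cuboid L := fun x hx i => by
      have := hx i; have := abs_nonneg (y i); simp only [hL'] at *; linarith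
    have hsubT : cuboid L' ⊆ T := by
      rw [hTpre]
      intro x hx i
      have h1 := hx i
      have h2 := abs_sub (x i) (y i)
      simp only [hL'] at h1
      simp only [PiLp.sub_apply]
      linarith
    have hshift : ∫ x in cuboid L, g (x + y) = ∫ x in T, g x := by
      rw [hT]
      exact ((measurePreserving_add_right volume y).setIntegral_image_emb
        (MeasurableEquiv.addRight y).measurableEmbedding g (cuboid L)).symm
    have hfin : ∀ {s : Set (E d)}, IsCompact s → volume s ≠ ⊤ := fun hs => hs.measure_lt_top.ne
    have hb : ∀ {s : Set (E d)}, IsCompact s → MeasurableSet s → cuboid L' ⊆ s →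
        ‖∫ x in s \ cuboid L', g x‖ ≤ C * (volume.real s - volume.real (cuboid L')) := by
      intro s hs hsm hsub
      rw [← measureReal_sdiff hsub hK'm (hfin hs)]
      refine norm_setIntegral_le_of_norm_le_const ?_ (fun x _ => hC x)
      exact (measure_mono Set.sdiff_subset).trans_lt hs.measure_lt_top
    have hsplit : ∀ {s : Set (E d)}, IsCompact s → cuboid L' ⊆ s →
        ∫ x in s, g x = (∫ x in s \ cuboid L', g x) + ∫ x in cuboid L', g x := by
      intro s hs hsub
      rw [setIntegral_sdiff hK'm (hg.continuousOn.integrableOn_compact hs) hsub]; ring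
    have hmain : ‖(∫ x in cuboid L, g (x + y)) - ∫ x in cuboid L, g x‖ ≤
        2 * C * (volume.real (cuboid L) - volume.real (cuboid L')) := by
      rw [hshift, hsplit hTc hsubT, hsplit (isCompact_cuboid L) hsubK, add_sub_add_right_eq_sub]
      have h1 := hb hTc hTm hsubT
      have h2 := hb (isCompact_cuboid L) hKm hsubK
      rw [hTvol] at h1
      calc _ ≤ _ := norm_sub_le _ _
        _ ≤ _ := add_le_add h1 h2
        _ = _ := by ring
    have hvpos : 0 < volume.real (cuboid L) := by
      rw [volume_cuboid fun i => (hLpos i).le]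
      exact Finset.prod_pos fun i _ => by have := hLpos i; positivity
    have hv' : volume.real (cuboid L') =
        volume.real (cuboid L) * ∏ i, (1 - |y i| * (L i)⁻¹) := by
      rw [volume_cuboid fun i => (hLpos i).le, volume_cuboid hL'0, ← Finset.prod_mul_distrib]
      refine Finset.prod_congr rfl fun i _ => ?_
      have := (hLpos i).ne'
      simp only [hL']
      field_simp
    simp only [cuboidMean]
    rw [← mul_sub, norm_mul, Complex.norm_real, Real.norm_of_nonneg (by positivity)]
    calc _ ≤ (volume.real (cuboid L))⁻¹ *
          (2 * C * (volume.real (cuboid L) - volume.real (cuboid L'))) := by gcongr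
      _ = _ := by rw [hv']; field_simp
  simpa using hdiff.add h0

namespace IsometricFlow

variable {d : ℕ} {X : Type*} [NormedAddCommGroup X] [NormedSpace ℂ X]

/-- The Arveson spectrum of the flow restricted to the subspace `S`. -/
def spectrumOn (F : IsometricFlow d X) (β : LinearMap.BilinForm ℝ (E d)) (S : Submodule ℂ X) :
    Set (E d) :=
  closure (⋃ A ∈ S, ⋃ φ ∈ F.fn, fourierSupport β fun x => φ (F.act x A))

/-- The spectral subspace (inside `S`) of a closed set `Δ`. -/
def spectralSubspace (F : IsometricFlow d X) (β : LinearMap.BilinForm ℝ (E d))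
    (S : Submodule ℂ X) (Δ : Set (E d)) : Set X :=
  {A | A ∈ S ∧ ∀ φ ∈ F.fn, fourierSupport β (fun x => φ (F.act x A)) ⊆ Δ}

/-- The pure-point spectrum of the flow restricted to `S`. -/
def ppSpectrum (F : IsometricFlow d X) (β : LinearMap.BilinForm ℝ (E d)) (S : Submodule ℂ X) :
    Set (E d) :=
  {q | q ∈ F.spectrumOn β S ∧ ∃ A ∈ F.spectralSubspace β S {q}, A ≠ 0}

/-- `A` has vanishing means `|K|⁻¹ ∫_K e^{-iqx} φ(α_x(A)) dx → 0` for all `q` and `φ`. -/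
def HasZeroMeans (F : IsometricFlow d X) (β : LinearMap.BilinForm ℝ (E d)) (K : CuboidFamily d)
    (A : X) : Prop :=
  ∀ q : E d, ∀ φ ∈ F.fn, Tendsto
    (fun L => cuboidMean L fun x => Complex.exp (-(Complex.I * (β q x : ℂ))) * φ (F.act x A))
    K.filter (𝓝 0)

lemma continuous_phase (β : LinearMap.BilinForm ℝ (E d)) (q : E d) :
    Continuous fun x : E d => Complex.exp (-(Complex.I * (β q x : ℂ))) := by
  have : Continuous fun x : E d => β q x := (β q).continuous_of_finiteDimensional
  fun_prop

lemma continuous_integrand (F : IsometricFlow d X) (β : LinearMap.BilinForm ℝ (E d)) (q : E d)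
    {φ : StrongDual ℂ X} (hφ : φ ∈ F.fn) (A : X) :
    Continuous fun x => Complex.exp (-(Complex.I * (β q x : ℂ))) * φ (F.act x A) :=
  (continuous_phase β q).mul (F.continuous_fn φ hφ A)

/-- The continuous subspace of the flow. -/
def continuousSubspace (F : IsometricFlow d X) (β : LinearMap.BilinForm ℝ (E d))
    (K : CuboidFamily d) : Submodule ℂ X where
  carrier := {A | F.HasZeroMeans β K A}
  zero_mem' := fun q φ _ => by simpa [cuboidMean] using tendsto_const_nhds
  add_mem' := fun {A B} hA hB q φ hφ => by
    have h := (hA q φ hφ).add (hB q φ hφ)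
    simp only [← cuboidMean_add _ (F.continuous_integrand β q hφ A)
      (F.continuous_integrand β q hφ B), add_zero] at h
    simpa [mul_add] using h
  smul_mem' := fun c A hA q φ hφ => by
    have h := (hA q φ hφ).const_mul c
    simp only [← cuboidMean_const_mul, mul_zero] at h
    simpa [mul_left_comm] using h

/-- The continuous subspace is invariant. -/
lemma act_mem_continuousSubspace (F : IsometricFlow d X) (β : LinearMap.BilinForm ℝ (E d))
    (K : CuboidFamily d) (y : E d) {A : X} (hA : A ∈ F.continuousSubspace β K) :
    F.act y A ∈ F.continuousSubspace β K := by
  intro q φ hφ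
  have hb : ∀ x, ‖Complex.exp (-(Complex.I * (β q x : ℂ))) * φ (F.act x A)‖ ≤ ‖φ‖ * ‖A‖ := by
    intro x
    have h1 : ‖Complex.exp (-(Complex.I * (β q x : ℂ)))‖ = 1 := by simp [Complex.norm_exp]
    have h2 := φ.le_opNorm (F.act x A)
    rw [LinearIsometry.norm_map] at h2
    rwa [norm_mul, h1, one_mul]
  have h := (tendsto_cuboidMean_translate K (F.continuous_integrand β q hφ A) hb
    (hA q φ hφ) y).const_mul (Complex.exp (Complex.I * (β q y : ℂ)))
  simp only [← cuboidMean_const_mul, mul_zero] at h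
  refine h.congr fun L => ?_
  congr 1
  funext x
  rw [F.act_add, ← mul_assoc, ← Complex.exp_add, map_add]
  congr 2
  push_cast
  ring

/-- The continuous spectrum of the flow restricted to `S`. -/
def cSpectrum (F : IsometricFlow d X) (β : LinearMap.BilinForm ℝ (E d)) (K : CuboidFamily d)
    (S : Submodule ℂ X) : Set (E d) :=
  F.spectrumOn β (S ⊓ F.continuousSubspace β K)

/-- The absolutely continuous subspace (inside `S`): the norm closure of the space of all elements
`A` of the continuous subspace such that the Fourier transforms of `x ↦ φ(α_x(A))` are in `L¹` for
all `φ` in the set `G` of functionals. -/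
def acSubspace (F : IsometricFlow d X) (β : LinearMap.BilinForm ℝ (E d)) (K : CuboidFamily d)
    (S : Submodule ℂ X) (G : Submodule ℂ (StrongDual ℂ X)) : Submodule ℂ X :=
  (Submodule.span ℂ {A | A ∈ S ⊓ F.continuousSubspace β K ∧
    ∀ φ ∈ G, FourierInL1 β fun x => φ (F.act x A)}).topologicalClosure

/-- The absolutely continuous spectrum of the flow restricted to `S`. -/
def acSpectrum (F : IsometricFlow d X) (β : LinearMap.BilinForm ℝ (E d)) (K : CuboidFamily d)
    (S : Submodule ℂ X) (G : Submodule ℂ (StrongDual ℂ X)) : Set (E d) :=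
  F.spectrumOn β (F.acSubspace β K S G)

/-- The singular continuous space: the quotient of the continuous subspace by the absolutely
continuous one, with the quotient norm. -/
abbrev ScSpace (F : IsometricFlow d X) (β : LinearMap.BilinForm ℝ (E d)) (K : CuboidFamily d)
    (G : Submodule ℂ (StrongDual ℂ X)) : Type _ :=
  F.continuousSubspace β K ⧸ (F.acSubspace β K ⊤ G).submoduleOf (F.continuousSubspace β K)

/-- The class `[α_x(A)]` (the reduced group applied to `[A]`) in the singular continuous space. -/
def scClass (F : IsometricFlow d X) (β : LinearMap.BilinForm ℝ (E d)) (K : CuboidFamily d)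
    (G : Submodule ℂ (StrongDual ℂ X)) (A : F.continuousSubspace β K) (x : E d) :
    F.ScSpace β K G :=
  Submodule.Quotient.mk ⟨F.act x A, F.act_mem_continuousSubspace β K x A.2⟩

/-- The singular continuous spectrum: the Arveson spectrum of the reduced group acting on the
singular continuous space, with respect to all bounded functionals on that space. -/
def scSpectrum (F : IsometricFlow d X) (β : LinearMap.BilinForm ℝ (E d)) (K : CuboidFamily d)
    (G : Submodule ℂ (StrongDual ℂ X)) : Set (E d) :=
  closure (⋃ A : F.continuousSubspace β K, ⋃ φ : StrongDual ℂ (F.ScSpace β K G),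
    fourierSupport β fun x => φ (F.scClass β K G A x))

end IsometricFlow

/-! ### Unitary groups -/

/-- A strongly continuous group of unitaries `ℝ^d ∋ x ↦ U(x)` on a Hilbert space. -/
structure UnitaryGroup (d : ℕ) (H : Type*) [NormedAddCommGroup H] [InnerProductSpace ℂ H] where
  toFun : E d → (H ≃ₗᵢ[ℂ] H)
  map_zero : ∀ Ψ, toFun 0 Ψ = Ψ
  map_add : ∀ x y Ψ, toFun (x + y) Ψ = toFun x (toFun y Ψ)
  continuous_apply : ∀ Ψ, Continuous fun x => toFun x Ψ

/-- A unitary group as a group of isometries, with respect to all bounded functionals. -/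
def UnitaryGroup.flow {d : ℕ} {H : Type*} [NormedAddCommGroup H] [InnerProductSpace ℂ H]
    (U : UnitaryGroup d H) : IsometricFlow d H where
  act := fun x => (U.toFun x).toLinearIsometry
  act_zero := U.map_zero
  act_add := U.map_add
  fn := ⊤
  continuous_fn := fun φ _ A => φ.continuous.comp (U.continuous_apply A)

/-! ### Automorphism groups of C*-algebras and their transposed action -/

/-- A strongly continuous group of automorphisms `ℝ^d ∋ x ↦ α_x` of a unital C*-algebra. -/
structure AutomorphismGroup (d : ℕ) (𝔄 : Type*) [CStarAlgebra 𝔄] where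
  toFun : E d → (𝔄 ≃⋆ₐ[ℂ] 𝔄)
  map_zero : ∀ A, toFun 0 A = A
  map_add : ∀ x y A, toFun (x + y) A = toFun x (toFun y A)
  continuous_apply : ∀ A, Continuous fun x => toFun x A

namespace AutomorphismGroup

variable {d : ℕ} {𝔄 : Type*} [CStarAlgebra 𝔄]

/-- The automorphism `α_x` as a linear isometry. -/
def isometry (α : AutomorphismGroup d 𝔄) (x : E d) : 𝔄 ≃ₗᵢ[ℂ] 𝔄 where
  toFun := α.toFun x
  invFun := (α.toFun x).symm
  left_inv := (α.toFun x).left_inv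
  right_inv := (α.toFun x).right_inv
  map_add' := _root_.map_add (α.toFun x)
  map_smul' := _root_.map_smul (α.toFun x)
  norm_map' := fun A => StarAlgEquiv.norm_map (α.toFun x) A

/-- The group `α` as a group of isometries of `𝔄`, with respect to the functionals in `P`. -/
def flow (α : AutomorphismGroup d 𝔄) (P : Submodule ℂ (StrongDual ℂ 𝔄)) : IsometricFlow d 𝔄 where
  act := fun x => (α.isometry x).toLinearIsometry
  act_zero := α.map_zero
  act_add := α.map_add
  fn := P
  continuous_fn := fun φ _ A => φ.continuous.comp (α.continuous_apply A)

/-- A subspace of `𝔄`, viewed as a space of functionals (evaluations) on `𝔄*`. -/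
def evaluations (S : Submodule ℂ 𝔄) : Submodule ℂ (StrongDual ℂ (StrongDual ℂ 𝔄)) :=
  S.map (NormedSpace.inclusionInDoubleDual ℂ 𝔄).toLinearMap

/-- The transposed action `α*_x φ = φ ∘ α_x` on `𝔄*`, with respect to the evaluations on elements
of `𝔄`. -/
def transposed (α : AutomorphismGroup d 𝔄) : IsometricFlow d (StrongDual ℂ 𝔄) where
  act := fun x =>
    { toFun := fun φ => φ ∘L ((α.isometry x : 𝔄 ≃L[ℂ] 𝔄) : 𝔄 →L[ℂ] 𝔄)
      map_add' := fun φ ψ => rfl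
      map_smul' := fun c φ => rfl
      norm_map' := fun φ => φ.opNorm_comp_linearIsometryEquiv (α.isometry x) }
  act_zero := fun φ => by
    ext A
    exact congrArg φ (α.map_zero A)
  act_add := fun x y φ => by
    ext A
    exact congrArg φ ((congrArg (fun z => α.toFun z A) (add_comm x y)).trans (α.map_add y x A))
  fn := evaluations ⊤
  continuous_fn := by
    rintro _ ⟨A, _, rfl⟩ φ
    exact φ.continuous.comp (α.continuous_apply A)

end AutomorphismGroup

/-! ### States and GNS representations -/

/-- The set of states of a unital C*-algebra. -/
def states (𝔄 : Type*) [CStarAlgebra 𝔄] : Set (StrongDual ℂ 𝔄) :=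
  {ω | (∀ A, 0 ≤ ω (star A * A)) ∧ ω 1 = 1}

/-- A pure state is an extreme point of the set of states. -/
def IsPureState {𝔄 : Type*} [CStarAlgebra 𝔄] (ω : StrongDual ℂ 𝔄) : Prop :=
  ω ∈ Set.extremePoints ℝ (states 𝔄)

section GNS

variable {𝔄 : Type*} [CStarAlgebra 𝔄] {H : Type*} [NormedAddCommGroup H] [InnerProductSpace ℂ H]
  [CompleteSpace H]

/-- `(π, H, Ω)` is a GNS triple of `ω`: `Ω` is cyclic for `π` and induces `ω`. (Such a triple is
unique up to unitary equivalence.) -/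
structure IsGNSTriple (ω : StrongDual ℂ 𝔄) (π : 𝔄 →⋆ₐ[ℂ] (H →L[ℂ] H)) (Ω : H) : Prop where
  cyclic : Dense (Set.range fun A => π A Ω)
  inner_eq : ∀ A, ⟪Ω, π A Ω⟫_ℂ = ω A

/-- The functional `A ↦ (Ψ|π(A)Φ)`. -/
def vectorFunctional (π : 𝔄 →⋆ₐ[ℂ] (H →L[ℂ] H)) (Ψ Φ : H) : StrongDual ℂ 𝔄 :=
  LinearMap.mkContinuous
    { toFun := fun A => ⟪Ψ, π A Φ⟫_ℂ
      map_add' := fun A B => by simp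
      map_smul' := fun c A => by simp }
    (‖Ψ‖ * ‖Φ‖) (fun A => by
      calc ‖⟪Ψ, π A Φ⟫_ℂ‖ ≤ ‖Ψ‖ * ‖π A Φ‖ := norm_inner_le_norm _ _
        _ ≤ ‖Ψ‖ * (‖π A‖ * ‖Φ‖) := by gcongr; exact (π A).le_opNorm Φ
        _ ≤ ‖Ψ‖ * (‖A‖ * ‖Φ‖) := by gcongr; exact NonUnitalStarAlgHom.norm_apply_le π A
        _ = ‖Ψ‖ * ‖Φ‖ * ‖A‖ := by ring)

/-- The predual of the representation `π` (the functionals on `𝔄` which are normal in `π`): the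
norm closure in `𝔄*` of the linear span of the functionals `(Ψ|π(·)Φ)`. -/
def predual (π : 𝔄 →⋆ₐ[ℂ] (H →L[ℂ] H)) : Submodule ℂ (StrongDual ℂ 𝔄) :=
  (Submodule.span ℂ (Set.range fun v : H × H => vectorFunctional π v.1 v.2)).topologicalClosure

/-- The norm of every element of `𝔄` is determined by the functionals in `P`. -/
def IsNorming (P : Submodule ℂ (StrongDual ℂ 𝔄)) : Prop :=
  ∀ A : 𝔄, IsLUB {r : ℝ | ∃ φ ∈ P, ‖φ‖ ≤ 1 ∧ r = ‖φ A‖} ‖A‖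

/-- The condition on the subspace `Phat` of the predual: it is norm dense in the predual,
self-adjoint, and contains the functionals `(Ψ|π(·)Ω)` for `Ψ` in some dense subspace of `H`. -/
structure DenseCondition (π : 𝔄 →⋆ₐ[ℂ] (H →L[ℂ] H)) (Ω : H)
    (Phat : Submodule ℂ (StrongDual ℂ 𝔄)) : Prop where
  le_predual : Phat ≤ predual π
  dense : predual π ≤ Phat.topologicalClosure
  selfAdjoint : ∀ φ ∈ Phat, ∃ ψ ∈ Phat, ∀ A, ψ A = star (φ (star A))
  vector_mem : ∃ D : Submodule ℂ H, Dense (D : Set H) ∧ ∀ Ψ ∈ D, vectorFunctional π Ψ Ω ∈ Phat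

/-- The unitary group `U` implements `α` in the representation `π` and leaves `Ω` invariant. -/
structure Implements {d : ℕ} (α : AutomorphismGroup d 𝔄) (π : 𝔄 →⋆ₐ[ℂ] (H →L[ℂ] H)) (Ω : H)
    (U : UnitaryGroup d H) : Prop where
  covariant : ∀ x A Ψ, π (α.toFun x A) Ψ = U.toFun x (π A ((U.toFun x).symm Ψ))
  invariant : ∀ x, U.toFun x Ω = Ω

end GNS

end ArvesonSpectral

end

open ArvesonSpectral

/-! Linear coordinates `T` turn the form `β` into `2π` times the inner product, so up to a nonzero
constant the distribution `g̃` pairs a test function `f` with `∫ g(T y) 𝓕f(y) dy`. For a unitary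
group this gives a matrix element of `U(f) = ∫ 𝓕f(y) U(T y) dy`. The map `f ↦ U(f)` respects
products and adjoints, and `‖U(f)‖ ≤ sup |f|` for compactly supported `f`. A point lies outside a
spectrum exactly when all pairings vanish for test functions supported in one fixed ball around it.

Subtracting `ω(A)·1` puts every `A` into the continuous subspace. Comparing orbits there forces `ω`
to be invariant, which yields `U` on the cyclic vectors `π(A)Ω`, and also `𝔄_c = ker ω` and `H_c =
Ω^⊥`.

(a) A bounded function with Fourier support `{q}` is a multiple of `e^{iqx}`
(`eq_exp_of_fourierSupport_subset_singleton`). An eigenvector with `q ≠ 0` is annihilated by the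
invariant functional; its means therefore tend to zero, yet after cancelling the phase they are
constant.

(b) Given `p, q` in the continuous spectrum of `U`, choose vectors orthogonal to `Ω` that are
spectrally localized near `p` and `q`. Purity gives some `A ∈ ker ω` with a nonzero matrix element
between them (`IsPureState.exists_inner_ne_zero`). Smearing `A` with an `f` equal to `1` near `p -
q` leaves this element unchanged (`UnitaryGroup.integral_fourier_mul_inner_smear`), so `p - q` is in
the continuous spectrum of `α`.

(c) For `Ψ` with integrable spectral densities, both `(Ψ|π(·)Ω)` and `(Ω|π(·)Ψ)` are absolutely
continuous normal functionals; they account for the two signs.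

(d) The map `A ↦ π(A)Ω` sends `𝔄_ac` into `H_ac`: densities that are `L¹` for a dense set of vectors
are `L¹` for all (`UnitaryGroup.fourierInL1_of_dense`). A vector orthogonal to `H_ac` thus gives
functionals on `𝔄_c` that vanish on `𝔄_ac`. The other sign comes from invariance of `𝔄_ac` under the
involution. -/

noncomputable section

namespace ArvesonSpectral

open scoped FourierTransform ContDiff ComplexConjugate

/-! ### Elementary operations on Schwartz functions -/

/-- The complex conjugate of a Schwartz function. -/
def schwartzConj {d : ℕ} (f : 𝓢(E d, ℂ)) : 𝓢(E d, ℂ) :=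
  SchwartzMap.postcompCLM (𝕜 := ℝ) (Complex.conjCLE : ℂ →L[ℝ] ℂ) f

/-- The reflection `p ↦ f (-p)` of a Schwartz function. -/
def schwartzNeg {d : ℕ} (f : 𝓢(E d, ℂ)) : 𝓢(E d, ℂ) :=
  SchwartzMap.compCLMOfContinuousLinearEquiv ℂ (ContinuousLinearEquiv.neg ℝ) f

/-- The pointwise product of Schwartz functions. -/
def schwartzMul {d : ℕ} (f g : 𝓢(E d, ℂ)) : 𝓢(E d, ℂ) :=
  SchwartzMap.smulLeftCLM ℂ f g

@[simp] lemma schwartzConj_apply {d : ℕ} (f : 𝓢(E d, ℂ)) (p : E d) :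
    schwartzConj f p = conj (f p) := rfl

@[simp] lemma schwartzNeg_apply {d : ℕ} (f : 𝓢(E d, ℂ)) (p : E d) :
    schwartzNeg f p = f (-p) := rfl

@[simp] lemma schwartzMul_apply {d : ℕ} (f g : 𝓢(E d, ℂ)) (p : E d) :
    schwartzMul f g p = f p * g p := by
  simp [schwartzMul, SchwartzMap.smulLeftCLM_apply_apply f.hasTemperateGrowth]

lemma tsupport_schwartzConj {d : ℕ} (f : 𝓢(E d, ℂ)) :
    tsupport (schwartzConj f) = tsupport f := by
  refine congrArg closure ?_
  ext p
  simp

lemma tsupport_schwartzNeg_subset {d : ℕ} {f : 𝓢(E d, ℂ)} {p : E d} {r : ℝ}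
    (hf : tsupport f ⊆ Metric.ball p r) :
    tsupport (schwartzNeg f) ⊆ Metric.ball (-p) r := by
  have h : tsupport (schwartzNeg f) = (Homeomorph.neg (E d)) ⁻¹' tsupport f :=
    (tsupport_comp_eq_preimage (f : E d → ℂ) (Homeomorph.neg (E d)))
  rw [h]
  intro x hx
  have := hf hx
  simp only [Metric.mem_ball, Homeomorph.coe_neg, dist_eq_norm] at this ⊢
  rwa [← norm_neg, show -(x - -p) = -x - p by abel]

/-! ### The pairing in terms of the standard Fourier transform -/

/-- `T` is the inverse of the isomorphism with the dual space given by `β`, applied to `2π⟪y, ·⟫`.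
It makes the phase `e^{-ipx}` the kernel of the standard Fourier transform `𝓕`. -/
lemma exists_frequencyEquiv {d : ℕ} (β : LinearMap.BilinForm ℝ (E d)) (hβ : β.Nondegenerate)
    (hβs : β.IsSymm) :
    ∃ T : E d ≃L[ℝ] E d, ∀ p y, β p (T y) = 2 * Real.pi * ⟪p, y⟫_ℝ := by
  let D := β.toDual hβ
  have hinj : Function.Injective
      (D.symm.toLinearMap ∘ₗ ((2 * Real.pi) • (innerₗ (E d) : E d →ₗ[ℝ] E d →ₗ[ℝ] ℝ))) := by
    refine D.symm.injective.comp ?_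
    rw [← LinearMap.ker_eq_bot, LinearMap.ker_eq_bot']
    intro y hy
    have := LinearMap.congr_fun hy y
    simpa [Real.pi_ne_zero] using this
  refine ⟨(LinearEquiv.ofInjectiveEndo _ hinj).toContinuousLinearEquiv, fun p y => ?_⟩
  rw [← hβs.eq]
  rw [real_inner_comm]
  simp [D]

/-- Coordinates `T` in which the form `β` becomes `2π` times the standard inner product. -/
def IsFrequencyEquiv {d : ℕ} (β : LinearMap.BilinForm ℝ (E d)) (T : E d ≃L[ℝ] E d) : Prop :=
  ∀ p y, β p (T y) = 2 * Real.pi * ⟪p, y⟫_ℝ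

variable {d : ℕ} {β : LinearMap.BilinForm ℝ (E d)} {T : E d ≃L[ℝ] E d}

/-- The constant is `|det T|`. No integrability is needed, since the change of variables is a
measurable embedding. -/
lemma exists_integral_comp_equiv (T : E d ≃L[ℝ] E d) :
    ∃ c : ℂ, c ≠ 0 ∧ ∀ F : E d → ℂ, ∫ x, F x = c * ∫ y, F (T y) := by
  have hdet : LinearMap.det (T.toLinearEquiv : E d →ₗ[ℝ] E d) ≠ 0 := T.toLinearEquiv.isUnit_det'.ne_zero
  have hmap := Measure.map_linearMap_addHaar_eq_smul_addHaar (volume : Measure (E d)) hdet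
  set D := LinearMap.det (T.toLinearEquiv : E d →ₗ[ℝ] E d)
  refine ⟨((|D| : ℝ) : ℂ), by simpa using hdet, fun F => ?_⟩
  have h1 : ∫ y, F (T y) = ∫ x, F x ∂(Measure.map T volume) :=
    (T.toHomeomorph.measurableEmbedding.integral_map F).symm
  rw [h1, show Measure.map T (volume : Measure (E d)) = ENNReal.ofReal |D⁻¹| • volume from hmap,
    integral_smul_measure, ENNReal.toReal_ofReal (abs_nonneg _), abs_inv, Complex.real_smul,
    ← mul_assoc, ← Complex.ofReal_mul, mul_inv_cancel₀ (abs_ne_zero.2 hdet)]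
  simp

lemma fourier_eq_integral (hT : IsFrequencyEquiv β T) (f : 𝓢(E d, ℂ)) (y : E d) :
    ∫ p, Complex.exp (-(Complex.I * (β p (T y) : ℂ))) * f p = 𝓕 f y := by
  rw [SchwartzMap.fourier_coe, Real.fourier_eq']
  refine integral_congr_ae (ae_of_all _ fun p => ?_)
  simp only [hT p y, smul_eq_mul]
  congr 2
  push_cast
  ring

lemma exists_fourierPairing_eq (hT : IsFrequencyEquiv β T) :
    ∃ c : ℂ, c ≠ 0 ∧ ∀ (g : E d → ℂ) (f : 𝓢(E d, ℂ)),
      fourierPairing β g f = c * ∫ y, g (T y) * 𝓕 f y := by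
  obtain ⟨c, hc, h⟩ := exists_integral_comp_equiv T
  refine ⟨(((2 * Real.pi) ^ (-(d : ℝ) / 2) : ℝ) : ℂ) * c, mul_ne_zero ?_ hc, fun g f => ?_⟩
  · exact_mod_cast (Real.rpow_pos_of_pos Real.two_pi_pos _).ne'
  · rw [fourierPairing, h, mul_assoc]
    simp only [fourier_eq_integral hT]

/-- The constant relating the pairing to the standard Fourier transform. -/
def pairingConst (hT : IsFrequencyEquiv β T) : ℂ := (exists_fourierPairing_eq hT).choose

lemma pairingConst_ne_zero (hT : IsFrequencyEquiv β T) : pairingConst hT ≠ 0 :=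
  (exists_fourierPairing_eq hT).choose_spec.1

lemma fourierPairing_eq (hT : IsFrequencyEquiv β T) (g : E d → ℂ) (f : 𝓢(E d, ℂ)) :
    fourierPairing β g f = pairingConst hT * ∫ y, g (T y) * 𝓕 f y :=
  (exists_fourierPairing_eq hT).choose_spec.2 g f

/-- Bounded continuous functions. -/
def IsBddCont (g : E d → ℂ) : Prop := Continuous g ∧ ∃ C, ∀ x, ‖g x‖ ≤ C

lemma IsBddCont.integrable_mul {g : E d → ℂ} (hg : IsBddCont g) {h : E d → ℂ}
    (hh : Integrable h) : Integrable fun y => g y * h y := by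
  obtain ⟨C, hC⟩ := hg.2
  exact hh.bdd_mul hg.1.aestronglyMeasurable (ae_of_all _ hC)

lemma IsBddCont.comp {g : E d → ℂ} (hg : IsBddCont g) {φ : E d → E d} (hφ : Continuous φ) :
    IsBddCont (fun x => g (φ x)) :=
  ⟨hg.1.comp hφ, hg.2.imp fun _ h x => h (φ x)⟩

lemma fourierPairing_sum (hT : IsFrequencyEquiv β T) {g : E d → ℂ} (hg : IsBddCont g)
    {ι : Type*} (s : Finset ι) (f : ι → 𝓢(E d, ℂ)) :
    fourierPairing β g (∑ i ∈ s, f i) = ∑ i ∈ s, fourierPairing β g (f i) := by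
  classical
  simp only [fourierPairing_eq hT, ← Finset.mul_sum]
  congr 1
  rw [← integral_finsetSum]
  · refine integral_congr_ae (ae_of_all _ fun y => ?_)
    have : 𝓕 (∑ i ∈ s, f i) = ∑ i ∈ s, 𝓕 (f i) :=
      map_sum (FourierTransform.fourierCLM ℂ 𝓢(E d, ℂ)) f s
    simp only [this, sum_apply, Finset.mul_sum]
  · exact fun i _ => (hg.comp T.continuous).integrable_mul (𝓕 (f i)).integrable

/-! ### Vanishing of the pairing away from the support -/

lemma hasCompactSupport_of_tsupport_subset_ball {f : 𝓢(E d, ℂ)} {p : E d} {r : ℝ}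
    (hf : tsupport f ⊆ Metric.ball p r) : HasCompactSupport f :=
  (isCompact_closedBall p r).of_isClosed_subset (isClosed_tsupport _)
    (hf.trans Metric.ball_subset_closedBall)

/-- Finitely many open sets on which the pairing vanishes cover the compact support of `f`. A
subordinate partition of unity splits `f` into pieces that each pair to zero, so finite additivity
suffices. -/
lemma fourierPairing_eq_zero_of_disjoint (hT : IsFrequencyEquiv β T) {g : E d → ℂ}
    (hg : IsBddCont g) {f : 𝓢(E d, ℂ)} (hfc : HasCompactSupport f)
    (hf : Disjoint (tsupport f) (fourierSupport β g)) : fourierPairing β g f = 0 := by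
  have hloc : ∀ p : tsupport f, ∃ s : Set (E d),
      Distribution.IsVanishingOn (fourierPairing β g) s ∧ IsOpen s ∧ (p : E d) ∈ s := fun p =>
    (Distribution.notMem_dsupport_iff _).1 (Set.disjoint_left.1 hf p.2)
  choose s hs hso hps using hloc
  obtain ⟨t, ht⟩ := IsCompact.elim_finite_subcover hfc s hso
    (fun p hp => Set.mem_iUnion.2 ⟨⟨p, hp⟩, hps ⟨p, hp⟩⟩)
  obtain ⟨ρ, hρ⟩ := SmoothPartitionOfUnity.exists_isSubordinate (modelWithCornersSelf ℝ (E d))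
    (isClosed_tsupport f) (fun i : t => s i) (fun i => hso i)
    (by simpa [Set.iUnion_subtype] using ht)
  have hsm : ∀ i, ContDiff ℝ ∞ (fun p => (ρ i p : ℂ) * f p) := fun i =>
    (Complex.ofRealCLM.contDiff.comp (ρ i).contMDiff.contDiff).mul (f.smooth ⊤)
  have hcs : ∀ i, HasCompactSupport (fun p => (ρ i p : ℂ) * f p) := fun i => hfc.mul_left
  have hsum : f = ∑ i : t, (hcs i).toSchwartzMap (hsm i) := by
    ext p
    simp only [sum_apply]
    change f p = ∑ i : t, (ρ i p : ℂ) * f p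
    by_cases hp : p ∈ tsupport f
    · have h1 := ρ.sum_eq_one hp
      rw [finsum_eq_sum_of_fintype] at h1
      rw [← Finset.sum_mul, ← Complex.ofReal_sum, h1]
      simp
    · simp [image_eq_zero_of_notMem_tsupport hp]
  rw [hsum, fourierPairing_sum hT hg]
  refine Finset.sum_eq_zero fun i _ => hs i _ ?_
  have h1 : tsupport (fun p => (ρ i p : ℂ) * f p) ⊆ tsupport fun p => (ρ i p : ℂ) :=
    tsupport_mul_subset_left
  have h2 : tsupport (fun p => (ρ i p : ℂ)) ⊆ tsupport (ρ i) :=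
    closure_mono fun p hp => by simpa using hp
  exact (h1.trans h2).trans (hρ i)

/-- A point is outside of the closure of a union of supports if and only if all pairings vanish on
test functions supported in a fixed ball. -/
lemma notMem_closure_iUnion_fourierSupport (hT : IsFrequencyEquiv β T) {G : Set (E d → ℂ)}
    (hG : ∀ g ∈ G, IsBddCont g) (p : E d) :
    p ∉ closure (⋃ g ∈ G, fourierSupport β g) ↔
      ∃ r > 0, ∀ g ∈ G, ∀ f : 𝓢(E d, ℂ), tsupport f ⊆ Metric.ball p r →
        fourierPairing β g f = 0 := by
  constructor
  · intro hp
    obtain ⟨r, hr, hsub⟩ := Metric.isOpen_iff.1 isClosed_closure.isOpen_compl p hp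
    refine ⟨r, hr, fun g hgG f hf => fourierPairing_eq_zero_of_disjoint hT (hG g hgG)
      (hasCompactSupport_of_tsupport_subset_ball hf) ?_⟩
    refine Set.disjoint_left.2 fun q hq hqs => hsub (hf hq) (subset_closure ?_)
    exact Set.mem_biUnion hgG hqs
  · rintro ⟨r, hr, h⟩ hp
    obtain ⟨q, hq, hqU⟩ := mem_closure_iff.1 hp _ Metric.isOpen_ball (Metric.mem_ball_self hr)
    simp only [Set.mem_iUnion] at hqU
    obtain ⟨g, hgG, hqg⟩ := hqU
    exact (Distribution.notMem_dsupport_iff q).2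
      ⟨Metric.ball p r, fun f hf => h g hgG f hf, Metric.isOpen_ball, hq⟩ hqg

/-! ### Reflections, conjugates and constants -/

/-- Conjugation turns `e^{-ipx}` into `e^{ipx}`, so momentum space is reflected. This and the next
lemma produce the signs `±` in the theorem. -/
lemma fourierPairing_conj (g : E d → ℂ) (f : 𝓢(E d, ℂ)) :
    fourierPairing β (fun x => conj (g x)) f
      = conj (fourierPairing β g (schwartzNeg (schwartzConj f))) := by
  simp only [fourierPairing, map_mul, Complex.conj_ofReal, ← integral_conj]
  congr 2
  funext x
  congr 1
  rw [← integral_neg_eq_self]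
  refine integral_congr_ae (ae_of_all _ fun p => ?_)
  simp [← Complex.exp_conj]

lemma fourierPairing_neg (g : E d → ℂ) (f : 𝓢(E d, ℂ)) :
    fourierPairing β (fun x => g (-x)) f = fourierPairing β g (schwartzNeg f) := by
  simp only [fourierPairing]
  congr 1
  rw [← integral_neg_eq_self]
  congr 1
  funext x
  rw [neg_neg]
  congr 1
  rw [← integral_neg_eq_self]
  refine integral_congr_ae (ae_of_all _ fun p => ?_)
  simp

lemma FourierInL1.conj {g : E d → ℂ} (hg : FourierInL1 β g) :
    FourierInL1 β (fun x => conj (g x)) := by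
  obtain ⟨h, hh, hpair⟩ := hg
  refine ⟨fun p => conj (h (-p)), ?_, fun f => ?_⟩
  · exact (Complex.conjCLE.integrable_comp_iff.2 hh.comp_neg)
  · rw [fourierPairing_conj, hpair, ← integral_conj, ← integral_neg_eq_self]
    refine integral_congr_ae (ae_of_all _ fun p => ?_)
    simp

lemma FourierInL1.neg {g : E d → ℂ} (hg : FourierInL1 β g) :
    FourierInL1 β (fun x => g (-x)) := by
  obtain ⟨h, hh, hpair⟩ := hg
  refine ⟨fun p => h (-p), hh.comp_neg, fun f => ?_⟩
  rw [fourierPairing_neg, hpair, ← integral_neg_eq_self]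
  refine integral_congr_ae (ae_of_all _ fun p => ?_)
  simp

/-- Fourier inversion at the origin: the integral of `𝓕 f` is `f 0`. -/
lemma fourierPairing_const (hT : IsFrequencyEquiv β T) (k : ℂ) (f : 𝓢(E d, ℂ)) :
    fourierPairing β (fun _ => k) f = pairingConst hT * (k * f 0) := by
  rw [fourierPairing_eq hT, integral_const_mul]
  congr 2
  have h : 𝓕⁻ (𝓕 f) = f := FourierTransform.fourierInv_fourier_eq f
  have h0 := DFunLike.congr_fun h (0 : E d)
  rw [SchwartzMap.fourierInv_coe, Real.fourierInv_eq'] at h0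
  simpa using h0

lemma fourierSupport_const_subset (hT : IsFrequencyEquiv β T) (k : ℂ) :
    fourierSupport β (fun _ : E d => k) ⊆ {0} := by
  intro p hp
  by_contra hne
  refine (Distribution.notMem_dsupport_iff p).2 ⟨{0}ᶜ, fun f hf => ?_,
    isOpen_compl_singleton, hne⟩ hp
  rw [fourierPairing_const hT, image_eq_zero_of_notMem_tsupport
    (Set.subset_compl_singleton_iff.1 hf)]
  simp

lemma zero_mem_fourierSupport_const (hT : IsFrequencyEquiv β T) {k : ℂ} (hk : k ≠ 0) :
    (0 : E d) ∈ fourierSupport β (fun _ : E d => k) := by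
  refine (Distribution.mem_dsupport_iff_forall_exists_ne _).2 fun s hs hso => ?_
  obtain ⟨u, h₁, h₂, h₃, -, h₄⟩ :=
    exists_contDiff_tsupport_subset (n := ⊤) ((IsOpen.mem_nhds_iff hso).mpr hs)
  have h₁' : tsupport (Complex.ofRealCLM ∘ u) ⊆ s := (tsupport_comp_subset rfl _).trans h₁
  have h₂' : HasCompactSupport (Complex.ofRealCLM ∘ u) := h₂.comp_left rfl
  refine ⟨h₂'.toSchwartzMap (Complex.ofRealCLM.contDiff.comp h₃), h₁', ?_⟩
  rw [fourierPairing_const hT]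
  exact mul_ne_zero (pairingConst_ne_zero hT) (mul_ne_zero hk (by simp [h₄]))

end ArvesonSpectral
end

noncomputable section

namespace ArvesonSpectral

open scoped FourierTransform ContDiff ComplexConjugate

/-! ### Bounded functions whose Fourier transform is supported in a point -/

lemma tendsto_integral_norm_translate_sub {d : ℕ} (ψ : 𝓢(E d, ℂ)) :
    Tendsto (fun h : E d => ∫ z, ‖ψ (z - h) - ψ z‖) (𝓝 0) (𝓝 0) := by
  set C := 2 ^ (d + 1) * ((Finset.Iic (d + 1, 0)).sup fun m => SchwartzMap.seminorm ℂ m.1 m.2) ψ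
  have hC : ∀ x, (1 + ‖x‖) ^ (d + 1) * ‖ψ x‖ ≤ C := fun x => by
    simpa using SchwartzMap.one_add_le_sup_seminorm_apply (𝕜 := ℂ) (m := (d + 1, 0))
      (le_refl _) (le_refl _) ψ x
  have hb : ∀ z h : E d, ‖h‖ ≤ 1 → ‖ψ (z - h)‖ ≤ C * 2 ^ (d + 1) * (1 + ‖z‖) ^ (-((d : ℝ) + 1)) := by
    intro z h hh
    -- For `‖h‖ ≤ 1` the decay of the translates is uniform up to a factor `2` per power, which
    -- yields one integrable dominating function.
    have h1 : 1 + ‖z‖ ≤ 2 * (1 + ‖z - h‖) := by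
      have := norm_add_le (z - h) h
      rw [sub_add_cancel] at this
      have := norm_nonneg (z - h)
      linarith
    have h2 : (1 + ‖z‖) ^ (d + 1) * ‖ψ (z - h)‖ ≤ C * 2 ^ (d + 1) :=
      calc _ ≤ (2 * (1 + ‖z - h‖)) ^ (d + 1) * ‖ψ (z - h)‖ := by gcongr
        _ = 2 ^ (d + 1) * ((1 + ‖z - h‖) ^ (d + 1) * ‖ψ (z - h)‖) := by rw [mul_pow]; ring
        _ ≤ 2 ^ (d + 1) * C := by gcongr; exact hC _
        _ = _ := by ring
    have hpos : (0 : ℝ) < (1 + ‖z‖) ^ (d + 1) := by positivity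
    rw [Real.rpow_neg (by positivity), ← div_eq_mul_inv,
      show (d : ℝ) + 1 = ((d + 1 : ℕ) : ℝ) by push_cast; ring, Real.rpow_natCast,
      le_div_iff₀ hpos]
    linarith
  have hint : Integrable (fun z : E d => 2 * (C * 2 ^ (d + 1) * (1 + ‖z‖) ^ (-((d : ℝ) + 1)))) := by
    refine (Integrable.const_mul ?_ _).const_mul _
    exact integrable_one_add_norm (by simp)
  have h0 : (0 : ℝ) = ∫ z, ‖ψ (z - 0) - ψ z‖ := by simp
  conv => rw [h0]
  refine tendsto_integral_filter_of_dominated_convergence _ ?_ ?_ hint ?_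
  · exact Eventually.of_forall fun h => Continuous.aestronglyMeasurable (by fun_prop)
  · filter_upwards [Metric.closedBall_mem_nhds (0 : E d) one_pos] with h hh
    refine ae_of_all _ fun z => ?_
    have h1 := hb z h (by simpa using hh)
    have h2 := hb z 0 (by simp)
    rw [sub_zero] at h2
    rw [norm_norm]
    exact (norm_sub_le _ _).trans (by linarith)
  · refine ae_of_all _ fun z => ?_
    have : Continuous fun h => ‖ψ (z - h) - ψ z‖ := by fun_prop
    exact this.tendsto 0

/-- The function `p ↦ η (t p) e^{2πi⟨b,p⟩}` for a bump function `η`. -/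
def modulatedBump {d : ℕ} (η : ContDiffBump (0 : E d)) (b : E d) {t : ℝ} (ht : 0 < t) :
    𝓢(E d, ℂ) :=
  HasCompactSupport.toSchwartzMap
    (f := fun p => (η (t • p) : ℂ) * Complex.exp (((2 * Real.pi * ⟪p, b⟫_ℝ : ℝ) : ℂ) * Complex.I))
    (by
      refine HasCompactSupport.mul_right ?_
      exact (η.hasCompactSupport.comp_smul ht.ne').comp_left (g := fun r : ℝ => (r : ℂ)) rfl)
    (by
      refine ContDiff.mul ?_ ?_
      · exact Complex.ofRealCLM.contDiff.comp (η.contDiff.comp (contDiff_const_smul t))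
      · refine ContDiff.cexp (ContDiff.mul ?_ contDiff_const)
        exact Complex.ofRealCLM.contDiff.comp
          (contDiff_const.mul (contDiff_id.inner ℝ contDiff_const)))

lemma modulatedBump_apply {d : ℕ} (η : ContDiffBump (0 : E d)) (b : E d) {t : ℝ} (ht : 0 < t)
    (p : E d) : modulatedBump η b ht p =
      (η (t • p) : ℂ) * Complex.exp (((2 * Real.pi * ⟪p, b⟫_ℝ : ℝ) : ℂ) * Complex.I) := rfl

lemma fourier_modulatedBump {d : ℕ} (η : ContDiffBump (0 : E d)) (b : E d) {t : ℝ} (ht : 0 < t)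
    (y : E d) : 𝓕 (modulatedBump η b ht) y =
      ((t⁻¹ ^ d : ℝ) : ℂ) * 𝓕 (modulatedBump η 0 one_pos) (t⁻¹ • (y - b)) := by
  rw [SchwartzMap.fourier_coe, SchwartzMap.fourier_coe, Real.fourier_eq', Real.fourier_eq']
  set F : E d → ℂ := fun v => Complex.exp (((-2 * Real.pi * ⟪v, t⁻¹ • (y - b)⟫_ℝ : ℝ) : ℂ) *
    Complex.I) • (modulatedBump η 0 one_pos) v with hF
  have h := Measure.integral_comp_smul (volume : Measure (E d)) F t
  have h' : ∫ v, F (t • v) = ((t⁻¹ ^ d : ℝ) : ℂ) * ∫ v, F v := by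
    rw [h, finrank_euclideanSpace_fin, abs_of_pos (by positivity), inv_pow, Complex.real_smul]
  rw [← h']
  refine integral_congr_ae (ae_of_all _ fun v => ?_)
  simp only [hF, modulatedBump_apply, smul_eq_mul, one_smul, inner_zero_right, mul_zero,
    Complex.ofReal_zero, zero_mul, Complex.exp_zero, mul_one]
  rw [real_inner_smul_left, real_inner_smul_right, mul_left_comm, ← Complex.exp_add, mul_comm]
  congr 2
  rw [← mul_assoc t, mul_inv_cancel₀ ht.ne', inner_sub_right]
  push_cast
  ring

lemma integral_mul_fourier_modulatedBump {d : ℕ} (η : ContDiffBump (0 : E d)) (G : E d → ℂ)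
    (b : E d) {t : ℝ} (ht : 0 < t) :
    ∫ y, G y * 𝓕 (modulatedBump η b ht) y =
      ∫ z, G (t • z + b) * 𝓕 (modulatedBump η 0 one_pos) z := by
  simp only [fourier_modulatedBump η b ht]
  rw [← integral_add_right_eq_self _ b]
  set F : E d → ℂ := fun z => G (t • z + b) * 𝓕 (modulatedBump η 0 one_pos) z with hF
  have h := Measure.integral_comp_smul (volume : Measure (E d)) F t⁻¹
  rw [finrank_euclideanSpace_fin, abs_of_pos (by positivity), inv_pow, inv_inv,
    Complex.real_smul] at h
  have h2 : ∫ v, F v = ((t⁻¹ ^ d : ℝ) : ℂ) * ∫ v, F (t⁻¹ • v) := by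
    rw [h, ← mul_assoc, ← Complex.ofReal_mul, inv_pow,
      inv_mul_cancel₀ (by positivity)]
    simp
  rw [h2, ← integral_const_mul]
  refine integral_congr_ae (ae_of_all _ fun v => ?_)
  simp only [hF, smul_smul, mul_inv_cancel₀ ht.ne', one_smul, add_sub_cancel_right]
  ring

/-- Average `G` around `b` at scale `t` with weight `ψ`. The hypothesis makes the average
independent of `t`. As `t → 0` it tends to `G b`; as `t → ∞` it forgets `b`, because moving the
centre shifts `ψ` by only `b / t`. Hence `G` is constant. -/
lemma eq_apply_zero_of_forall_integral_eq_zero {d : ℕ} {G : E d → ℂ} (hG : IsBddCont G)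
    (h : ∀ f : 𝓢(E d, ℂ), HasCompactSupport f → 0 ∉ tsupport f → ∫ y, G y * 𝓕 f y = 0) (b : E d) :
    G b = G 0 := by
  let η : ContDiffBump (0 : E d) := ⟨1, 2, one_pos, one_lt_two⟩
  set ψ := 𝓕 (modulatedBump η 0 one_pos) with hψ
  set J : E d → ℝ → ℂ := fun b t => ∫ z, G (t • z + b) * ψ z with hJ
  have hψint : ∫ z, ψ z = 1 := by
    have h : 𝓕⁻ ψ = modulatedBump η 0 one_pos := FourierTransform.fourierInv_fourier_eq _
    have h0 := DFunLike.congr_fun h (0 : E d)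
    rw [SchwartzMap.fourierInv_coe, Real.fourierInv_eq', modulatedBump_apply] at h0
    simpa [η.one_of_mem_closedBall (Metric.mem_closedBall_self zero_le_one)] using h0
  obtain ⟨C, hC⟩ := hG.2
  have hconst : ∀ b : E d, ∀ t s : ℝ, 0 < t → 0 < s → J b t = J b s := by
    intro b t s ht hs
    -- Near the origin both bumps equal the same exponential `e^{2πi⟨b,p⟩}`, so their difference
    -- vanishes there and is an admissible test function.
    have h1 := h (modulatedBump η b ht - modulatedBump η b hs) ?_ ?_
    · have hsub : 𝓕 (modulatedBump η b ht - modulatedBump η b hs) =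
          𝓕 (modulatedBump η b ht) - 𝓕 (modulatedBump η b hs) :=
        map_sub (FourierTransform.fourierCLM ℂ 𝓢(E d, ℂ)) _ _
      simp only [hsub, sub_apply, mul_sub] at h1
      rw [integral_sub (hG.integrable_mul (SchwartzMap.integrable _))
        (hG.integrable_mul (SchwartzMap.integrable _)),
        integral_mul_fourier_modulatedBump η G b ht,
        integral_mul_fourier_modulatedBump η G b hs] at h1
      exact sub_eq_zero.1 h1
    · refine HasCompactSupport.sub ?_ ?_ <;>
      · refine HasCompactSupport.mul_right ?_
        exact (η.hasCompactSupport.comp_smul (by positivity)).comp_left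
          (g := fun r : ℝ => (r : ℂ)) rfl
    · rw [notMem_tsupport_iff_eventuallyEq]
      have : ∀ t : ℝ, ∀ᶠ p : E d in 𝓝 0, η (t • p) = 1 := by
        intro t
        have hc : Tendsto (fun p : E d => t • p) (𝓝 0) (𝓝 0) := by
          have : Continuous fun p : E d => t • p := by fun_prop
          simpa using this.tendsto 0
        filter_upwards [hc (Metric.closedBall_mem_nhds (0 : E d) one_pos)] with p hp
        exact η.one_of_mem_closedBall hp
      filter_upwards [this t, this s] with p h1 h2
      simp [sub_apply, modulatedBump_apply, h1, h2]
  have hsmall : ∀ b, Tendsto (J b) (𝓝 0) (𝓝 (G b)) := by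
    intro b
    have h1 : G b = ∫ z, G ((0 : ℝ) • z + b) * ψ z := by
      simp only [zero_smul, zero_add]
      rw [integral_const_mul, hψint, mul_one]
    rw [h1]
    refine tendsto_integral_filter_of_dominated_convergence (fun z => C * ‖ψ z‖) ?_ ?_
      (ψ.integrable.norm.const_mul C) ?_
    · have := hG.1
      exact Eventually.of_forall fun t => Continuous.aestronglyMeasurable (by fun_prop)
    · refine Eventually.of_forall fun t => ae_of_all _ fun z => ?_
      rw [norm_mul]
      gcongr
      exact hC _
    · refine ae_of_all _ fun z => ?_
      have := hG.1
      have hc : Continuous fun t : ℝ => G (t • z + b) * ψ z := by fun_prop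
      exact hc.tendsto 0
  have hJG : ∀ b, ∀ t > 0, J b t = G b := by
    intro b t ht
    have h1 : Tendsto (J b) (𝓝[>] 0) (𝓝 (J b t)) :=
      tendsto_const_nhds.congr' (by
        filter_upwards [self_mem_nhdsWithin] with s hs using hconst b t s ht hs)
    exact tendsto_nhds_unique h1 ((hsmall b).mono_left nhdsWithin_le_nhds)
  have hshift : ∀ t : ℝ, 0 < t → J b t = ∫ z, G (t • z) * ψ (z - t⁻¹ • b) := by
    intro t ht
    rw [hJ]
    simp only
    rw [← integral_sub_right_eq_self _ (t⁻¹ • b)]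
    refine integral_congr_ae (ae_of_all _ fun z => ?_)
    simp only [smul_sub, smul_smul, mul_inv_cancel₀ ht.ne', one_smul, sub_add_cancel]
  have hlim : Tendsto (fun t : ℝ => C * ∫ z, ‖ψ (z - t⁻¹ • b) - ψ z‖) atTop (𝓝 0) := by
    have h1 : Tendsto (fun t : ℝ => t⁻¹ • b) atTop (𝓝 0) := by
      have := (tendsto_inv_atTop_zero (𝕜 := ℝ)).smul_const b
      rwa [zero_smul] at this
    simpa using ((tendsto_integral_norm_translate_sub ψ).comp h1).const_mul C
  have hle : ∀ᶠ t : ℝ in atTop, ‖G b - G 0‖ ≤ C * ∫ z, ‖ψ (z - t⁻¹ • b) - ψ z‖ := by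
    filter_upwards [eventually_gt_atTop 0] with t ht
    have hGt : IsBddCont fun z => G (t • z) := hG.comp (by fun_prop)
    have hi1 : Integrable fun z => ψ (z - t⁻¹ • b) := ψ.integrable.comp_sub_right _
    rw [← hJG b t ht, ← hJG 0 t ht, hshift t ht]
    simp only [hJ, add_zero]
    rw [← integral_sub (hGt.integrable_mul hi1) (hGt.integrable_mul ψ.integrable),
      ← integral_const_mul]
    refine norm_integral_le_of_norm_le ((hi1.sub ψ.integrable).norm.const_mul C)
      (ae_of_all _ fun z => ?_)
    rw [← mul_sub, norm_mul]
    gcongr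
    exact hC _
  have := ge_of_tendsto hlim hle
  exact sub_eq_zero.1 (norm_le_zero_iff.1 this)

variable {d : ℕ} {β : LinearMap.BilinForm ℝ (E d)} {T : E d ≃L[ℝ] E d}

/-- A bounded continuous function whose Fourier transform is supported in `{q}` is a multiple of
`x ↦ e^{iqx}`. -/
lemma eq_exp_of_fourierSupport_subset_singleton (hT : IsFrequencyEquiv β T) {g : E d → ℂ}
    (hg : IsBddCont g) {q : E d} (hq : fourierSupport β g ⊆ {q}) (x : E d) :
    g x = Complex.exp (Complex.I * (β q x : ℂ)) * g 0 := by
  -- Demodulating by `e^{-iqx}` moves the Fourier support from `q` to `0`; the claim becomes that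
  -- `G` is constant.
  set G : E d → ℂ := fun y =>
    Complex.exp (((-2 * Real.pi * ⟪q, y⟫_ℝ : ℝ) : ℂ) * Complex.I) * g (T y) with hGdef
  have hG : IsBddCont G := by
    refine ⟨?_, ?_⟩
    · have h1 := hg.1
      have h2 : Continuous fun y : E d => ⟪q, y⟫_ℝ := by fun_prop
      fun_prop
    · obtain ⟨C, hC⟩ := hg.2
      refine ⟨C, fun y => ?_⟩
      rw [norm_mul, Complex.norm_exp_ofReal_mul_I, one_mul]
      exact hC _
  have key : ∀ f : 𝓢(E d, ℂ), HasCompactSupport f → 0 ∉ tsupport f → ∫ y, G y * 𝓕 f y = 0 := by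
    intro f hf h0
    -- The translate by `q` of a function vanishing near `0` vanishes near `q`, so its support
    -- misses that of `g̃`.
    set f' := SchwartzMap.compSubConstCLM ℂ q f with hf'
    have hts : tsupport f' = (Homeomorph.subRight q) ⁻¹' tsupport f :=
      tsupport_comp_eq_preimage (f : E d → ℂ) (Homeomorph.subRight q)
    have hfc : HasCompactSupport f' := by
      rw [HasCompactSupport, hts]
      exact (Homeomorph.subRight q).isCompact_preimage.2 hf
    have h1 : fourierPairing β g f' = 0 := by
      refine fourierPairing_eq_zero_of_disjoint hT hg hfc ?_
      refine (Set.disjoint_singleton_right.2 ?_).mono_right hq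
      rw [hts]
      simpa using h0
    rw [fourierPairing_eq hT] at h1
    rw [← (mul_eq_zero.1 h1).resolve_left (pairingConst_ne_zero hT)]
    refine integral_congr_ae (ae_of_all _ fun y => ?_)
    have h2 : 𝓕 f' y =
        Complex.exp (((-2 * Real.pi * ⟪q, y⟫_ℝ : ℝ) : ℂ) * Complex.I) * 𝓕 f y := by
      rw [SchwartzMap.fourier_coe, SchwartzMap.fourier_coe, Real.fourier_eq', Real.fourier_eq',
        ← integral_const_mul, ← integral_add_right_eq_self _ q]
      refine integral_congr_ae (ae_of_all _ fun p => ?_)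
      simp only [hf', SchwartzMap.compSubConstCLM_apply, add_sub_cancel_right, smul_eq_mul]
      rw [← mul_assoc, ← Complex.exp_add, inner_add_left]
      congr 2
      push_cast
      ring
    simp only [hGdef, h2]
    ring
  have h3 := eq_apply_zero_of_forall_integral_eq_zero hG key (T.symm x)
  simp only [hGdef, inner_zero_right, mul_zero, Complex.ofReal_zero, zero_mul, Complex.exp_zero,
    one_mul, map_zero, ContinuousLinearEquiv.apply_symm_apply] at h3
  have h4 : β q x = 2 * Real.pi * ⟪q, T.symm x⟫_ℝ := by
    rw [← hT, ContinuousLinearEquiv.apply_symm_apply]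
  rw [← h3, ← mul_assoc, ← Complex.exp_add, h4]
  have : Complex.I * ((2 * Real.pi * ⟪q, T.symm x⟫_ℝ : ℝ) : ℂ) +
      ((-2 * Real.pi * ⟪q, T.symm x⟫_ℝ : ℝ) : ℂ) * Complex.I = 0 := by
    push_cast
    ring
  rw [this, Complex.exp_zero, one_mul]

end ArvesonSpectral
end

noncomputable section

namespace ArvesonSpectral

open scoped FourierTransform ContDiff ComplexConjugate

/-! ### Translations and modulations of Schwartz functions -/

section Modulation

variable {d : ℕ}

/-- The function `p ↦ e^{-2πi⟨p,z⟩} f(p)`, given by translating the Fourier transform. -/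
def schwartzMod (z : E d) (f : 𝓢(E d, ℂ)) : 𝓢(E d, ℂ) :=
  𝓕⁻ (SchwartzMap.compSubConstCLM ℂ (-z) (𝓕 f))

lemma fourier_schwartzMod (z : E d) (f : 𝓢(E d, ℂ)) (x : E d) :
    𝓕 (schwartzMod z f) x = 𝓕 f (x + z) := by
  rw [schwartzMod, FourierTransform.fourier_fourierInv_eq, SchwartzMap.compSubConstCLM_apply,
    sub_neg_eq_add]

lemma schwartzMod_apply (z : E d) (f : 𝓢(E d, ℂ)) (p : E d) :
    schwartzMod z f p =
      Complex.exp (((-2 * Real.pi * ⟪p, z⟫_ℝ : ℝ) : ℂ) * Complex.I) * f p := by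
  have h : 𝓕⁻ (𝓕 f) p = f p := DFunLike.congr_fun (FourierTransform.fourierInv_fourier_eq f) p
  rw [schwartzMod, ← h, SchwartzMap.fourierInv_coe, SchwartzMap.fourierInv_coe,
    Real.fourierInv_eq', Real.fourierInv_eq', ← integral_const_mul,
    ← integral_sub_right_eq_self _ z]
  refine integral_congr_ae (ae_of_all _ fun x => ?_)
  simp only [SchwartzMap.compSubConstCLM_apply, sub_neg_eq_add, sub_add_cancel, smul_eq_mul]
  rw [← mul_assoc, ← Complex.exp_add, inner_sub_left, real_inner_comm p z]
  congr 2
  push_cast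
  ring

lemma integral_conj_fourier_mul_fourier (f g : 𝓢(E d, ℂ)) :
    ∫ x, conj (𝓕 f x) * 𝓕 g x = ∫ p, conj (f p) * g p := by
  have h := SchwartzMap.integral_inner_fourier_fourier f g
  simpa only [RCLike.inner_apply, mul_comm] using h

/-- Plancherel after writing the translate as a modulation. This identity is what makes `f ↦ U(f)`
compatible with products. -/
lemma integral_conj_fourier_mul_fourier_add (f g : 𝓢(E d, ℂ)) (z : E d) :
    ∫ x, conj (𝓕 f x) * 𝓕 g (x + z) = 𝓕 (schwartzMul (schwartzConj f) g) z := by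
  simp only [← fourier_schwartzMod]
  rw [integral_conj_fourier_mul_fourier, SchwartzMap.fourier_coe, Real.fourier_eq']
  refine integral_congr_ae (ae_of_all _ fun p => ?_)
  simp only [schwartzMod_apply, schwartzMul_apply, schwartzConj_apply, smul_eq_mul]
  ring

lemma fourier_schwartzConj (f : 𝓢(E d, ℂ)) (y : E d) :
    𝓕 (schwartzConj f) y = conj (𝓕 f (-y)) := by
  rw [SchwartzMap.fourier_coe, SchwartzMap.fourier_coe, Real.fourier_eq', Real.fourier_eq',
    ← integral_conj]
  refine integral_congr_ae (ae_of_all _ fun p => ?_)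
  simp only [smul_eq_mul, schwartzConj_apply, map_mul, ← Complex.exp_conj, Complex.conj_ofReal,
    Complex.conj_I, inner_neg_right]
  congr 2
  push_cast
  ring

end Modulation

/-! ### Smeared unitary groups -/

namespace UnitaryGroup

variable {d : ℕ} {H : Type*} [NormedAddCommGroup H] [InnerProductSpace ℂ H]
  (U : UnitaryGroup d H) (T : E d ≃L[ℝ] E d)

lemma continuous_comp (Ψ : H) : Continuous fun y => U.toFun (T y) Ψ :=
  (U.continuous_apply Ψ).comp T.continuous

lemma toFun_neg_apply (x : E d) (Ψ : H) : U.toFun x (U.toFun (-x) Ψ) = Ψ := by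
  rw [← U.map_add, add_neg_cancel, U.map_zero]

lemma symm_apply (x : E d) (Ψ : H) : (U.toFun x).symm Ψ = U.toFun (-x) Ψ := by
  rw [LinearIsometryEquiv.symm_apply_eq, toFun_neg_apply]

lemma inner_toFun_left (x : E d) (Φ Ψ : H) :
    ⟪U.toFun x Φ, Ψ⟫_ℂ = ⟪Φ, U.toFun (-x) Ψ⟫_ℂ := by
  rw [← (U.toFun x).inner_map_map Φ, toFun_neg_apply]

lemma isBddCont_inner (Φ Ψ : H) : IsBddCont fun x => ⟪Φ, U.toFun x Ψ⟫_ℂ := by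
  refine ⟨continuous_const.inner (U.continuous_apply Ψ), ‖Φ‖ * ‖Ψ‖, fun x => ?_⟩
  exact (norm_inner_le_norm _ _).trans (by rw [LinearIsometryEquiv.norm_map])

lemma integrable_smul {h : E d → ℂ} (hh : Integrable h) (Ψ : H) :
    Integrable fun y => h y • U.toFun (T y) Ψ := by
  refine (hh.norm.mul_const ‖Ψ‖).mono' (hh.1.smul (U.continuous_comp T Ψ).aestronglyMeasurable)
    (ae_of_all _ fun y => ?_)
  rw [norm_smul, LinearIsometryEquiv.norm_map]

/-- The operator `∫ f̂(y) U(T y) dy`. -/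
def smear (f : 𝓢(E d, ℂ)) : H →L[ℂ] H :=
  LinearMap.mkContinuous
    { toFun := fun Ψ => ∫ y, 𝓕 f y • U.toFun (T y) Ψ
      map_add' := fun Φ Ψ => by
        simp only [_root_.map_add, smul_add]
        exact integral_add (U.integrable_smul T (𝓕 f).integrable Φ)
          (U.integrable_smul T (𝓕 f).integrable Ψ)
      map_smul' := fun c Ψ => by
        simp only [_root_.map_smul, smul_comm _ c]
        exact integral_smul c _ }
    (∫ y, ‖𝓕 f y‖) (fun Ψ => by
      change ‖∫ y, 𝓕 f y • U.toFun (T y) Ψ‖ ≤ _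
      rw [← integral_mul_const]
      refine norm_integral_le_of_norm_le ((𝓕 f).integrable.norm.mul_const ‖Ψ‖)
        (ae_of_all _ fun y => ?_)
      rw [norm_smul, LinearIsometryEquiv.norm_map])

lemma smear_apply (f : 𝓢(E d, ℂ)) (Ψ : H) :
    U.smear T f Ψ = ∫ y, 𝓕 f y • U.toFun (T y) Ψ := rfl

lemma smear_add (f g : 𝓢(E d, ℂ)) (Ψ : H) :
    U.smear T (f + g) Ψ = U.smear T f Ψ + U.smear T g Ψ := by
  have h : 𝓕 (f + g) = 𝓕 f + 𝓕 g := _root_.map_add (FourierTransform.fourierCLM ℂ 𝓢(E d, ℂ)) _ _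
  simp only [smear_apply, h, add_apply, add_smul]
  exact integral_add (U.integrable_smul T (𝓕 f).integrable Ψ)
    (U.integrable_smul T (𝓕 g).integrable Ψ)

lemma smear_const_smul (c : ℂ) (f : 𝓢(E d, ℂ)) (Ψ : H) :
    U.smear T (c • f) Ψ = c • U.smear T f Ψ := by
  have h : 𝓕 (c • f) = c • 𝓕 f := map_smul (FourierTransform.fourierCLM ℂ 𝓢(E d, ℂ)) _ _
  simp only [smear_apply, h, smul_apply, smul_assoc]
  exact integral_smul c _

variable [CompleteSpace H]

lemma inner_smear (f : 𝓢(E d, ℂ)) (Φ Ψ : H) :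
    ⟪Φ, U.smear T f Ψ⟫_ℂ = ∫ y, 𝓕 f y * ⟪Φ, U.toFun (T y) Ψ⟫_ℂ := by
  rw [smear_apply, ← integral_inner (U.integrable_smul T (𝓕 f).integrable Ψ)]
  simp only [inner_smul_right]

lemma inner_smear_schwartzConj (f : 𝓢(E d, ℂ)) (Φ Ψ : H) :
    ⟪U.smear T (schwartzConj f) Φ, Ψ⟫_ℂ = ⟪Φ, U.smear T f Ψ⟫_ℂ := by
  rw [← inner_conj_symm, inner_smear, inner_smear, ← integral_conj, ← integral_neg_eq_self]
  refine integral_congr_ae (ae_of_all _ fun y => ?_)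
  simp only [fourier_schwartzConj, map_mul, Complex.conj_conj, neg_neg, inner_conj_symm]
  rw [inner_toFun_left, map_neg, neg_neg]

/-- By the group law the double integral depends on `U` only through the difference of the two group
parameters. Fubini then leaves the correlation of `𝓕 f` and `𝓕 g`, which is the transform of the
product. -/
lemma inner_smear_smear (f g : 𝓢(E d, ℂ)) (Φ Ψ : H) :
    ⟪U.smear T f Φ, U.smear T g Ψ⟫_ℂ =
      ⟪Φ, U.smear T (schwartzMul (schwartzConj f) g) Ψ⟫_ℂ := by
  set s : E d → ℂ := fun z => ⟪Φ, U.toFun (T z) Ψ⟫_ℂ with hs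
  have hsb : IsBddCont s := (U.isBddCont_inner Φ Ψ).comp T.continuous
  have h1 : ⟪U.smear T f Φ, U.smear T g Ψ⟫_ℂ =
      ∫ x, ∫ z, conj (𝓕 f x) * 𝓕 g (x + z) * s z := by
    rw [← inner_conj_symm, inner_smear, ← integral_conj]
    refine integral_congr_ae (ae_of_all _ fun x => ?_)
    simp only [map_mul, inner_conj_symm]
    rw [inner_smear, ← integral_const_mul, ← integral_add_left_eq_self _ x]
    refine integral_congr_ae (ae_of_all _ fun z => ?_)
    simp only [hs, _root_.map_add, U.map_add, LinearIsometryEquiv.inner_map_map]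
    ring
  have hconj : Integrable fun x => conj (𝓕 f x) :=
    Complex.conjCLE.integrable_comp_iff.2 (𝓕 f).integrable
  have hint : Integrable (Function.uncurry fun x z => conj (𝓕 f x) * 𝓕 g (x + z) * s z)
      (volume.prod volume) := by
    have hp : Integrable (fun q : E d × E d => conj (𝓕 f q.1) * 𝓕 g (q.1 + q.2))
        (volume.prod volume) :=
      (measurePreserving_prod_add volume volume).integrable_comp_of_integrable
        (hconj.mul_prod (𝓕 g).integrable)
    obtain ⟨C, hC⟩ := hsb.2
    refine hp.mul_bdd (hsb.1.comp continuous_snd).aestronglyMeasurable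
      (ae_of_all _ fun q => hC q.2)
  rw [h1, integral_integral_swap hint, inner_smear]
  refine integral_congr_ae (ae_of_all _ fun z => ?_)
  simp only
  rw [integral_mul_const, integral_conj_fourier_mul_fourier_add]

/-- The operators `∫ f̂(y) U(T y) dy` are bounded by the supremum norm of `f`. -/
lemma norm_smear_apply_le {f : 𝓢(E d, ℂ)} (hf : HasCompactSupport f) {C : ℝ}
    (hC : ∀ p, ‖f p‖ ≤ C) (Ψ : H) : ‖U.smear T f Ψ‖ ≤ C * ‖Ψ‖ := by
  have hC0 : 0 ≤ C := (norm_nonneg _).trans (hC 0)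
  -- With `C' > C` the function `C'^2 - |f|^2` stays strictly positive, so its square root is
  -- smooth.
  suffices h : ∀ C' > C, ‖U.smear T f Ψ‖ ≤ C' * ‖Ψ‖ by
    have hcont : Tendsto (fun C' : ℝ => C' * ‖Ψ‖) (𝓝[>] C) (𝓝 (C * ‖Ψ‖)) :=
      ((continuous_id.mul continuous_const).tendsto C).mono_left nhdsWithin_le_nhds
    refine ge_of_tendsto hcont ?_
    filter_upwards [self_mem_nhdsWithin] with C' hC' using h C' hC'
  intro C' hC'
  have hC'0 : 0 < C' := hC0.trans_lt hC'
  have hpos : ∀ p, 0 < C' ^ 2 - ‖f p‖ ^ 2 := fun p => by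
    have : ‖f p‖ < C' := (hC p).trans_lt hC'
    have := norm_nonneg (f p)
    nlinarith
  -- The root itself equals `C'` off `supp f`; subtracting `C'` makes it a test function. From
  -- `|f|^2 + (C' + k)^2 = C'^2` follows `‖U(f)Ψ‖^2 + ‖C'Ψ + U(k)Ψ‖^2 = C'^2‖Ψ‖^2`, which gives the
  -- bound.
  set k : E d → ℝ := fun p => √(C' ^ 2 - ‖f p‖ ^ 2) - C' with hk
  have hksm : ContDiff ℝ ∞ k := by
    refine ContDiff.sub (ContDiff.sqrt ?_ fun p => (hpos p).ne') contDiff_const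
    exact contDiff_const.sub ((f.smooth ⊤).norm_sq ℝ)
  have hkc : HasCompactSupport k := by
    refine hf.mono fun p hp => ?_
    contrapose! hp
    have : f p = 0 := by simpa using hp
    simp [hk, this, hC'0.le]
  have hkc' : HasCompactSupport (Complex.ofRealCLM ∘ k) := hkc.comp_left (_root_.map_zero _)
  set κ : 𝓢(E d, ℂ) := hkc'.toSchwartzMap (Complex.ofRealCLM.contDiff.comp hksm) with hκ
  have hκa : ∀ p, κ p = (k p : ℂ) := fun p => rfl
  have hsum : schwartzMul (schwartzConj f) f + (schwartzMul (schwartzConj κ) κ +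
      (2 * C' : ℂ) • κ) = 0 := by
    ext p
    have h1 : k p ^ 2 + 2 * C' * k p + ‖f p‖ ^ 2 = 0 := by
      have := Real.sq_sqrt (hpos p).le
      simp only [hk]
      nlinarith
    simp only [add_apply, smul_apply, schwartzMul_apply, schwartzConj_apply, hκa,
      Complex.conj_ofReal, Complex.conj_mul', smul_eq_mul]
    change _ = (0 : ℂ)
    exact_mod_cast (by linarith : ‖f p‖ ^ 2 + (k p * k p + 2 * C' * k p) = 0)
  have hκconj : schwartzConj κ = κ := by
    ext p
    simp [hκa]
  have h0 : U.smear T (0 : 𝓢(E d, ℂ)) Ψ = 0 := by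
    have := U.smear_const_smul T 0 (0 : 𝓢(E d, ℂ)) Ψ
    simpa using this
  have hA := congrArg (fun g => ⟪Ψ, U.smear T g Ψ⟫_ℂ) hsum
  simp only [smear_add, smear_const_smul, h0, inner_zero_right, inner_add_right,
    ← inner_smear_smear, inner_smul_right] at hA
  have hB : ‖C' • Ψ + U.smear T κ Ψ‖ ^ 2 =
      (C' * ‖Ψ‖) ^ 2 + 2 * C' * RCLike.re ⟪Ψ, U.smear T κ Ψ⟫_ℂ + ‖U.smear T κ Ψ‖ ^ 2 := by
    rw [@norm_add_sq ℂ, norm_smul, Real.norm_of_nonneg hC'0.le]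
    have : (C' • Ψ : H) = ((C' : ℝ) : ℂ) • Ψ := (Complex.coe_smul C' Ψ).symm
    rw [this, inner_smul_left, Complex.conj_ofReal]
    simp
    ring
  have hA' := congrArg Complex.re hA
  rw [inner_self_eq_norm_sq_to_K, inner_self_eq_norm_sq_to_K] at hA'
  have hA2 : ‖U.smear T f Ψ‖ ^ 2 + (‖U.smear T κ Ψ‖ ^ 2 +
      2 * C' * RCLike.re ⟪Ψ, U.smear T κ Ψ⟫_ℂ) = 0 := by
    rw [← Complex.zero_re, ← hA']
    simp [← Complex.ofReal_pow]
  have hB0 := sq_nonneg ‖C' • Ψ + U.smear T κ Ψ‖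
  refine abs_le_of_sq_le_sq' ?_ (by positivity) |>.2
  linarith

variable {T} {β : LinearMap.BilinForm ℝ (E d)}

lemma fourierPairing_inner (hT : IsFrequencyEquiv β T) (Φ Ψ : H) (f : 𝓢(E d, ℂ)) :
    fourierPairing β (fun x => ⟪Φ, U.toFun x Ψ⟫_ℂ) f =
      pairingConst hT * ⟪Φ, U.smear T f Ψ⟫_ℂ := by
  rw [fourierPairing_eq hT, inner_smear]
  simp only [mul_comm]

end UnitaryGroup

end ArvesonSpectral
end

noncomputable section

namespace ArvesonSpectral

open scoped FourierTransform ContDiff ComplexConjugate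

/-! ### The `L¹` norm by duality with test functions -/

lemma norm_convolution_normed_le {d : ℕ} (φ : ContDiffBump (0 : E d)) {σ : E d → ℂ}
    (hσ : ∀ p, ‖σ p‖ ≤ 1) (p : E d) :
    ‖convolution (φ.normed volume) σ (ContinuousLinearMap.lsmul ℝ ℝ) volume p‖ ≤ 1 := by
  rw [convolution_def, ← φ.integral_normed (μ := volume)]
  refine norm_integral_le_of_norm_le φ.integrable_normed (ae_of_all _ fun t => ?_)
  simp only [ContinuousLinearMap.lsmul_apply, norm_smul]
  rw [Real.norm_of_nonneg (φ.nonneg_normed t)]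
  exact mul_le_of_le_one_right (φ.nonneg_normed t) (hσ _)

/-- The ideal test function is the phase `conj h / |h|`, whose pairing with `h` is `∫ |h|`.
Mollifying it and cutting it off gives test functions bounded by `1` that converge to it almost
everywhere; dominated convergence concludes. -/
lemma integral_norm_le_of_forall_schwartz {d : ℕ} {h : E d → ℂ} (hh : Integrable h) {C : ℝ}
    (hC : ∀ f : 𝓢(E d, ℂ), HasCompactSupport f → (∀ p, ‖f p‖ ≤ 1) → ‖∫ p, h p * f p‖ ≤ C) :
    ∫ p, ‖h p‖ ≤ C := by
  -- Where `h` vanishes, `0⁻¹ = 0` makes `σ` vanish too.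
  set σ : E d → ℂ := fun p => conj (h p) * ((‖h p‖⁻¹ : ℝ) : ℂ) with hσdef
  have hσ1 : ∀ p, ‖σ p‖ ≤ 1 := fun p => by
    simp only [hσdef, norm_mul, RCLike.norm_conj, Complex.norm_real, norm_inv, norm_norm]
    exact mul_inv_le_one
  have hσm : AEStronglyMeasurable σ volume := by
    refine (Complex.continuous_conj.comp_aestronglyMeasurable hh.1).mul ?_
    exact Complex.continuous_ofReal.comp_aestronglyMeasurable
      (hh.1.norm.aemeasurable.inv.aestronglyMeasurable)
  have hσi : LocallyIntegrable σ volume := by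
    refine (locallyIntegrable_const (1 : ℝ)).mono hσm (ae_of_all _ fun p => ?_)
    simpa using hσ1 p
  have hhσ : ∀ p, h p * σ p = (‖h p‖ : ℂ) := fun p => by
    by_cases h0 : h p = 0
    · simp [h0]
    · simp only [hσdef]
      rw [← mul_assoc, Complex.mul_conj', Complex.ofReal_inv, pow_two, mul_assoc,
        mul_inv_cancel₀ (by simpa using h0), mul_one]
  -- The mollifiers shrink with the ratio of outer to inner radius fixed at `2`, as almost
  -- everywhere convergence of the convolutions requires.
  let φ : ℕ → ContDiffBump (0 : E d) := fun n =>
    ⟨1 / ((n : ℝ) + 1), 2 * (1 / ((n : ℝ) + 1)), by positivity, by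
      have : (0 : ℝ) < 1 / ((n : ℝ) + 1) := by positivity
      linarith⟩
  let χ : ℕ → ContDiffBump (0 : E d) := fun n =>
    ⟨(n : ℝ) + 1, (n : ℝ) + 2, by positivity, by linarith⟩
  set m : ℕ → E d → ℂ := fun n =>
    convolution ((φ n).normed volume) σ (ContinuousLinearMap.lsmul ℝ ℝ) volume with hm
  have hmlim : ∀ᵐ p, Tendsto (fun n => m n p) atTop (𝓝 (σ p)) := by
    refine ContDiffBump.ae_convolution_tendsto_right_of_locallyIntegrable (K := 2) ?_ ?_ hσi
    · simpa [φ] using (tendsto_one_div_add_atTop_nhds_zero_nat (𝕜 := ℝ)).const_mul 2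
    · exact Eventually.of_forall fun n => le_refl _
  have hmsm : ∀ n, ContDiff ℝ ∞ (m n) := fun n =>
    (φ n).hasCompactSupport_normed.contDiff_convolution_left _ (φ n).contDiff_normed hσi
  have hm1 : ∀ n p, ‖m n p‖ ≤ 1 := fun n p => norm_convolution_normed_le (φ n) hσ1 p
  have hcs : ∀ n, HasCompactSupport fun p => (χ n p : ℂ) * m n p := fun n =>
    HasCompactSupport.mul_right ((χ n).hasCompactSupport.comp_left (g := fun r : ℝ => (r : ℂ)) rfl)
  have hsm : ∀ n, ContDiff ℝ ∞ fun p => (χ n p : ℂ) * m n p := fun n =>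
    (Complex.ofRealCLM.contDiff.comp (χ n).contDiff).mul (hmsm n)
  set f : ℕ → 𝓢(E d, ℂ) := fun n => (hcs n).toSchwartzMap (hsm n) with hf
  have hfa : ∀ n p, f n p = (χ n p : ℂ) * m n p := fun n p => rfl
  have hf1 : ∀ n p, ‖f n p‖ ≤ 1 := fun n p => by
    rw [hfa, norm_mul, Complex.norm_real, Real.norm_of_nonneg (χ n).nonneg]
    exact mul_le_one₀ (χ n).le_one (norm_nonneg _) (hm1 n p)
  have hχ : ∀ p, ∀ᶠ n in atTop, χ n p = 1 := fun p => by
    obtain ⟨N, hN⟩ := exists_nat_ge ‖p‖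
    filter_upwards [eventually_ge_atTop N] with n hn
    refine (χ n).one_of_mem_closedBall ?_
    have : (N : ℝ) ≤ n := by exact_mod_cast hn
    simp only [mem_closedBall_zero_iff, χ]
    linarith
  have hlim : Tendsto (fun n => ∫ p, h p * f n p) atTop (𝓝 (∫ p, (‖h p‖ : ℂ))) := by
    refine tendsto_integral_of_dominated_convergence (fun p => ‖h p‖) (fun n => ?_) hh.norm
      (fun n => ae_of_all _ fun p => ?_) ?_
    · exact hh.1.mul (f n).continuous.aestronglyMeasurable
    · rw [norm_mul]
      exact mul_le_of_le_one_right (norm_nonneg _) (hf1 n p)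
    · filter_upwards [hmlim] with p hp
      rw [← hhσ p]
      refine Tendsto.const_mul _ (hp.congr' ?_)
      filter_upwards [hχ p] with n hn
      simp [hfa, hn]
  have hle := le_of_tendsto hlim.norm (Eventually.of_forall fun n => hC (f n) (hcs n) (hf1 n))
  rw [integral_complex_ofReal, Complex.norm_real] at hle
  exact (Real.le_norm_self _).trans hle

/-! ### Absolute continuity for a dense set of vectors -/

namespace UnitaryGroup

variable {d : ℕ} {H : Type*} [NormedAddCommGroup H] [InnerProductSpace ℂ H] [CompleteSpace H]
  (U : UnitaryGroup d H) {T : E d ≃L[ℝ] E d} {β : LinearMap.BilinForm ℝ (E d)}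

/-- The `L¹` distance of two spectral densities is tested against bounded `f`, where the difference
is a matrix element of `U(f)` and `‖U(f)‖ ≤ sup |f|` applies. -/
lemma integral_norm_sub_le (hT : IsFrequencyEquiv β T) {Φ Φ' χ : H} {h h' : E d → ℂ}
    (hh : Integrable h) (hh' : Integrable h')
    (hp : ∀ f, fourierPairing β (fun x => ⟪Φ, U.toFun x χ⟫_ℂ) f = ∫ p, h p * f p)
    (hp' : ∀ f, fourierPairing β (fun x => ⟪Φ', U.toFun x χ⟫_ℂ) f = ∫ p, h' p * f p) :
    ∫ p, ‖h p - h' p‖ ≤ ‖pairingConst hT‖ * ‖χ‖ * ‖Φ - Φ'‖ := by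
  refine integral_norm_le_of_forall_schwartz (hh.sub hh') fun f hf hf1 => ?_
  have hi : ∀ {h : E d → ℂ}, Integrable h → Integrable fun p => h p * f p := fun hh =>
    hh.mul_bdd f.continuous.aestronglyMeasurable (ae_of_all _ hf1)
  have h1 : ∫ p, (h - h') p * f p = pairingConst hT * ⟪Φ - Φ', U.smear T f χ⟫_ℂ := by
    simp only [Pi.sub_apply, sub_mul]
    rw [integral_sub (hi hh) (hi hh'), ← hp, ← hp', U.fourierPairing_inner hT,
      U.fourierPairing_inner hT, inner_sub_left, mul_sub]
  change ‖∫ p, (h - h') p * f p‖ ≤ _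
  rw [h1, norm_mul, mul_assoc]
  gcongr
  refine (norm_inner_le_norm _ _).trans ?_
  rw [mul_comm]
  gcongr
  simpa using U.norm_smear_apply_le T hf hf1 χ

/-- The density depends Lipschitz-continuously on the left vector in `L¹` norm, so an approximating
sequence from `D` has Cauchy densities; completeness of `L¹` supplies the density for `Φ`. -/
lemma fourierInL1_of_dense (hT : IsFrequencyEquiv β T) {D : Set H} (hD : Dense D) {χ : H}
    (h : ∀ Ψ ∈ D, FourierInL1 β fun x => ⟪Ψ, U.toFun x χ⟫_ℂ) (Φ : H) :
    FourierInL1 β fun x => ⟪Φ, U.toFun x χ⟫_ℂ := by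
  obtain ⟨Φs, hΦD, hΦ⟩ := mem_closure_iff_seq_limit.1 (hD Φ)
  choose hs hsi hsp using fun n => h (Φs n) (hΦD n)
  set F : ℕ → E d →₁[volume] ℂ := fun n => (hsi n).toL1 (hs n) with hF
  set M := ‖pairingConst hT‖ * ‖χ‖ with hM
  have hM0 : 0 ≤ M := by positivity
  have hdist : ∀ m n, dist (F m) (F n) ≤ M * dist (Φs m) (Φs n) := fun m n => by
    rw [dist_eq_norm, dist_eq_norm, hF]
    simp only
    rw [← Integrable.toL1_sub, L1.norm_of_fun_eq_integral_norm]
    exact U.integral_norm_sub_le hT (hsi m) (hsi n) (hsp m) (hsp n)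
  have hcauchy : CauchySeq F := by
    rw [Metric.cauchySeq_iff]
    intro ε hε
    obtain ⟨N, hN⟩ := Metric.cauchySeq_iff.1 hΦ.cauchySeq (ε / (M + 1)) (by positivity)
    refine ⟨N, fun m hm n hn => (hdist m n).trans_lt ?_⟩
    have := hN m hm n hn
    rw [lt_div_iff₀ (by positivity)] at this
    have := dist_nonneg (x := Φs m) (y := Φs n)
    nlinarith
  obtain ⟨G, hG⟩ := cauchySeq_tendsto_of_complete hcauchy
  refine ⟨G, L1.integrable_coeFn G, fun f => ?_⟩
  obtain ⟨C, hC⟩ : ∃ C, ∀ p, ‖f p‖ ≤ C :=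
    ⟨_, fun p => SchwartzMap.norm_le_seminorm ℂ f p⟩
  have hi : ∀ {h : E d → ℂ}, Integrable h → Integrable fun p => h p * f p := fun hh =>
    hh.mul_bdd f.continuous.aestronglyMeasurable (ae_of_all _ hC)
  have hl1 : Tendsto (fun n => ∫ p, hs n p * f p) atTop
      (𝓝 (fourierPairing β (fun x => ⟪Φ, U.toFun x χ⟫_ℂ) f)) := by
    simp only [← hsp, U.fourierPairing_inner hT]
    exact (hΦ.inner tendsto_const_nhds).const_mul _
  have hl2 : Tendsto (fun n => ∫ p, hs n p * f p) atTop (𝓝 (∫ p, G p * f p)) := by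
    rw [tendsto_iff_norm_sub_tendsto_zero]
    have hz : Tendsto (fun n => C * ‖F n - G‖) atTop (𝓝 0) := by
      simpa using (tendsto_iff_norm_sub_tendsto_zero.1 hG).const_mul C
    refine squeeze_zero (fun _ => norm_nonneg _) (fun n => ?_) hz
    rw [← integral_sub (hi (hsi n)) (hi (L1.integrable_coeFn G)), L1.norm_eq_integral_norm,
      ← integral_const_mul]
    refine norm_integral_le_of_norm_le ((L1.integrable_coeFn _).norm.const_mul C) ?_
    filter_upwards [(hsi n).coeFn_toL1, Lp.coeFn_sub (F n) G] with p h1 h2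
    rw [h2, Pi.sub_apply, hF]
    simp only
    rw [h1, ← sub_mul, norm_mul, mul_comm]
    gcongr
    exact hC p
  exact tendsto_nhds_unique hl1 hl2

end UnitaryGroup

end ArvesonSpectral
end

noncomputable section

namespace ArvesonSpectral

open scoped ComplexConjugate

/-! ### Irreducibility of GNS representations of pure states -/

lemma inner_self_eq_ofReal {H : Type*} [NormedAddCommGroup H] [InnerProductSpace ℂ H] (Ψ : H) :
    ⟪Ψ, Ψ⟫_ℂ = ((‖Ψ‖ ^ 2 : ℝ) : ℂ) := by
  rw [inner_self_eq_norm_sq_to_K, Complex.ofReal_pow]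
  rfl

section Pure

variable {𝔄 : Type*} [CStarAlgebra 𝔄] {H : Type*} [NormedAddCommGroup H] [InnerProductSpace ℂ H]
  [CompleteSpace H] {π : 𝔄 →⋆ₐ[ℂ] (H →L[ℂ] H)} {Ω : H} {ω : StrongDual ℂ 𝔄}

@[simp] lemma vectorFunctional_apply (Ψ Φ : H) (A : 𝔄) :
    vectorFunctional π Ψ Φ A = ⟪Ψ, π A Φ⟫_ℂ := rfl

lemma inner_map_star (π : 𝔄 →⋆ₐ[ℂ] (H →L[ℂ] H)) (A : 𝔄) (Ψ Φ : H) :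
    ⟪Ψ, π (star A) Φ⟫_ℂ = ⟪π A Ψ, Φ⟫_ℂ := by
  rw [map_star, ContinuousLinearMap.star_eq_adjoint, ContinuousLinearMap.adjoint_inner_right]

lemma inner_map_left (π : 𝔄 →⋆ₐ[ℂ] (H →L[ℂ] H)) (A : 𝔄) (Ψ Φ : H) :
    ⟪π (star A) Ψ, Φ⟫_ℂ = ⟪Ψ, π A Φ⟫_ℂ := by
  rw [← inner_map_star, star_star]

lemma inner_map_star_mul (π : 𝔄 →⋆ₐ[ℂ] (H →L[ℂ] H)) (A B : 𝔄) (Ψ Φ : H) :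
    ⟪Ψ, π (star A * B) Φ⟫_ℂ = ⟪π A Ψ, π B Φ⟫_ℂ := by
  rw [map_mul]
  exact inner_map_star π A Ψ (π B Φ)

lemma eq_zero_of_forall_inner_eq_zero {Φ Ψ : H} (hd : Dense (Set.range fun A => π A Φ))
    (h : ∀ A, ⟪Ψ, π A Φ⟫_ℂ = 0) : Ψ = 0 := by
  refine hd.eq_zero_of_inner_left (𝕜 := ℂ) ?_
  rintro _ ⟨A, rfl⟩
  exact h A

lemma IsGNSTriple.inner_self (hGNS : IsGNSTriple ω π Ω) (h1 : ω 1 = 1) : ⟪Ω, Ω⟫_ℂ = 1 := by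
  have := hGNS.inner_eq 1
  rwa [map_one, one_apply_eq_self, h1] at this

lemma IsGNSTriple.norm_eq_one (hGNS : IsGNSTriple ω π Ω) (h1 : ω 1 = 1) : ‖Ω‖ = 1 := by
  have h := hGNS.inner_self h1
  rw [inner_self_eq_ofReal] at h
  have h2 : ‖Ω‖ ^ 2 = 1 := by exact_mod_cast h
  nlinarith [norm_nonneg Ω]

/-- Self-adjoint operators in the commutant of the representation are scalars. -/
lemma IsPureState.exists_eq_smul_of_isSelfAdjoint (hω : IsPureState ω)
    (hGNS : IsGNSTriple ω π Ω) {S : H →L[ℂ] H} (hS : IsSelfAdjoint S)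
    (hcomm : ∀ A Ψ, S (π A Ψ) = π A (S Ψ)) : ∃ t : ℂ, ∀ Ψ, S Ψ = t • Ψ := by
  have hω1 : ω 1 = 1 := hω.1.2
  have hsym : ∀ Φ Ψ : H, ⟪S Φ, Ψ⟫_ℂ = ⟪Φ, S Ψ⟫_ℂ := fun Φ Ψ =>
    (ContinuousLinearMap.isSelfAdjoint_iff_isSymmetric.1 hS) Φ Ψ
  -- This size ensures `1/4 ≤ R ≤ 3/4` for `R = 1/2 + εS`, so that `R` and `1 - R` are both strictly
  -- positive operators in the commutant.
  set ε : ℝ := 1 / (4 * (‖S‖ + 1)) with hε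
  have hε0 : 0 < ε := by positivity
  set R : H →L[ℂ] H := (1 / 2 : ℂ) • 1 + (ε : ℂ) • S with hR
  have hRa : ∀ Ψ, R Ψ = (1 / 2 : ℂ) • Ψ + (ε : ℂ) • S Ψ := fun Ψ => rfl
  have hRcomm : ∀ A Ψ, R (π A Ψ) = π A (R Ψ) := fun A Ψ => by
    simp only [hRa, hcomm, map_add, map_smul]
  set q : H → ℝ := fun Ψ => 1 / 2 * ‖Ψ‖ ^ 2 + ε * RCLike.re ⟪S Ψ, Ψ⟫_ℂ with hq
  have hqR : ∀ Ψ, ⟪R Ψ, Ψ⟫_ℂ = (q Ψ : ℂ) := fun Ψ => by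
    have h1 : ((RCLike.re ⟪S Ψ, Ψ⟫_ℂ : ℝ) : ℂ) = ⟪S Ψ, Ψ⟫_ℂ := by
      refine RCLike.conj_eq_iff_re.1 ?_
      rw [inner_conj_symm, hsym]
    rw [hRa, inner_add_left, inner_smul_left, inner_smul_left, inner_self_eq_ofReal, hq]
    simp only [Complex.conj_ofReal, Complex.ofReal_add, Complex.ofReal_mul, h1]
    simp [Complex.conj_ofNat]
  have hbound : ∀ Ψ, |ε * RCLike.re ⟪S Ψ, Ψ⟫_ℂ| ≤ 1 / 4 * ‖Ψ‖ ^ 2 := fun Ψ => by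
    rw [abs_mul, abs_of_pos hε0]
    have h1 : |RCLike.re ⟪S Ψ, Ψ⟫_ℂ| ≤ ‖S‖ * ‖Ψ‖ ^ 2 :=
      calc _ ≤ ‖⟪S Ψ, Ψ⟫_ℂ‖ := RCLike.abs_re_le_norm _
        _ ≤ ‖S Ψ‖ * ‖Ψ‖ := norm_inner_le_norm _ _
        _ ≤ ‖S‖ * ‖Ψ‖ * ‖Ψ‖ := by gcongr; exact S.le_opNorm Ψ
        _ = _ := by ring
    calc _ ≤ ε * ((‖S‖ + 1) * ‖Ψ‖ ^ 2) := by
          gcongr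
          nlinarith [sq_nonneg ‖Ψ‖]
      _ = _ := by
          rw [hε]
          field_simp
  have hq0 : ∀ Ψ, 1 / 4 * ‖Ψ‖ ^ 2 ≤ q Ψ := fun Ψ => by
    have := (abs_le.1 (hbound Ψ)).1
    simp only [hq]
    linarith
  have hq1 : ∀ Ψ, q Ψ ≤ 3 / 4 * ‖Ψ‖ ^ 2 := fun Ψ => by
    have := (abs_le.1 (hbound Ψ)).2
    simp only [hq]
    linarith
  have hΩ1 := hGNS.norm_eq_one hω1
  set s := q Ω with hs
  have hs0 : 0 < s := by have := hq0 Ω; rw [hΩ1] at this; linarith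
  have hs1 : s < 1 := by have := hq1 Ω; rw [hΩ1] at this; linarith
  -- Splitting `Ω = RΩ + (Ω - RΩ)` decomposes `ω` as `s ω₁ + (1 - s) ω₂`. Purity forces `ω₁ = ω`,
  -- and cyclicity then gives `RΩ = sΩ`.
  set ω₁ : StrongDual ℂ 𝔄 := ((s⁻¹ : ℝ) : ℂ) • vectorFunctional π (R Ω) Ω with hω₁
  set ω₂ : StrongDual ℂ 𝔄 := (((1 - s)⁻¹ : ℝ) : ℂ) • vectorFunctional π (Ω - R Ω) Ω with hω₂
  have hRAA : ∀ A, ⟪R Ω, π (star A * A) Ω⟫_ℂ = (q (π A Ω) : ℂ) := fun A => by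
    rw [inner_map_star_mul, ← hRcomm, hqR]
  have hst1 : ω₁ ∈ states 𝔄 := by
    refine ⟨fun A => ?_, ?_⟩
    · rw [hω₁, smul_apply, vectorFunctional_apply, hRAA, smul_eq_mul,
        ← Complex.ofReal_mul]
      have := hq0 (π A Ω)
      exact_mod_cast mul_nonneg (inv_nonneg.2 hs0.le) (le_trans (by positivity) this)
    · rw [hω₁, smul_apply, vectorFunctional_apply, map_one,
        one_apply_eq_self, hqR, smul_eq_mul, ← Complex.ofReal_mul,
        inv_mul_cancel₀ hs0.ne', Complex.ofReal_one]
  have hst2 : ω₂ ∈ states 𝔄 := by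
    refine ⟨fun A => ?_, ?_⟩
    · rw [hω₂, smul_apply, vectorFunctional_apply, inner_sub_left, hRAA,
        inner_map_star_mul, inner_self_eq_ofReal, smul_eq_mul]
      have h1 := hq1 (π A Ω)
      have h2 : 0 ≤ (1 - s)⁻¹ * (‖π A Ω‖ ^ 2 - q (π A Ω)) :=
        mul_nonneg (inv_nonneg.2 (by linarith)) (by nlinarith [sq_nonneg ‖π A Ω‖])
      exact_mod_cast h2
    · rw [hω₂, smul_apply, vectorFunctional_apply, map_one,
        one_apply_eq_self, inner_sub_left, hqR, hGNS.inner_self hω1, smul_eq_mul,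
        ← Complex.ofReal_one, ← Complex.ofReal_sub, ← Complex.ofReal_mul,
        inv_mul_cancel₀ (by linarith)]
  have hseg : ω ∈ openSegment ℝ ω₁ ω₂ := by
    refine ⟨s, 1 - s, hs0, by linarith, by ring, ?_⟩
    ext A
    change s • ((s⁻¹ : ℝ) : ℂ) • ⟪R Ω, π A Ω⟫_ℂ +
      (1 - s) • (((1 - s)⁻¹ : ℝ) : ℂ) • ⟪Ω - R Ω, π A Ω⟫_ℂ = ω A
    rw [Complex.real_smul, Complex.real_smul, smul_eq_mul, smul_eq_mul, ← mul_assoc, ← mul_assoc,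
      ← Complex.ofReal_mul, ← Complex.ofReal_mul, mul_inv_cancel₀ hs0.ne',
      mul_inv_cancel₀ (by linarith), Complex.ofReal_one, one_mul, one_mul, ← inner_add_left,
      add_sub_cancel, hGNS.inner_eq]
  have heq : ω₁ = ω := hω.2 hst1 hst2 hseg
  have hRΩ : R Ω - (s : ℂ) • Ω = 0 := by
    refine eq_zero_of_forall_inner_eq_zero hGNS.cyclic fun A => ?_
    have h1 : ω₁ A = ω A := by rw [heq]
    rw [hω₁, smul_apply, vectorFunctional_apply, ← hGNS.inner_eq,
      smul_eq_mul] at h1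
    rw [inner_sub_left, inner_smul_left, Complex.conj_ofReal, ← h1, ← mul_assoc,
      ← Complex.ofReal_mul, mul_inv_cancel₀ hs0.ne', Complex.ofReal_one, one_mul, sub_self]
  have hεC : (ε : ℂ) ≠ 0 := by exact_mod_cast hε0.ne'
  have hSΩ : S Ω = ((ε : ℂ)⁻¹ * (s - 1 / 2)) • Ω := by
    rw [sub_eq_zero, hRa] at hRΩ
    rw [mul_smul, sub_smul, ← hRΩ, add_sub_cancel_left, smul_smul, inv_mul_cancel₀ hεC, one_smul]
  refine ⟨(ε : ℂ)⁻¹ * (s - 1 / 2), fun Ψ => ?_⟩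
  have hfun : (S : H → H) = fun Ψ => ((ε : ℂ)⁻¹ * (s - 1 / 2)) • Ψ := by
    refine Continuous.ext_on hGNS.cyclic S.continuous (by fun_prop) ?_
    rintro _ ⟨A, rfl⟩
    simp only [hcomm, hSΩ, map_smul]
  exact congrFun hfun Ψ

/-- The commutant of the GNS representation of a pure state is trivial. -/
lemma IsPureState.exists_eq_smul (hω : IsPureState ω) (hGNS : IsGNSTriple ω π Ω)
    {S : H →L[ℂ] H} (hcomm : ∀ A Ψ, S (π A Ψ) = π A (S Ψ)) : ∃ t : ℂ, ∀ Ψ, S Ψ = t • Ψ := by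
  have hstar : ∀ A Ψ, (star S) (π A Ψ) = π A ((star S) Ψ) := fun A Ψ => by
    refine ext_inner_left ℂ fun Φ => ?_
    rw [ContinuousLinearMap.star_eq_adjoint, ContinuousLinearMap.adjoint_inner_right,
      ← inner_map_left, ← hcomm, ← inner_map_left, ContinuousLinearMap.adjoint_inner_right]
  -- The adjoint also commutes with the representation, so the self-adjoint operators `S + S*` and
  -- `i(S - S*)` are scalars, and so is `S`.
  obtain ⟨a, ha⟩ := hω.exists_eq_smul_of_isSelfAdjoint hGNS (S := S + star S)
    (by rw [isSelfAdjoint_iff, star_add, star_star, add_comm])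
    (fun A Ψ => by simp [hcomm, hstar])
  obtain ⟨b, hb⟩ := hω.exists_eq_smul_of_isSelfAdjoint hGNS (S := Complex.I • (S - star S))
    (by
      rw [isSelfAdjoint_iff, star_smul, star_sub, star_star, Complex.star_def, Complex.conj_I,
        neg_smul, ← smul_neg, neg_sub])
    (fun A Ψ => by simp [hcomm, hstar])
  refine ⟨(1 / 2) * (a - Complex.I * b), fun Ψ => ?_⟩
  have h1 := ha Ψ
  have h2 := hb Ψ
  simp only [add_apply, smul_apply,
    sub_apply] at h1 h2
  rw [mul_smul, sub_smul, mul_smul, ← h1, ← h2, smul_smul, Complex.I_mul_I]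
  module

/-- The GNS representation of a pure state is irreducible. -/
lemma IsPureState.dense_range_apply (hω : IsPureState ω) (hGNS : IsGNSTriple ω π Ω) {Φ : H}
    (hΦ : Φ ≠ 0) : Dense (Set.range fun A => π A Φ) := by
  let e : 𝔄 →ₗ[ℂ] H :=
    { toFun := fun A => π A Φ, map_add' := by simp, map_smul' := by simp }
  set M : Submodule ℂ H := (LinearMap.range e).topologicalClosure with hM
  have hMclosed : IsClosed (M : Set H) := Submodule.isClosed_topologicalClosure _
  have : CompleteSpace M := hMclosed.completeSpace_coe
  have hinv : ∀ A, ∀ Ψ ∈ M, π A Ψ ∈ M := fun A => by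
    intro Ψ hΨ
    have hmaps : Set.MapsTo (π A) (LinearMap.range e : Set H) (LinearMap.range e : Set H) := by
      rintro _ ⟨B, rfl⟩
      exact ⟨A * B, by simp [e]⟩
    exact hmaps.closure (π A).continuous hΨ
  -- `M` is invariant under every `π(A)`, including `π(A*)`, so its orthogonal complement is
  -- invariant as well.
  have hcomm : ∀ A Ψ, M.starProjection (π A Ψ) = π A (M.starProjection Ψ) := fun A Ψ => by
    refine Submodule.eq_starProjection_of_mem_of_inner_eq_zero (hinv A _ (by simp))
      fun w hw => ?_
    rw [← map_sub, ← inner_map_star]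
    exact Submodule.starProjection_inner_eq_zero Ψ _ (hinv _ _ hw)
  obtain ⟨t, ht⟩ := hω.exists_eq_smul hGNS hcomm
  have hΦM : Φ ∈ M := Submodule.le_topologicalClosure _ ⟨1, by simp [e]⟩
  have h1 : t • Φ = (1 : ℂ) • Φ := by
    rw [← ht, one_smul]
    exact Submodule.starProjection_eq_self_iff.2 hΦM
  have ht1 : t = 1 := smul_left_injective ℂ hΦ h1
  intro Ψ
  have : Ψ ∈ M := by
    rw [← Submodule.starProjection_eq_self_iff, ht, ht1, one_smul]
  exact this

/-- Matrix elements between vectors orthogonal to `Ω` do not vanish on the kernel of a pure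
state. -/
lemma IsPureState.exists_inner_ne_zero (hω : IsPureState ω) (hGNS : IsGNSTriple ω π Ω) {Ψ Φ : H}
    (hΨ : Ψ ≠ 0) (hΦ : Φ ≠ 0) (hΨΩ : ⟪Ω, Ψ⟫_ℂ = 0) (hΦΩ : ⟪Ω, Φ⟫_ℂ = 0) :
    ∃ A, ω A = 0 ∧ ⟪Ψ, π A Φ⟫_ℂ ≠ 0 := by
  by_contra! hcon
  have hω1 : ω 1 = 1 := hω.1.2
  -- A functional vanishing on `ker ω` is a multiple of `ω`. By irreducibility the factor is
  -- nonzero; it is normalized away in `Φ'`.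
  have hprop : ∀ A, ⟪Ψ, π A Φ⟫_ℂ = ω A * ⟪Ψ, Φ⟫_ℂ := fun A => by
    have h := hcon (A - ω A • 1) (by simp [hω1])
    rw [map_sub, map_smul, map_one, sub_apply,
      smul_apply, one_apply_eq_self, inner_sub_right,
      inner_smul_right, sub_eq_zero] at h
    exact h
  set c := ⟪Ψ, Φ⟫_ℂ with hc
  have hc0 : c ≠ 0 := by
    intro h0
    refine hΨ (eq_zero_of_forall_inner_eq_zero (hω.dense_range_apply hGNS hΦ) fun A => ?_)
    rw [hprop, h0, mul_zero]
  set Φ' : H := c⁻¹ • Φ with hΦ'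
  have hAA : ∀ A, ⟪π A Ψ, π A Φ'⟫_ℂ = (‖π A Ω‖ : ℂ) ^ 2 := fun A => by
    rw [hΦ', map_smul, inner_smul_right, ← inner_map_star_mul, hprop, ← hGNS.inner_eq,
      inner_map_star_mul, inner_self_eq_norm_sq_to_K, mul_comm, mul_assoc, mul_inv_cancel₀ hc0,
      mul_one]
    rfl
  set χ : H := Ψ + Φ' with hχ
  -- Polarization: `‖π(A)(Ψ + Φ')‖^2 - ‖π(A)(Ψ - Φ')‖^2 = 4 ‖π(A)Ω‖^2`.
  have hle : ∀ A, ‖π A Ω‖ ≤ 1 * ‖π A χ‖ := fun A => by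
    have h1 := @norm_add_sq ℂ _ _ _ _ (π A Ψ) (π A Φ')
    have h2 := @norm_sub_sq ℂ _ _ _ _ (π A Ψ) (π A Φ')
    have h3 : RCLike.re ⟪π A Ψ, π A Φ'⟫_ℂ = ‖π A Ω‖ ^ 2 := by
      rw [hAA, ← Complex.ofReal_pow]
      exact Complex.ofReal_re _
    rw [h3] at h1 h2
    rw [one_mul, hχ, map_add]
    refine abs_le_of_sq_le_sq' ?_ (norm_nonneg _) |>.2
    nlinarith [sq_nonneg ‖π A Ψ - π A Φ'‖, sq_nonneg ‖π A Ω‖]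
  have hΩ0 : Ω ≠ 0 := by
    intro h
    have := hGNS.norm_eq_one hω1
    simp [h] at this
  have hχ0 : χ ≠ 0 := by
    intro h
    have := hle 1
    rw [h, map_zero, norm_zero, mul_zero, map_one] at this
    exact hΩ0 (norm_le_zero_iff.1 this)
  let e : 𝔄 →ₗ[ℂ] H := { toFun := fun A => π A χ, map_add' := by simp, map_smul' := by simp }
  let f : 𝔄 →ₗ[ℂ] H := { toFun := fun A => π A Ω, map_add' := by simp, map_smul' := by simp }
  have hdense : DenseRange e := hω.dense_range_apply hGNS hχ0
  -- The map `π(A)χ ↦ π(A)Ω` is bounded by `hle` and commutes with `π`, so it is a scalar. Then `Ω`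
  -- would be a multiple of `χ`, which is orthogonal to `Ω`.
  set S : H →L[ℂ] H := f.extendOfNorm e with hS
  have hSe : ∀ A, S (π A χ) = π A Ω := fun A => LinearMap.extendOfNorm_eq hdense ⟨1, hle⟩ A
  have hcomm : ∀ A Ξ, S (π A Ξ) = π A (S Ξ) := fun A => by
    refine congrFun (Continuous.ext_on hdense (by fun_prop) (by fun_prop) ?_)
    rintro _ ⟨B, rfl⟩
    change S (π A (π B χ)) = π A (S (π B χ))
    have h : ∀ Ξ, π A (π B Ξ) = π (A * B) Ξ := fun Ξ => by rw [map_mul]; rfl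
    rw [hSe, h, h, hSe]
  obtain ⟨t, ht⟩ := hω.exists_eq_smul hGNS hcomm
  have h1 := hSe 1
  rw [map_one, one_apply_eq_self, one_apply_eq_self, ht] at h1
  have h2 : ⟪Ω, Ω⟫_ℂ = 0 := by
    nth_rewrite 2 [← h1]
    rw [inner_smul_right, hχ, inner_add_right, hΨΩ, hΦ', inner_smul_right, hΦΩ]
    simp
  exact hΩ0 (inner_self_eq_zero.1 h2)

end Pure

end ArvesonSpectral
end

noncomputable section

namespace ArvesonSpectral

open scoped FourierTransform ComplexConjugate

/-! ### Means over cuboids -/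

section Means

variable {d : ℕ}

lemma norm_cuboidMean_le (L : Fin d → ℝ) {g : E d → ℂ} {C : ℝ} (hC : ∀ x, ‖g x‖ ≤ C) :
    ‖cuboidMean L g‖ ≤ C := by
  have hC0 : 0 ≤ C := (norm_nonneg _).trans (hC 0)
  have h1 : ‖∫ x in cuboid L, g x‖ ≤ C * volume.real (cuboid L) :=
    norm_setIntegral_le_of_norm_le_const (isCompact_cuboid L).measure_lt_top fun x _ => hC x
  rw [cuboidMean, norm_mul, Complex.norm_real, Real.norm_of_nonneg (by positivity)]
  calc _ ≤ (volume.real (cuboid L))⁻¹ * (C * volume.real (cuboid L)) := by gcongr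
    _ = C * ((volume.real (cuboid L))⁻¹ * volume.real (cuboid L)) := by ring
    -- Only an inequality: the cuboid may have volume zero, and then the product is `0`.
    _ ≤ C * 1 := by gcongr; exact inv_mul_le_one
    _ = C := mul_one C

/-- The restriction to the tail of the family excludes cuboids of volume zero, whose mean is `0` by
convention. -/
lemma eventually_cuboidMean_const (K : CuboidFamily d) (c : ℂ) :
    ∀ᶠ L in K.filter, cuboidMean L (fun _ => c) = c := by
  have hev : ∀ᶠ L in K.filter, ∀ i, 1 ≤ L i :=
    eventually_all.2 fun i => (K.tendsto_atTop i).eventually_ge_atTop _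
  filter_upwards [hev] with L hL
  have hpos : 0 < volume.real (cuboid L) := by
    rw [volume_cuboid fun i => zero_le_one.trans (hL i)]
    exact Finset.prod_pos fun i _ => by have := hL i; linarith
  rw [cuboidMean, setIntegral_const, Complex.real_smul, ← mul_assoc, ← Complex.ofReal_mul,
    inv_mul_cancel₀ hpos.ne', Complex.ofReal_one, one_mul]

lemma eq_zero_of_tendsto_cuboidMean_const (K : CuboidFamily d) {c : ℂ}
    (h : Tendsto (fun L => cuboidMean L fun _ => c) K.filter (𝓝 0)) : c = 0 := by
  have := K.neBot
  refine tendsto_nhds_unique ?_ h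
  exact tendsto_const_nhds.congr' ((eventually_cuboidMean_const K c).mono fun L hL => hL.symm)

end Means

/-! ### Closedness of the continuous subspace -/

namespace IsometricFlow

variable {d : ℕ} {X : Type*} [NormedAddCommGroup X] [NormedSpace ℂ X] (F : IsometricFlow d X)
  (β : LinearMap.BilinForm ℝ (E d)) (K : CuboidFamily d)

lemma isBddCont {φ : StrongDual ℂ X} (hφ : φ ∈ F.fn) (A : X) :
    IsBddCont fun x => φ (F.act x A) := by
  refine ⟨F.continuous_fn φ hφ A, ‖φ‖ * ‖A‖, fun x => ?_⟩
  simpa using φ.le_opNorm (F.act x A)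

lemma norm_cuboidMean_phase_le (L : Fin d → ℝ) (q : E d) (φ : StrongDual ℂ X) (A : X) :
    ‖cuboidMean L fun x => Complex.exp (-(Complex.I * (β q x : ℂ))) * φ (F.act x A)‖ ≤
      ‖φ‖ * ‖A‖ := by
  refine norm_cuboidMean_le L fun x => ?_
  have h1 : ‖Complex.exp (-(Complex.I * (β q x : ℂ)))‖ = 1 := by simp [Complex.norm_exp]
  rw [norm_mul, h1, one_mul]
  simpa using φ.le_opNorm (F.act x A)

/-- The means are bounded by `‖φ‖ ‖A‖` uniformly in the cuboid, so vanishing in the limit survives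
norm limits of `A`. -/
lemma isClosed_continuousSubspace : IsClosed (F.continuousSubspace β K : Set X) := by
  refine isClosed_of_closure_subset fun A hA q φ hφ => ?_
  rw [Metric.tendsto_nhds]
  intro ε hε
  obtain ⟨B, hB, hAB⟩ := Metric.mem_closure_iff.1 hA (ε / (2 * (‖φ‖ + 1))) (by positivity)
  filter_upwards [Metric.tendsto_nhds.1 (hB q φ hφ) (ε / 2) (by positivity)] with L hL
  rw [dist_zero_right] at hL ⊢
  have hsplit : cuboidMean L (fun x => Complex.exp (-(Complex.I * (β q x : ℂ))) *
        φ (F.act x A)) =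
      cuboidMean L (fun x => Complex.exp (-(Complex.I * (β q x : ℂ))) * φ (F.act x (A - B))) +
      cuboidMean L (fun x => Complex.exp (-(Complex.I * (β q x : ℂ))) * φ (F.act x B)) := by
    rw [← cuboidMean_add L (F.continuous_integrand β q hφ _) (F.continuous_integrand β q hφ _)]
    congr 1
    funext x
    rw [← mul_add, ← map_add, ← map_add, sub_add_cancel]
  have h1 := F.norm_cuboidMean_phase_le β L q φ (A - B)
  rw [dist_eq_norm, lt_div_iff₀ (by positivity)] at hAB
  rw [hsplit]
  refine (norm_add_le _ _).trans_lt ?_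
  nlinarith [norm_nonneg (A - B)]

end IsometricFlow

/-! ### The implementing unitary group -/

section GNS

variable {d : ℕ} {𝔄 : Type*} [CStarAlgebra 𝔄] {H : Type*} [NormedAddCommGroup H]
  [InnerProductSpace ℂ H] [CompleteSpace H] {β : LinearMap.BilinForm ℝ (E d)}
  {K : CuboidFamily d} {α : AutomorphismGroup d 𝔄} {π : 𝔄 →⋆ₐ[ℂ] (H →L[ℂ] H)} {Ω : H}
  {ω : StrongDual ℂ 𝔄} {U : UnitaryGroup d H}

lemma vectorFunctional_mem_predual (Ψ Φ : H) : vectorFunctional π Ψ Φ ∈ predual π :=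
  Submodule.le_topologicalClosure _ (Submodule.subset_span ⟨(Ψ, Φ), rfl⟩)

lemma IsGNSTriple.vectorFunctional_eq (hGNS : IsGNSTriple ω π Ω) :
    vectorFunctional π Ω Ω = ω := by
  ext A
  exact hGNS.inner_eq A

lemma IsGNSTriple.mem_predual (hGNS : IsGNSTriple ω π Ω) : ω ∈ predual π := by
  rw [← hGNS.vectorFunctional_eq]
  exact vectorFunctional_mem_predual Ω Ω

lemma AutomorphismGroup.flow_act (α : AutomorphismGroup d 𝔄) (P : Submodule ℂ (StrongDual ℂ 𝔄))
    (x : E d) (A : 𝔄) : (α.flow P).act x A = α.toFun x A := rfl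

lemma UnitaryGroup.flow_act {H : Type*} [NormedAddCommGroup H] [InnerProductSpace ℂ H]
    (U : UnitaryGroup d H) (x : E d) (Ψ : H) :
    U.flow.act x Ψ = U.toFun x Ψ := rfl

/-- A state with `ker ω ⊆ 𝔄_c` is invariant. -/
lemma apply_toFun_eq_of_ker_le (hGNS : IsGNSTriple ω π Ω) (h1 : ω 1 = 1)
    (hker : ∀ A, ω A = 0 → A ∈ (α.flow (predual π)).continuousSubspace β K) (x : E d) (A : 𝔄) :
    ω (α.toFun x A) = ω A := by
  have hmem : ∀ B : 𝔄, B - ω B • 1 ∈ (α.flow (predual π)).continuousSubspace β K := fun B =>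
    hker _ (by simp [h1])
  have ha := (α.flow (predual π)).act_mem_continuousSubspace β K x (hmem A)
  have hb := hmem (α.toFun x A)
  have hc := Submodule.sub_mem _ ha hb
  rw [AutomorphismGroup.flow_act, map_sub, map_smul, map_one] at hc
  -- The difference of two elements of the continuous subspace is a multiple of `1`; its mean in the
  -- state `ω` is the coefficient, which must vanish.
  have hd : α.toFun x A - ω A • (1 : 𝔄) - (α.toFun x A - ω (α.toFun x A) • 1) =
      (ω (α.toFun x A) - ω A) • 1 := by module
  rw [hd] at hc
  have he := hc 0 ω hGNS.mem_predual
  refine sub_eq_zero.1 (eq_zero_of_tendsto_cuboidMean_const K (he.congr fun L => ?_))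
  congr 1
  funext y
  simp [AutomorphismGroup.flow_act, h1]

/-- By invariance the mean of `ω(α_x(A))` is the constant `ω(A)`, so zero means at `q = 0` force
`ω(A) = 0`. -/
lemma mem_continuousSubspace_iff_apply_eq_zero (hGNS : IsGNSTriple ω π Ω) (h1 : ω 1 = 1)
    (hker : ∀ A, ω A = 0 → A ∈ (α.flow (predual π)).continuousSubspace β K) (A : 𝔄) :
    A ∈ (α.flow (predual π)).continuousSubspace β K ↔ ω A = 0 := by
  refine ⟨fun hA => ?_, hker A⟩
  have he := hA 0 ω hGNS.mem_predual
  refine eq_zero_of_tendsto_cuboidMean_const K (he.congr fun L => ?_)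
  congr 1
  funext y
  simp [AutomorphismGroup.flow_act, apply_toFun_eq_of_ker_le hGNS h1 hker]

lemma IsGNSTriple.norm_apply_sq (hGNS : IsGNSTriple ω π Ω) (A : 𝔄) :
    ((‖π A Ω‖ ^ 2 : ℝ) : ℂ) = ω (star A * A) := by
  rw [← inner_self_eq_ofReal, ← hGNS.inner_eq, inner_map_star_mul]

lemma continuous_representation (π : 𝔄 →⋆ₐ[ℂ] (H →L[ℂ] H)) : Continuous π :=
  AddMonoidHomClass.continuous_of_bound π 1 fun A => by
    simpa using NonUnitalStarAlgHom.norm_apply_le π A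

/-- Invariance of `ω` makes `π(A)Ω ↦ π(α_x(A))Ω` isometric on a dense set; the group law turns its
extension into a unitary with inverse at `-x`. -/
lemma exists_implements (hGNS : IsGNSTriple ω π Ω)
    (hinv : ∀ x A, ω (α.toFun x A) = ω A) : ∃ U : UnitaryGroup d H, Implements α π Ω U := by
  let e : 𝔄 →ₗ[ℂ] H := { toFun := fun A => π A Ω, map_add' := by simp, map_smul' := by simp }
  let f : E d → 𝔄 →ₗ[ℂ] H := fun x =>
    { toFun := fun A => π (α.toFun x A) Ω, map_add' := by simp, map_smul' := by simp }
  have hdense : DenseRange e := hGNS.cyclic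
  have hnorm : ∀ x A, ‖f x A‖ = ‖e A‖ := fun x A => by
    have h : ‖f x A‖ ^ 2 = ‖e A‖ ^ 2 := by
      have := hGNS.norm_apply_sq (α.toFun x A)
      rw [← map_star, ← map_mul, hinv, ← hGNS.norm_apply_sq] at this
      exact_mod_cast this
    exact (pow_left_inj₀ (norm_nonneg _) (norm_nonneg _) two_ne_zero).1 h
  let W : E d → H →L[ℂ] H := fun x => (f x).extendOfNorm e
  have hW : ∀ x A, W x (π A Ω) = π (α.toFun x A) Ω := fun x A =>
    LinearMap.extendOfNorm_eq hdense ⟨1, fun A => by rw [one_mul, hnorm]⟩ A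
  have hWnorm : ∀ x Ψ, ‖W x Ψ‖ = ‖Ψ‖ := fun x => by
    refine congrFun (Continuous.ext_on hdense (by fun_prop) (by fun_prop) ?_)
    rintro _ ⟨A, rfl⟩
    exact (congrArg norm (hW x A)).trans (hnorm x A)
  have hW0 : ∀ Ψ, W 0 Ψ = Ψ := by
    refine congrFun (Continuous.ext_on hdense (by fun_prop) (by fun_prop) ?_)
    rintro _ ⟨A, rfl⟩
    exact (hW 0 A).trans (by rw [α.map_zero]; rfl)
  have hWadd : ∀ x y Ψ, W (x + y) Ψ = W x (W y Ψ) := fun x y => by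
    refine congrFun (Continuous.ext_on hdense (by fun_prop) (by fun_prop) ?_)
    rintro _ ⟨A, rfl⟩
    change W (x + y) (π A Ω) = W x (W y (π A Ω))
    rw [hW, hW, hW, α.map_add]
  let V : E d → H ≃ₗᵢ[ℂ] H := fun x =>
    { toLinearEquiv := LinearEquiv.ofLinearMap (W x : H →ₗ[ℂ] H) (W (-x) : H →ₗ[ℂ] H)
        (LinearMap.ext fun Ψ => by
          change W x (W (-x) Ψ) = Ψ
          rw [← hWadd, add_neg_cancel, hW0])
        (LinearMap.ext fun Ψ => by
          change W (-x) (W x Ψ) = Ψ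
          rw [← hWadd, neg_add_cancel, hW0])
      norm_map' := hWnorm x }
  have hcont : ∀ Ψ, Continuous fun x => W x Ψ := fun Ψ => by
    -- Approximating `Ψ` by `π(A)Ω` is uniform in `x` because the `W x` are isometric, and the orbit
    -- of `π(A)Ω` is continuous since `α` is.
    refine continuous_of_uniform_approx_of_continuous fun u hu => ?_
    obtain ⟨ε, hε, hεu⟩ := Metric.mem_uniformity_dist.1 hu
    obtain ⟨_, ⟨A, rfl⟩, hA⟩ := Metric.mem_closure_iff.1 (hdense Ψ) ε hε
    refine ⟨fun x => π (α.toFun x A) Ω, ?_, fun x => hεu ?_⟩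
    · exact (ContinuousLinearMap.apply ℂ H Ω).continuous.comp
        ((continuous_representation π).comp (α.continuous_apply A))
    · simp only
      rw [← hW, dist_eq_norm, ← map_sub, hWnorm, ← dist_eq_norm]
      exact hA
  have hWΩ : ∀ x, W x Ω = Ω := fun x => by
    have := hW x 1
    simpa only [map_one, one_apply_eq_self] using this
  refine ⟨⟨V, hW0, hWadd, hcont⟩, ⟨fun x A Ψ => ?_, hWΩ⟩⟩
  change π (α.toFun x A) Ψ = W x (π A (W (-x) Ψ))
  revert Ψ
  refine congrFun (Continuous.ext_on hdense (by fun_prop) (by fun_prop) ?_)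
  rintro _ ⟨B, rfl⟩
  change π (α.toFun x A) (π B Ω) = W x (π A (W (-x) (π B Ω)))
  have h : ∀ A B : 𝔄, π A (π B Ω) = π (A * B) Ω := fun A B => by rw [map_mul]; rfl
  rw [hW, h, h, hW, map_mul (α.toFun x), ← α.map_add, add_neg_cancel, α.map_zero]

lemma Implements.apply_cyclic (hU : Implements α π Ω U) (x : E d) (A : 𝔄) :
    U.toFun x (π A Ω) = π (α.toFun x A) Ω := by
  have h : (U.toFun x).symm Ω = Ω := by
    rw [LinearIsometryEquiv.symm_apply_eq, hU.invariant]
  rw [hU.covariant, h]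

lemma Implements.unique (hGNS : IsGNSTriple ω π Ω) (hU : Implements α π Ω U)
    {V : UnitaryGroup d H} (hV : Implements α π Ω V) : V = U := by
  have h : V.toFun = U.toFun := by
    funext x
    refine LinearIsometryEquiv.ext (congrFun (Continuous.ext_on hGNS.cyclic
      (V.toFun x).continuous (U.toFun x).continuous ?_))
    rintro _ ⟨A, rfl⟩
    exact (hV.apply_cyclic x A).trans (hU.apply_cyclic x A).symm
  cases V
  cases U
  cases h
  rfl

lemma Implements.vectorFunctional_act (hU : Implements α π Ω U) (Ψ Φ : H) (x : E d) (A : 𝔄) :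
    vectorFunctional π Ψ Φ (α.toFun x A) = ⟪Ψ, U.toFun x (π A (U.toFun (-x) Φ))⟫_ℂ := by
  rw [vectorFunctional_apply, hU.covariant, U.symm_apply]

lemma Implements.inner_omega (hU : Implements α π Ω U) (x : E d) (Ψ : H) :
    ⟪Ω, U.toFun x Ψ⟫_ℂ = ⟪Ω, Ψ⟫_ℂ := by
  conv_lhs => rw [← hU.invariant x]
  exact (U.toFun x).inner_map_map _ _

/-- Vectors orthogonal to `Ω` are approximated by `π(A)Ω` with `ω(A) = 0`. -/
lemma mem_closure_of_inner_eq_zero (hGNS : IsGNSTriple ω π Ω) (h1 : ω 1 = 1) {Ψ : H}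
    (hΨ : ⟪Ω, Ψ⟫_ℂ = 0) : Ψ ∈ closure ((fun A => π A Ω) '' {A | ω A = 0}) := by
  rw [Metric.mem_closure_iff]
  intro ε hε
  obtain ⟨_, ⟨B, rfl⟩, hB⟩ := Metric.mem_closure_iff.1 (hGNS.cyclic Ψ) (ε / 2) (by positivity)
  refine ⟨π (B - ω B • 1) Ω, ⟨_, by simp [h1], rfl⟩, ?_⟩
  have hω : ‖ω B‖ ≤ ‖Ψ - π B Ω‖ := by
    have h2 : ω B = -⟪Ω, Ψ - π B Ω⟫_ℂ := by
      rw [inner_sub_right, hΨ, hGNS.inner_eq]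
      ring
    rw [h2, norm_neg]
    refine (norm_inner_le_norm _ _).trans ?_
    rw [hGNS.norm_eq_one h1, one_mul]
  rw [dist_eq_norm] at hB ⊢
  have h3 : Ψ - π (B - ω B • 1) Ω = (Ψ - π B Ω) + ω B • Ω := by
    rw [map_sub, map_smul, map_one, sub_apply, smul_apply, one_apply_eq_self]
    abel
  rw [h3]
  refine (norm_add_le _ _).trans_lt ?_
  rw [norm_smul, hGNS.norm_eq_one h1, mul_one]
  linarith

lemma exists_forall_eq_inner (φ : StrongDual ℂ H) : ∃ Φ : H, ∀ Ψ, φ Ψ = ⟪Φ, Ψ⟫_ℂ :=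
  ⟨(InnerProductSpace.toDual ℂ H).symm φ, fun Ψ => by
    rw [InnerProductSpace.toDual_symm_apply]⟩

/-- The vectors `π(A)Ω` with `ω(A) = 0` inherit zero means from `A`, as `(Φ|π(·)Ω)` is normal. They
are dense in `Ω^⊥`, and the continuous subspace is closed. Conversely, the component along the
invariant `Ω` equals its own mean. -/
lemma mem_continuousSubspace_iff_inner_eq_zero (hGNS : IsGNSTriple ω π Ω) (h1 : ω 1 = 1)
    (hker : ∀ A, ω A = 0 → A ∈ (α.flow (predual π)).continuousSubspace β K)
    (hU : Implements α π Ω U) (Ψ : H) :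
    Ψ ∈ U.flow.continuousSubspace β K ↔ ⟪Ω, Ψ⟫_ℂ = 0 := by
  constructor
  · intro hΨ
    have he := hΨ 0 (InnerProductSpace.toDual ℂ H Ω) trivial
    refine eq_zero_of_tendsto_cuboidMean_const K (he.congr fun L => ?_)
    congr 1
    funext y
    simp [UnitaryGroup.flow_act, hU.inner_omega]
  · intro hΨ
    refine closure_minimal ?_ (U.flow.isClosed_continuousSubspace β K)
      (mem_closure_of_inner_eq_zero hGNS h1 hΨ)
    rintro _ ⟨A, hA, rfl⟩ q φ -
    obtain ⟨Φ, hΦ⟩ := exists_forall_eq_inner φ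
    refine (hker A hA q _ (vectorFunctional_mem_predual Φ Ω)).congr fun L => ?_
    simp only [UnitaryGroup.flow_act, hU.apply_cyclic, hΦ, AutomorphismGroup.flow_act,
      vectorFunctional_apply]

end GNS

end ArvesonSpectral
end

noncomputable section

namespace ArvesonSpectral

open scoped FourierTransform ComplexConjugate

/-! ### Points outside of the spectra -/

namespace IsometricFlow

variable {d : ℕ} {X : Type*} [NormedAddCommGroup X] [NormedSpace ℂ X] (F : IsometricFlow d X)
  {β : LinearMap.BilinForm ℝ (E d)} {T : E d ≃L[ℝ] E d} {K : CuboidFamily d}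

lemma notMem_spectrumOn_iff (hT : IsFrequencyEquiv β T) (S : Submodule ℂ X) (p : E d) :
    p ∉ F.spectrumOn β S ↔ ∃ r > 0, ∀ A ∈ S, ∀ φ ∈ F.fn, ∀ f : 𝓢(E d, ℂ),
      tsupport f ⊆ Metric.ball p r → fourierPairing β (fun x => φ (F.act x A)) f = 0 := by
  have h := notMem_closure_iUnion_fourierSupport hT
    (G := {g | ∃ A ∈ S, ∃ φ ∈ F.fn, (fun x => φ (F.act x A)) = g})
    (by rintro _ ⟨A, -, φ, hφ, rfl⟩; exact F.isBddCont hφ A) p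
  have hset : (⋃ g ∈ {g | ∃ A ∈ S, ∃ φ ∈ F.fn, (fun x => φ (F.act x A)) = g},
      fourierSupport β g) = ⋃ A ∈ S, ⋃ φ ∈ F.fn, fourierSupport β fun x => φ (F.act x A) := by
    ext q
    simp only [Set.mem_iUnion, Set.mem_ofPred_eq, exists_prop]
    constructor
    · rintro ⟨_, ⟨A, hA, φ, hφ, rfl⟩, hq⟩
      exact ⟨A, hA, φ, hφ, hq⟩
    · rintro ⟨A, hA, φ, hφ, hq⟩
      exact ⟨_, ⟨A, hA, φ, hφ, rfl⟩, hq⟩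
  rw [hset] at h
  rw [spectrumOn, h]
  refine exists_congr fun r => and_congr_right fun _ => ⟨fun h A hA φ hφ => h _ ⟨A, hA, φ, hφ, rfl⟩,
    ?_⟩
  rintro h _ ⟨A, hA, φ, hφ, rfl⟩
  exact h A hA φ hφ

/-- Functionals on the singular continuous space are functionals on the continuous subspace. -/
lemma scClass_apply_eq (G : Submodule ℂ (StrongDual ℂ X)) (φ : StrongDual ℂ (F.ScSpace β K G))
    (A : F.continuousSubspace β K) (x : E d) :
    φ (F.scClass β K G A x) =
      (φ.comp (Submodule.mkQL _)) ⟨F.act x A, F.act_mem_continuousSubspace β K x A.2⟩ := rfl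

/-- Norm continuity of the orbits is required since `φ` ranges over all bounded functionals on the
quotient, not only those coming from `fn`. -/
lemma isBddCont_scClass (hF : ∀ A, Continuous fun x => F.act x A)
    (G : Submodule ℂ (StrongDual ℂ X)) (φ : StrongDual ℂ (F.ScSpace β K G))
    (A : F.continuousSubspace β K) : IsBddCont fun x => φ (F.scClass β K G A x) := by
  set ψ := φ.comp (Submodule.mkQL _) with hψ
  refine ⟨?_, ‖ψ‖ * ‖A‖, fun x => ?_⟩
  · simp only [scClass_apply_eq]
    exact ψ.continuous.comp ((hF A).subtype_mk _)
  · simp only [scClass_apply_eq]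
    refine (ψ.le_opNorm _).trans (le_of_eq ?_)
    rw [Submodule.coe_norm, LinearIsometry.norm_map, Submodule.coe_norm]

lemma notMem_scSpectrum_iff (hT : IsFrequencyEquiv β T) (hF : ∀ A, Continuous fun x => F.act x A)
    (G : Submodule ℂ (StrongDual ℂ X)) (p : E d) :
    p ∉ F.scSpectrum β K G ↔ ∃ r > 0, ∀ (A : F.continuousSubspace β K)
      (φ : StrongDual ℂ (F.ScSpace β K G)) (f : 𝓢(E d, ℂ)),
      tsupport f ⊆ Metric.ball p r → fourierPairing β (fun x => φ (F.scClass β K G A x)) f = 0 := by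
  have h := notMem_closure_iUnion_fourierSupport hT
    (G := {g | ∃ (A : F.continuousSubspace β K) (φ : StrongDual ℂ (F.ScSpace β K G)),
      (fun x => φ (F.scClass β K G A x)) = g})
    (by rintro _ ⟨A, φ, rfl⟩; exact F.isBddCont_scClass hF G φ A) p
  have hset : (⋃ g ∈ {g | ∃ (A : F.continuousSubspace β K) (φ : StrongDual ℂ (F.ScSpace β K G)),
      (fun x => φ (F.scClass β K G A x)) = g}, fourierSupport β g) =
      ⋃ A : F.continuousSubspace β K, ⋃ φ : StrongDual ℂ (F.ScSpace β K G),
        fourierSupport β fun x => φ (F.scClass β K G A x) := by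
    ext q
    simp only [Set.mem_iUnion, Set.mem_ofPred_eq, exists_prop]
    constructor
    · rintro ⟨_, ⟨A, φ, rfl⟩, hq⟩
      exact ⟨A, φ, hq⟩
    · rintro ⟨A, φ, hq⟩
      exact ⟨_, ⟨A, φ, rfl⟩, hq⟩
  rw [hset] at h
  rw [scSpectrum, h]
  refine exists_congr fun r => and_congr_right fun _ => ⟨fun h A φ => h _ ⟨A, φ, rfl⟩, ?_⟩
  rintro h _ ⟨A, φ, rfl⟩
  exact h A φ

lemma acSubspace_le_continuousSubspace (S : Submodule ℂ X) (G : Submodule ℂ (StrongDual ℂ X)) :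
    F.acSubspace β K S G ≤ F.continuousSubspace β K := by
  refine Submodule.topologicalClosure_minimal _ ?_ (F.isClosed_continuousSubspace β K)
  exact Submodule.span_le.2 fun A hA => hA.1.2

/-! ### Pure point spectrum -/

/-- At the frequency `q` the phases cancel, so the mean is that of the constant `φ A`. -/
lemma apply_eq_zero_of_eigenvector {A : X} (hA : A ∈ F.continuousSubspace β K)
    {φ : StrongDual ℂ X} (hφ : φ ∈ F.fn) {q : E d}
    (h : ∀ x, φ (F.act x A) = Complex.exp (Complex.I * (β q x : ℂ)) * φ A) : φ A = 0 := by
  refine eq_zero_of_tendsto_cuboidMean_const K ((hA q φ hφ).congr fun L => ?_)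
  congr 1
  funext x
  rw [h, ← mul_assoc, ← Complex.exp_add, neg_add_cancel, Complex.exp_zero, one_mul]

/-- Common pattern for `U`, `α` and `α*`: the invariant elements `Ω`, `1` and `ω` respectively put
`0` into the spectrum, and other points are excluded by showing that their eigenvectors vanish. -/
lemma ppSpectrum_eq_singleton_zero (hT : IsFrequencyEquiv β T) {S : Submodule ℂ X} {A₀ : X}
    (hA₀ : A₀ ∈ S) (hinv : ∀ x, F.act x A₀ = A₀) {φ₀ : StrongDual ℂ X} (hφ₀ : φ₀ ∈ F.fn)
    (hne : φ₀ A₀ ≠ 0)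
    (hev : ∀ q ≠ 0, ∀ A ∈ S, (∀ φ ∈ F.fn, ∀ x, φ (F.act x A) =
      Complex.exp (Complex.I * (β q x : ℂ)) * φ A) → A = 0) :
    F.ppSpectrum β S = {0} := by
  ext q
  rw [Set.mem_singleton_iff]
  constructor
  · rintro ⟨-, A, ⟨hAS, hsupp⟩, hA0⟩
    by_contra hq
    refine hA0 (hev q hq A hAS fun φ hφ x => ?_)
    have h := eq_exp_of_fourierSupport_subset_singleton hT (F.isBddCont hφ A) (hsupp φ hφ) x
    rwa [F.act_zero] at h
  · rintro rfl
    refine ⟨subset_closure ?_, A₀, ⟨hA₀, fun φ hφ => ?_⟩, fun h => hne (by rw [h, map_zero])⟩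
    · refine Set.mem_biUnion hA₀ (Set.mem_biUnion hφ₀ ?_)
      simp only [hinv]
      exact zero_mem_fourierSupport_const hT hne
    · simp only [hinv]
      exact fourierSupport_const_subset hT _

end IsometricFlow

lemma exists_exp_ne_one {d : ℕ} {β : LinearMap.BilinForm ℝ (E d)} {T : E d ≃L[ℝ] E d}
    (hT : IsFrequencyEquiv β T) {q : E d} (hq : q ≠ 0) :
    ∃ x, Complex.exp (Complex.I * (β q x : ℂ)) ≠ 1 := by
  -- The scaling is chosen so that `β q x = π` and the exponential equals `-1`.
  refine ⟨T ((2 * ‖q‖ ^ 2)⁻¹ • q), ?_⟩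
  have hq2 : ‖q‖ ^ 2 ≠ 0 := by simpa using hq
  have h : β q (T ((2 * ‖q‖ ^ 2)⁻¹ • q)) = Real.pi := by
    rw [hT, real_inner_smul_right, real_inner_self_eq_norm_sq]
    field_simp
  rw [h, mul_comm, Complex.exp_pi_mul_I]
  norm_num

section Spectra

variable {d : ℕ} {𝔄 : Type*} [CStarAlgebra 𝔄] {H : Type*} [NormedAddCommGroup H]
  [InnerProductSpace ℂ H] [CompleteSpace H] {β : LinearMap.BilinForm ℝ (E d)}
  {T : E d ≃L[ℝ] E d}
  {K : CuboidFamily d} {α : AutomorphismGroup d 𝔄} {π : 𝔄 →⋆ₐ[ℂ] (H →L[ℂ] H)} {Ω : H}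
  {ω : StrongDual ℂ 𝔄} {U : UnitaryGroup d H}

lemma ppSpectrum_unitary (hT : IsFrequencyEquiv β T) (hGNS : IsGNSTriple ω π Ω) (h1 : ω 1 = 1)
    (hker : ∀ A, ω A = 0 → A ∈ (α.flow (predual π)).continuousSubspace β K)
    (hU : Implements α π Ω U) : U.flow.ppSpectrum β ⊤ = {0} := by
  refine U.flow.ppSpectrum_eq_singleton_zero hT (A₀ := Ω) trivial hU.invariant
    (φ₀ := InnerProductSpace.toDual ℂ H Ω) trivial ?_ ?_
  · rw [InnerProductSpace.toDual_apply_apply, hGNS.inner_self h1]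
    exact one_ne_zero
  intro q hq Ψ _ hev
  obtain ⟨x, hx⟩ := exists_exp_ne_one hT hq
  have hΩΨ : ⟪Ω, Ψ⟫_ℂ = 0 := by
    have h := hev (InnerProductSpace.toDual ℂ H Ω) trivial x
    simp only [InnerProductSpace.toDual_apply_apply, UnitaryGroup.flow_act, hU.inner_omega] at h
    by_contra h0
    exact hx (mul_right_cancel₀ h0 (by rw [one_mul, ← h]))
  have hmem := (mem_continuousSubspace_iff_inner_eq_zero hGNS h1 hker hU Ψ).2 hΩΨ
  have := U.flow.apply_eq_zero_of_eigenvector hmem (φ := InnerProductSpace.toDual ℂ H Ψ) trivial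
    (hev _ trivial)
  exact inner_self_eq_zero.1 this

lemma ppSpectrum_automorphism (hT : IsFrequencyEquiv β T) (hGNS : IsGNSTriple ω π Ω)
    (h1 : ω 1 = 1) (hker : ∀ A, ω A = 0 → A ∈ (α.flow (predual π)).continuousSubspace β K)
    (hnorm : IsNorming (predual π)) : (α.flow (predual π)).ppSpectrum β ⊤ = {0} := by
  refine (α.flow (predual π)).ppSpectrum_eq_singleton_zero hT (A₀ := 1) trivial
    (fun x => map_one (α.toFun x)) (φ₀ := ω) hGNS.mem_predual (by simp [h1]) ?_
  intro q hq A _ hev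
  obtain ⟨x, hx⟩ := exists_exp_ne_one hT hq
  have hωA : ω A = 0 := by
    have h := hev ω hGNS.mem_predual x
    rw [AutomorphismGroup.flow_act, apply_toFun_eq_of_ker_le hGNS h1 hker] at h
    by_contra h0
    exact hx (mul_right_cancel₀ h0 (by rw [one_mul, ← h]))
  have hle : ‖A‖ ≤ 0 := by
    refine (hnorm A).2 ?_
    rintro _ ⟨φ, hφ, -, rfl⟩
    rw [(α.flow (predual π)).apply_eq_zero_of_eigenvector (hker A hωA) hφ (hev φ hφ), norm_zero]
  exact norm_le_zero_iff.1 hle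

/-- Invariance of `1` forces an eigenfunctional with `q ≠ 0` to vanish on `1`, and the mean argument
makes it vanish on `ker ω`; together these span `𝔄`. -/
lemma ppSpectrum_transposed (hT : IsFrequencyEquiv β T) (hGNS : IsGNSTriple ω π Ω)
    (h1 : ω 1 = 1) (hker : ∀ A, ω A = 0 → A ∈ (α.flow (predual π)).continuousSubspace β K) :
    α.transposed.ppSpectrum β (predual π) = {0} := by
  have hfn : ∀ A : 𝔄, NormedSpace.inclusionInDoubleDual ℂ 𝔄 A ∈ α.transposed.fn := fun A =>
    ⟨A, trivial, rfl⟩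
  refine α.transposed.ppSpectrum_eq_singleton_zero hT (A₀ := ω) hGNS.mem_predual
    (fun x => ContinuousLinearMap.ext fun A => apply_toFun_eq_of_ker_le hGNS h1 hker x A)
    (hfn 1) (by simp [h1]) ?_
  intro q hq φ hφ hev
  have hev' : ∀ A x, φ (α.toFun x A) = Complex.exp (Complex.I * (β q x : ℂ)) * φ A := fun A x =>
    hev _ (hfn A) x
  obtain ⟨x, hx⟩ := exists_exp_ne_one hT hq
  have hφ1 : φ 1 = 0 := by
    have h := hev' 1 x
    rw [map_one] at h
    by_contra h0
    exact hx (mul_right_cancel₀ h0 (by rw [one_mul, ← h]))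
  ext A
  have h := (α.flow (predual π)).apply_eq_zero_of_eigenvector
    (hker (A - ω A • 1) (by simp [h1])) hφ (hev' _)
  simpa [hφ1] using h

/-! ### Absolutely continuous spectrum -/

/-- Smeared vectors vanishing on the generators of the absolutely continuous subspace. -/
lemma notMem_acSpectrum_unitary (U : UnitaryGroup d H) (hT : IsFrequencyEquiv β T) {p : E d}
    {r : ℝ} (hr : 0 < r)
    (h : ∀ Ψ ∈ U.flow.continuousSubspace β K,
      (∀ Φ : H, FourierInL1 β fun x => ⟪Φ, U.toFun x Ψ⟫_ℂ) →
      ∀ f : 𝓢(E d, ℂ), tsupport f ⊆ Metric.ball p r → U.smear T f Ψ = 0) :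
    p ∉ U.flow.acSpectrum β K ⊤ ⊤ := by
  rw [IsometricFlow.acSpectrum, U.flow.notMem_spectrumOn_iff hT]
  refine ⟨r, hr, fun Ψ hΨ φ _ f hf => ?_⟩
  have hle : U.flow.acSubspace β K ⊤ ⊤ ≤ LinearMap.ker (U.smear T f : H →ₗ[ℂ] H) := by
    refine Submodule.topologicalClosure_minimal _ (Submodule.span_le.2 ?_)
      (U.smear T f).isClosed_ker
    rintro Ξ ⟨⟨-, hΞ⟩, hL⟩
    refine h Ξ hΞ (fun Φ => ?_) f hf
    exact hL (InnerProductSpace.toDual ℂ H Φ) trivial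
  have h0 : U.smear T f Ψ = 0 := hle hΨ
  obtain ⟨Φ, hΦ⟩ := exists_forall_eq_inner φ
  simp only [UnitaryGroup.flow_act, hΦ]
  rw [U.fourierPairing_inner hT, h0, inner_zero_right, mul_zero]

/-- Normal functionals vanishing on the identity have vanishing means. -/
lemma mem_continuousSubspace_transposed (h1 : ω 1 = 1)
    (hker : ∀ A, ω A = 0 → A ∈ (α.flow (predual π)).continuousSubspace β K)
    {φ : StrongDual ℂ 𝔄} (hφ : φ ∈ predual π) (hφ1 : φ 1 = 0) :
    φ ∈ α.transposed.continuousSubspace β K := by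
  rintro q _ ⟨A, -, rfl⟩
  refine (hker (A - ω A • 1) (by simp [h1]) q φ hφ).congr fun L => ?_
  congr 1
  funext x
  congr 1
  rw [AutomorphismGroup.flow_act, map_sub, map_smul, map_one, map_sub, map_smul, hφ1, smul_zero,
    sub_zero]
  rfl

lemma Implements.vectorFunctional_omega_right (hU : Implements α π Ω U) (Ψ : H) (x : E d)
    (A : 𝔄) : vectorFunctional π Ψ Ω (α.toFun x A) = ⟪Ψ, U.toFun x (π A Ω)⟫_ℂ := by
  rw [vectorFunctional_apply, hU.apply_cyclic]

lemma Implements.vectorFunctional_omega_left (hU : Implements α π Ω U) (Ψ : H) (x : E d)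
    (A : 𝔄) : vectorFunctional π Ω Ψ (α.toFun x A) = ⟪π (star A) Ω, U.toFun (-x) Ψ⟫_ℂ := by
  rw [hU.vectorFunctional_act, hU.inner_omega, inner_map_left]

/-- Because `Ω` is invariant, the orbit functions of both functionals reduce, up to conjugation and
`x ↦ -x`, to functions `(Φ|U(x)Ψ)`, whose transforms are `L¹` by assumption. Orthogonality to `Ω`
makes both functionals vanish on `1`. -/
lemma vectorFunctional_mem_acSubspace (hGNS : IsGNSTriple ω π Ω) (h1 : ω 1 = 1)
    (hker : ∀ A, ω A = 0 → A ∈ (α.flow (predual π)).continuousSubspace β K)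
    (hU : Implements α π Ω U) (Ahat : Submodule ℂ 𝔄) {Ψ : H}
    (hΨ : Ψ ∈ U.flow.continuousSubspace β K)
    (hL : ∀ Φ : H, FourierInL1 β fun x => ⟪Φ, U.toFun x Ψ⟫_ℂ) :
    vectorFunctional π Ψ Ω ∈
        α.transposed.acSubspace β K (predual π) (AutomorphismGroup.evaluations Ahat) ∧
      vectorFunctional π Ω Ψ ∈
        α.transposed.acSubspace β K (predual π) (AutomorphismGroup.evaluations Ahat) := by
  have hΩΨ := (mem_continuousSubspace_iff_inner_eq_zero hGNS h1 hker hU Ψ).1 hΨ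
  have hΨΩ : ⟪Ψ, Ω⟫_ℂ = 0 := by rw [← inner_conj_symm, hΩΨ, map_zero]
  refine ⟨Submodule.le_topologicalClosure _ (Submodule.subset_span ⟨⟨?_, ?_⟩, ?_⟩),
    Submodule.le_topologicalClosure _ (Submodule.subset_span ⟨⟨?_, ?_⟩, ?_⟩)⟩
  · exact vectorFunctional_mem_predual _ _
  · exact mem_continuousSubspace_transposed h1 hker (vectorFunctional_mem_predual _ _)
      (by simpa using hΨΩ)
  · rintro _ ⟨A, -, rfl⟩
    convert (hL (π A Ω)).neg.conj using 1
    funext x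
    change vectorFunctional π Ψ Ω (α.toFun x A) = _
    rw [hU.vectorFunctional_omega_right, inner_conj_symm, U.inner_toFun_left, neg_neg]
  · exact vectorFunctional_mem_predual _ _
  · exact mem_continuousSubspace_transposed h1 hker (vectorFunctional_mem_predual _ _)
      (by simpa using hΩΨ)
  · rintro _ ⟨A, -, rfl⟩
    convert (hL (π (star A) Ω)).neg using 1
    funext x
    exact hU.vectorFunctional_omega_left Ψ x A

lemma schwartzConj_schwartzConj (f : 𝓢(E d, ℂ)) : schwartzConj (schwartzConj f) = f := by
  ext p
  simp

lemma schwartzNeg_schwartzNeg (f : 𝓢(E d, ℂ)) : schwartzNeg (schwartzNeg f) = f := by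
  ext p
  simp

lemma acSpectrum_subset (hT : IsFrequencyEquiv β T) (hGNS : IsGNSTriple ω π Ω) (h1 : ω 1 = 1)
    (hker : ∀ A, ω A = 0 → A ∈ (α.flow (predual π)).continuousSubspace β K)
    (hU : Implements α π Ω U) (Ahat : Submodule ℂ 𝔄) :
    U.flow.acSpectrum β K ⊤ ⊤ ⊆
      α.transposed.acSpectrum β K (predual π) (AutomorphismGroup.evaluations Ahat) := by
  intro p
  contrapose
  intro hp
  rw [IsometricFlow.acSpectrum, α.transposed.notMem_spectrumOn_iff hT] at hp
  obtain ⟨r, hr, hvan⟩ := hp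
  refine notMem_acSpectrum_unitary U hT hr fun Ψ hΨ hL f hf => ?_
  refine eq_zero_of_forall_inner_eq_zero hGNS.cyclic fun A => ?_
  -- The conjugate test function is used because `U(f̄)` is the adjoint of `U(f)`, which has to act
  -- on the left vector `Ψ`.
  have h := hvan _ (vectorFunctional_mem_acSubspace hGNS h1 hker hU Ahat hΨ hL).1 _
    ⟨A, trivial, rfl⟩ (schwartzConj f) (by rwa [tsupport_schwartzConj])
  have h' : fourierPairing β (fun x => ⟪Ψ, U.toFun x (π A Ω)⟫_ℂ) (schwartzConj f) = 0 := by
    rw [← h]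
    congr 1
    funext x
    exact (hU.vectorFunctional_omega_right Ψ x A).symm
  rw [U.fourierPairing_inner hT, ← U.inner_smear_schwartzConj, schwartzConj_schwartzConj] at h'
  exact (mul_eq_zero.1 h').resolve_left (pairingConst_ne_zero hT)

lemma neg_acSpectrum_subset (hT : IsFrequencyEquiv β T) (hGNS : IsGNSTriple ω π Ω)
    (h1 : ω 1 = 1)
    (hker : ∀ A, ω A = 0 → A ∈ (α.flow (predual π)).continuousSubspace β K)
    (hU : Implements α π Ω U) (Ahat : Submodule ℂ 𝔄) :
    -U.flow.acSpectrum β K ⊤ ⊤ ⊆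
      α.transposed.acSpectrum β K (predual π) (AutomorphismGroup.evaluations Ahat) := by
  intro p
  rw [Set.mem_neg]
  contrapose
  intro hp
  rw [IsometricFlow.acSpectrum, α.transposed.notMem_spectrumOn_iff hT] at hp
  obtain ⟨r, hr, hvan⟩ := hp
  refine notMem_acSpectrum_unitary U hT hr fun Ψ hΨ hL f hf => ?_
  refine hGNS.cyclic.eq_zero_of_inner_right (𝕜 := ℂ) ?_
  rintro _ ⟨A, rfl⟩
  have hf' : tsupport (schwartzNeg f) ⊆ Metric.ball p r := by
    simpa using tsupport_schwartzNeg_subset hf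
  have h := hvan _ (vectorFunctional_mem_acSubspace hGNS h1 hker hU Ahat hΨ hL).2 _
    ⟨star A, trivial, rfl⟩ (schwartzNeg f) hf'
  have h' : fourierPairing β (fun x => ⟪π A Ω, U.toFun (-x) Ψ⟫_ℂ) (schwartzNeg f) = 0 := by
    rw [← h]
    congr 1
    funext x
    refine Eq.trans ?_ (hU.vectorFunctional_omega_left Ψ x (star A)).symm
    rw [star_star]
  rw [fourierPairing_neg (fun x => ⟪π A Ω, U.toFun x Ψ⟫_ℂ), schwartzNeg_schwartzNeg,
    U.fourierPairing_inner hT] at h'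
  exact (mul_eq_zero.1 h').resolve_left (pairingConst_ne_zero hT)

/-! ### Singular continuous spectrum -/

/-- For a generator `B` the functionals `(Ψ|π(·)Ω)` in `Phat` give `L¹` densities of `π(B)Ω` against
a dense set of `Ψ`, hence against all vectors. Continuity of `A ↦ π(A)Ω` extends this to the
closure. -/
lemma apply_cyclic_mem_acSubspace (hT : IsFrequencyEquiv β T) (hGNS : IsGNSTriple ω π Ω)
    (h1 : ω 1 = 1)
    (hker : ∀ A, ω A = 0 → A ∈ (α.flow (predual π)).continuousSubspace β K)
    (hU : Implements α π Ω U) {Phat : Submodule ℂ (StrongDual ℂ 𝔄)}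
    (hPhat : DenseCondition π Ω Phat) {A : 𝔄}
    (hA : A ∈ (α.flow (predual π)).acSubspace β K ⊤ Phat) :
    π A Ω ∈ U.flow.acSubspace β K ⊤ ⊤ := by
  let e : 𝔄 →ₗ[ℂ] H := { toFun := fun A => π A Ω, map_add' := by simp, map_smul' := by simp }
  have he : Continuous e := (ContinuousLinearMap.apply ℂ H Ω).continuous.comp
    (continuous_representation π)
  have hle : (α.flow (predual π)).acSubspace β K ⊤ Phat ≤
      (U.flow.acSubspace β K ⊤ ⊤).comap e := by
    refine Submodule.topologicalClosure_minimal _ (Submodule.span_le.2 ?_)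
      ((Submodule.isClosed_topologicalClosure _).preimage he)
    rintro B ⟨⟨-, hB⟩, hL⟩
    refine Submodule.le_topologicalClosure _ (Submodule.subset_span ⟨⟨trivial, ?_⟩, ?_⟩)
    · rw [SetLike.mem_coe, mem_continuousSubspace_iff_inner_eq_zero hGNS h1 hker hU]
      exact (hGNS.inner_eq B).trans
        ((mem_continuousSubspace_iff_apply_eq_zero hGNS h1 hker B).1 hB)
    · rintro φ -
      obtain ⟨Φ, hΦ⟩ := exists_forall_eq_inner φ
      simp only [UnitaryGroup.flow_act, hΦ]
      obtain ⟨D, hD, hDP⟩ := hPhat.vector_mem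
      refine U.fourierInL1_of_dense hT hD (fun Ψ hΨ => ?_) Φ
      convert hL _ (hDP Ψ hΨ) using 1
      funext x
      exact (hU.vectorFunctional_omega_right Ψ x B).symm
  exact hle hA

/-- Self-adjointness of `Phat` turns orbit functions of `A*` into conjugates of orbit functions of
`A`, and being an `L¹` transform is stable under conjugation. -/
lemma star_mem_acSubspace (hGNS : IsGNSTriple ω π Ω) (h1 : ω 1 = 1)
    (hker : ∀ A, ω A = 0 → A ∈ (α.flow (predual π)).continuousSubspace β K)
    {Phat : Submodule ℂ (StrongDual ℂ 𝔄)} (hPhat : DenseCondition π Ω Phat) {A : 𝔄}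
    (hA : A ∈ (α.flow (predual π)).acSubspace β K ⊤ Phat) :
    star A ∈ (α.flow (predual π)).acSubspace β K ⊤ Phat := by
  let e : 𝔄 →ₗ⋆[ℂ] 𝔄 := (starLinearEquiv ℂ : 𝔄 ≃ₗ⋆[ℂ] 𝔄).toLinearMap
  have hle : (α.flow (predual π)).acSubspace β K ⊤ Phat ≤
      ((α.flow (predual π)).acSubspace β K ⊤ Phat).comap e := by
    refine Submodule.topologicalClosure_minimal _ (Submodule.span_le.2 ?_)
      ((Submodule.isClosed_topologicalClosure _).preimage continuous_star)
    rintro B ⟨⟨-, hB⟩, hL⟩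
    refine Submodule.le_topologicalClosure _ (Submodule.subset_span ⟨⟨trivial, ?_⟩, ?_⟩)
    · rw [SetLike.mem_coe, mem_continuousSubspace_iff_apply_eq_zero hGNS h1 hker]
      have hωB := (mem_continuousSubspace_iff_apply_eq_zero hGNS h1 hker B).1 hB
      change ω (star B) = 0
      rw [← hGNS.inner_eq, inner_map_star, ← inner_conj_symm, hGNS.inner_eq, hωB, map_zero]
    · intro φ hφ
      obtain ⟨ψ, hψ, hψφ⟩ := hPhat.selfAdjoint φ hφ
      convert (hL ψ hψ).conj using 1
      funext x
      rw [hψφ, AutomorphismGroup.flow_act, AutomorphismGroup.flow_act, ← map_star (α.toFun x)]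
      exact (star_star (φ (α.toFun x (star B)))).symm
  exact hle hA

lemma continuous_flow_act (α : AutomorphismGroup d 𝔄) (P : Submodule ℂ (StrongDual ℂ 𝔄)) (A : 𝔄) :
    Continuous fun x => (α.flow P).act x A := α.continuous_apply A

/-- Bounded functionals on `𝔄_c` which vanish on `𝔄_ac` vanish on the orbits of all elements of
`ker ω`, in the sense of distributions, outside of the singular continuous spectrum. -/
lemma exists_forall_fourierPairing_eq_zero (hT : IsFrequencyEquiv β T)
    (hker : ∀ A, ω A = 0 → A ∈ (α.flow (predual π)).continuousSubspace β K)
    {Phat : Submodule ℂ (StrongDual ℂ 𝔄)} {p : E d}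
    (hp : p ∉ (α.flow (predual π)).scSpectrum β K Phat) :
    ∃ r > 0, ∀ ψ : StrongDual ℂ 𝔄, (∀ A ∈ (α.flow (predual π)).acSubspace β K ⊤ Phat, ψ A = 0) →
      ∀ A, ω A = 0 → ∀ f : 𝓢(E d, ℂ), tsupport f ⊆ Metric.ball p r →
        fourierPairing β (fun x => ψ (α.toFun x A)) f = 0 := by
  rw [(α.flow (predual π)).notMem_scSpectrum_iff hT (continuous_flow_act α _)] at hp
  obtain ⟨r, hr, h⟩ := hp
  refine ⟨r, hr, fun ψ hψ A hA f hf => ?_⟩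
  let ψc : StrongDual ℂ ((α.flow (predual π)).continuousSubspace β K) :=
    ψ.comp (Submodule.subtypeL _)
  -- Restricted to the continuous subspace, `ψ` annihilates the absolutely continuous one and so
  -- descends to the singular continuous quotient.
  exact h ⟨A, hker A hA⟩ (Submodule.liftQL _ ψc fun B hB => hψ B hB) f hf

/-- A criterion for points outside of the singular continuous spectrum. -/
lemma notMem_scSpectrum_unitary (hT : IsFrequencyEquiv β T) (hGNS : IsGNSTriple ω π Ω)
    (h1 : ω 1 = 1) (hker : ∀ A, ω A = 0 → A ∈ (α.flow (predual π)).continuousSubspace β K)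
    (hU : Implements α π Ω U) {p : E d} {r : ℝ} (hr : 0 < r)
    (h : ∀ Φ : H, (∀ Ψ ∈ U.flow.acSubspace β K ⊤ ⊤, ⟪Φ, Ψ⟫_ℂ = 0) → ∀ A, ω A = 0 →
      ∀ f : 𝓢(E d, ℂ), tsupport f ⊆ Metric.ball p r → ⟪Φ, U.smear T f (π A Ω)⟫_ℂ = 0) :
    p ∉ U.flow.scSpectrum β K ⊤ := by
  rw [U.flow.notMem_scSpectrum_iff hT U.continuous_apply]
  refine ⟨r, hr, fun Ψ φ f hf => ?_⟩
  have hcl := U.flow.isClosed_continuousSubspace β K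
  have : CompleteSpace (U.flow.continuousSubspace β K) := hcl.completeSpace_coe
  set ψ : StrongDual ℂ (U.flow.continuousSubspace β K) := φ.comp (Submodule.mkQL _) with hψ
  -- The continuous subspace is closed, hence a Hilbert space. By Riesz a functional on the quotient
  -- is a vector `Φ` in it orthogonal to the absolutely continuous subspace.
  obtain ⟨Φ, hΦ⟩ := exists_forall_eq_inner ψ
  have hΦac : ∀ Ξ ∈ U.flow.acSubspace β K ⊤ ⊤, ⟪(Φ : H), Ξ⟫_ℂ = 0 := fun Ξ hΞ => by
    have h2 := hΦ ⟨Ξ, U.flow.acSubspace_le_continuousSubspace _ _ hΞ⟩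
    rw [Submodule.coe_inner] at h2
    rw [← h2, hψ, ContinuousLinearMap.comp_apply, Submodule.mkQL_apply, Submodule.mkQ_apply]
    refine (congrArg φ ((Submodule.Quotient.mk_eq_zero _).2 ?_)).trans (map_zero φ)
    exact hΞ
  have hfun : (fun x => φ (U.flow.scClass β K ⊤ Ψ x)) =
      fun x => ⟪(Φ : H), U.toFun x (Ψ : H)⟫_ℂ := by
    funext x
    rw [IsometricFlow.scClass_apply_eq, ← hψ, hΦ, Submodule.coe_inner]
    rfl
  rw [hfun, U.fourierPairing_inner hT]
  have hΨ := mem_closure_of_inner_eq_zero hGNS h1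
    ((mem_continuousSubspace_iff_inner_eq_zero hGNS h1 hker hU (Ψ : H)).1 Ψ.2)
  have hset : closure ((fun A => π A Ω) '' {A | ω A = 0}) ⊆
      {Ξ : H | ⟪(Φ : H), U.smear T f Ξ⟫_ℂ = 0} := by
    refine closure_minimal ?_ (isClosed_eq (by fun_prop) continuous_const)
    rintro _ ⟨A, hA, rfl⟩
    exact h Φ hΦac A hA f hf
  rw [hset hΨ, mul_zero]

lemma scSpectrum_subset (hT : IsFrequencyEquiv β T) (hGNS : IsGNSTriple ω π Ω) (h1 : ω 1 = 1)
    (hker : ∀ A, ω A = 0 → A ∈ (α.flow (predual π)).continuousSubspace β K)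
    (hU : Implements α π Ω U) {Phat : Submodule ℂ (StrongDual ℂ 𝔄)}
    (hPhat : DenseCondition π Ω Phat) :
    U.flow.scSpectrum β K ⊤ ⊆ (α.flow (predual π)).scSpectrum β K Phat := by
  intro p
  contrapose
  intro hp
  obtain ⟨r, hr, hvan⟩ := exists_forall_fourierPairing_eq_zero hT hker hp
  refine notMem_scSpectrum_unitary hT hGNS h1 hker hU hr fun Φ hΦ A hA f hf => ?_
  have h := hvan (vectorFunctional π Φ Ω) (fun B hB =>
    hΦ _ (apply_cyclic_mem_acSubspace hT hGNS h1 hker hU hPhat hB)) A hA f hf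
  simp only [hU.vectorFunctional_omega_right] at h
  rw [U.fourierPairing_inner hT] at h
  exact (mul_eq_zero.1 h).resolve_left (pairingConst_ne_zero hT)

/-- The functional `(Ω|π(·)Φ)` evaluated on the orbit of `A*` is the conjugate of `(Φ|U(x)π(A)Ω)`,
which reflects momentum. It annihilates `𝔄_ac` because that space is invariant under the involution.
-/
lemma neg_scSpectrum_subset (hT : IsFrequencyEquiv β T) (hGNS : IsGNSTriple ω π Ω)
    (h1 : ω 1 = 1)
    (hker : ∀ A, ω A = 0 → A ∈ (α.flow (predual π)).continuousSubspace β K)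
    (hU : Implements α π Ω U) {Phat : Submodule ℂ (StrongDual ℂ 𝔄)}
    (hPhat : DenseCondition π Ω Phat) :
    -U.flow.scSpectrum β K ⊤ ⊆ (α.flow (predual π)).scSpectrum β K Phat := by
  intro p
  rw [Set.mem_neg]
  contrapose
  intro hp
  obtain ⟨r, hr, hvan⟩ := exists_forall_fourierPairing_eq_zero hT hker hp
  refine notMem_scSpectrum_unitary hT hGNS h1 hker hU hr fun Φ hΦ A hA f hf => ?_
  have hf' : tsupport (schwartzConj (schwartzNeg f)) ⊆ Metric.ball p r := by
    rw [tsupport_schwartzConj]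
    simpa using tsupport_schwartzNeg_subset hf
  have hωA : ω (star A) = 0 := by
    rw [← hGNS.inner_eq, inner_map_star, ← inner_conj_symm, hGNS.inner_eq, hA, map_zero]
  have h := hvan (vectorFunctional π Ω Φ) (fun B hB => ?_) (star A) hωA _ hf'
  · have hfun : (fun x => vectorFunctional π Ω Φ (α.toFun x (star A))) =
        fun x => conj ⟪Φ, U.toFun x (π A Ω)⟫_ℂ := by
      funext x
      rw [hU.vectorFunctional_omega_left, star_star, inner_conj_symm, U.inner_toFun_left]
    rw [hfun, fourierPairing_conj, schwartzConj_schwartzConj, schwartzNeg_schwartzNeg,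
      map_eq_zero, U.fourierPairing_inner hT] at h
    exact (mul_eq_zero.1 h).resolve_left (pairingConst_ne_zero hT)
  · have h2 := hΦ _ (apply_cyclic_mem_acSubspace hT hGNS h1 hker hU hPhat
      (star_mem_acSubspace hGNS h1 hker hPhat hB))
    rw [vectorFunctional_apply, ← inner_map_left, ← inner_conj_symm, h2, map_zero]

end Spectra

end ArvesonSpectral
end

noncomputable section

namespace ArvesonSpectral

open scoped FourierTransform ComplexConjugate

/-! ### Energy-momentum transfer -/

section Transfer

variable {d : ℕ}

lemma integral_schwartzMod (z : E d) (f : 𝓢(E d, ℂ)) :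
    ∫ p, schwartzMod z f p = 𝓕 f z := by
  have h := fourier_schwartzMod z f 0
  rw [zero_add] at h
  rw [← h, SchwartzMap.fourier_coe, Real.fourier_eq']
  simp

/-- If `f = 1` on `supp f₁ - supp f₂` then multiplication by `f̂` acts as the identity. -/
lemma integral_fourier_mul_fourier_mul_fourier {f f₁ f₂ : 𝓢(E d, ℂ)}
    (h : ∀ p q, f₁ p ≠ 0 → f₂ q ≠ 0 → f (p - q) = 1) (y z : E d) :
    ∫ x, 𝓕 f x * (conj (𝓕 f₁ (y + x)) * 𝓕 f₂ (z + x)) = conj (𝓕 f₁ y) * 𝓕 f₂ z := by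
  set a := schwartzMod y f₁ with ha
  set b := schwartzMod z f₂ with hb
  -- Multiplication by `𝓕 f` is convolution with `f` in momentum space. At points of the support of
  -- `f₁` the convolution reduces to the constant `∫ b`, and the integral factorizes.
  set c := SchwartzMap.convolution (ContinuousLinearMap.mul ℂ ℂ) f b with hc
  have hcF : ∀ x, 𝓕 c x = 𝓕 f x * 𝓕 b x := fun x => by
    rw [hc, SchwartzMap.fourier_convolution, SchwartzMap.pairing_apply_apply]
    rfl
  have hca : ∀ p, c p = ∫ q, f (p - q) * b q := fun p => by
    rw [hc, SchwartzMap.convolution_apply, convolution_eq_swap]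
    rfl
  have h1 : ∀ x, 𝓕 f x * (conj (𝓕 f₁ (y + x)) * 𝓕 f₂ (z + x)) = conj (𝓕 a x) * 𝓕 c x := fun x => by
    rw [hcF, ha, hb, fourier_schwartzMod, fourier_schwartzMod, add_comm y, add_comm z]
    ring
  simp only [h1]
  rw [integral_conj_fourier_mul_fourier, ← integral_schwartzMod y, ← integral_schwartzMod z,
    ← ha, ← hb, ← integral_conj, ← integral_mul_const]
  refine integral_congr_ae (ae_of_all _ fun p => ?_)
  simp only
  by_cases hp : f₁ p = 0
  · simp [ha, schwartzMod_apply, hp]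
  · congr 1
    rw [hca]
    refine integral_congr_ae (ae_of_all _ fun q => ?_)
    simp only
    by_cases hq : f₂ q = 0
    · simp [hb, schwartzMod_apply, hq]
    · rw [h p q hp hq, one_mul]

/-- The shear `(x, y, z) ↦ (x, y + x, z + x)` preserves the product measure. -/
lemma integrable_prod_translate {a b c : E d → ℂ} (ha : Integrable a) (hb : Integrable b)
    (hc : Integrable c) :
    Integrable (fun q : E d × (E d × E d) => a q.1 * (b (q.2.1 + q.1) * c (q.2.2 + q.1)))
      (volume.prod (volume.prod volume)) := by
  have h0 : Integrable (fun q : E d × (E d × E d) => a q.1 * (b q.2.1 * c q.2.2))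
      (volume.prod (volume.prod volume)) := ha.mul_prod (hb.mul_prod hc)
  have hmp : MeasurePreserving (fun q : E d × (E d × E d) => (q.1, q.2 + (q.1, q.1)))
      ((volume : Measure (E d)).prod ((volume : Measure (E d)).prod (volume : Measure (E d))))
      (volume.prod (volume.prod volume)) := by
    refine (MeasurePreserving.id volume).skew_product
      (g := fun (x : E d) (m : E d × E d) => m + (x, x)) ?_ (ae_of_all _ fun x => ?_)
    · exact Measurable.add measurable_snd (measurable_fst.prodMk measurable_fst)
    · exact (measurePreserving_add_right
        ((volume : Measure (E d)).prod (volume : Measure (E d))) (x, x)).map_eq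
  exact hmp.integrable_comp_of_integrable h0

variable {H : Type*} [NormedAddCommGroup H] [InnerProductSpace ℂ H] [CompleteSpace H]
  (U : UnitaryGroup d H) (T : E d ≃L[ℝ] E d)

lemma UnitaryGroup.toFun_neg_smear (f : 𝓢(E d, ℂ)) (x : E d) (Ψ : H) :
    U.toFun (-(T x)) (U.smear T f Ψ) = U.smear T (schwartzMod x f) Ψ := by
  refine ext_inner_left ℂ fun Φ => ?_
  rw [← neg_neg (T x), ← U.inner_toFun_left, neg_neg, U.inner_smear, U.inner_smear,
    ← integral_add_right_eq_self _ x]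
  refine integral_congr_ae (ae_of_all _ fun y => ?_)
  simp only [fourier_schwartzMod]
  rw [_root_.map_add T y x, add_comm (T y), U.map_add, LinearIsometryEquiv.inner_map_map]

lemma UnitaryGroup.inner_smear_apply_smear (B : H →L[ℂ] H) (f g : 𝓢(E d, ℂ)) (Φ Ψ : H) :
    ⟪U.smear T f Φ, B (U.smear T g Ψ)⟫_ℂ =
      ∫ m : E d × E d, conj (𝓕 f m.1) * 𝓕 g m.2 *
        ⟪U.toFun (T m.1) Φ, B (U.toFun (T m.2) Ψ)⟫_ℂ ∂(volume.prod volume) := by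
  have hconj : Integrable fun x => conj (𝓕 f x) :=
    Complex.conjCLE.integrable_comp_iff.2 (𝓕 f).integrable
  rw [integral_prod]
  · rw [← inner_conj_symm, U.inner_smear, ← integral_conj]
    refine integral_congr_ae (ae_of_all _ fun y => ?_)
    simp only [map_mul, inner_conj_symm]
    rw [← ContinuousLinearMap.adjoint_inner_left, U.inner_smear, ← integral_const_mul]
    refine integral_congr_ae (ae_of_all _ fun z => ?_)
    simp only [ContinuousLinearMap.adjoint_inner_left]
    ring
  · refine (hconj.mul_prod (𝓕 g).integrable).mul_bdd (c := ‖Φ‖ * (‖B‖ * ‖Ψ‖)) ?_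
      (ae_of_all _ fun m => ?_)
    · refine Continuous.aestronglyMeasurable ?_
      exact ((U.continuous_comp T Φ).comp continuous_fst).inner
        (B.continuous.comp ((U.continuous_comp T Ψ).comp continuous_snd))
    · refine (norm_inner_le_norm _ _).trans ?_
      rw [LinearIsometryEquiv.norm_map]
      gcongr
      exact (B.le_opNorm _).trans (by rw [LinearIsometryEquiv.norm_map])

/-- Smearing `x ↦ U(x) B U(-x)` with a function `f` which is `1` on `supp f₁ - supp f₂` does not
change matrix elements between vectors of spectral support in `supp f₁` and `supp f₂`. -/
lemma UnitaryGroup.integral_fourier_mul_inner_smear (B : H →L[ℂ] H) {f f₁ f₂ : 𝓢(E d, ℂ)}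
    (h : ∀ p q, f₁ p ≠ 0 → f₂ q ≠ 0 → f (p - q) = 1) (Φ Ψ : H) :
    ∫ x, 𝓕 f x * ⟪U.smear T f₁ Φ, U.toFun (T x) (B (U.toFun (-(T x)) (U.smear T f₂ Ψ)))⟫_ℂ =
      ⟪U.smear T f₁ Φ, B (U.smear T f₂ Ψ)⟫_ℂ := by
  set S : E d × E d → ℂ := fun m => ⟪U.toFun (T m.1) Φ, B (U.toFun (T m.2) Ψ)⟫_ℂ with hS
  have hScont : Continuous S := ((U.continuous_comp T Φ).comp continuous_fst).inner
        (B.continuous.comp ((U.continuous_comp T Ψ).comp continuous_snd))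
  have hSb : ∀ m, ‖S m‖ ≤ ‖Φ‖ * (‖B‖ * ‖Ψ‖) := fun m => by
    refine (norm_inner_le_norm _ _).trans ?_
    rw [LinearIsometryEquiv.norm_map]
    gcongr
    exact (B.le_opNorm _).trans (by rw [LinearIsometryEquiv.norm_map])
  have hconj : Integrable fun x => conj (𝓕 f₁ x) :=
    Complex.conjCLE.integrable_comp_iff.2 (𝓕 f₁).integrable
  have h1 : ∀ x, 𝓕 f x * ⟪U.smear T f₁ Φ, U.toFun (T x)
      (B (U.toFun (-(T x)) (U.smear T f₂ Ψ)))⟫_ℂ =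
      ∫ m : E d × E d, 𝓕 f x * (conj (𝓕 f₁ (m.1 + x)) * 𝓕 f₂ (m.2 + x)) * S m
        ∂(volume.prod volume) := fun x => by
    rw [← neg_neg (T x), ← U.inner_toFun_left, neg_neg, U.toFun_neg_smear, U.toFun_neg_smear,
      U.inner_smear_apply_smear, ← integral_const_mul]
    simp only [fourier_schwartzMod, hS, mul_assoc]
  simp only [h1]
  have hint : Integrable (Function.uncurry fun (x : E d) (m : E d × E d) =>
      𝓕 f x * (conj (𝓕 f₁ (m.1 + x)) * 𝓕 f₂ (m.2 + x)) * S m)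
      (volume.prod (volume.prod volume)) :=
    (integrable_prod_translate (𝓕 f).integrable hconj (𝓕 f₂).integrable).mul_bdd
      (hScont.comp continuous_snd).aestronglyMeasurable (ae_of_all _ fun q => hSb q.2)
  -- Carrying out the `x`-integral first reproduces the kernel of the original matrix element; the
  -- factor `S m` does not depend on `x`.
  rw [integral_integral_swap hint, U.inner_smear_apply_smear]
  refine integral_congr_ae (ae_of_all _ fun m => ?_)
  simp only
  rw [integral_mul_const, integral_fourier_mul_fourier_mul_fourier h]

end Transfer

/-! ### Differences of points of the continuous spectrum -/

section ContinuousSpectrum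

variable {d : ℕ} {𝔄 : Type*} [CStarAlgebra 𝔄] {H : Type*} [NormedAddCommGroup H]
  [InnerProductSpace ℂ H] [CompleteSpace H] {β : LinearMap.BilinForm ℝ (E d)}
  {T : E d ≃L[ℝ] E d}
  {K : CuboidFamily d} {α : AutomorphismGroup d 𝔄} {π : 𝔄 →⋆ₐ[ℂ] (H →L[ℂ] H)} {Ω : H}
  {ω : StrongDual ℂ 𝔄} {U : UnitaryGroup d H}

/-- Near each point of the continuous spectrum there are smeared vectors orthogonal to `Ω`. -/
lemma exists_smear_ne_zero (hT : IsFrequencyEquiv β T) (hGNS : IsGNSTriple ω π Ω) (h1 : ω 1 = 1)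
    (hker : ∀ A, ω A = 0 → A ∈ (α.flow (predual π)).continuousSubspace β K)
    (hU : Implements α π Ω U) {p : E d} (hp : p ∈ U.flow.cSpectrum β K ⊤) {r : ℝ} (hr : 0 < r) :
    ∃ (f : 𝓢(E d, ℂ)) (Ψ : H), tsupport f ⊆ Metric.ball p r ∧ U.smear T f Ψ ≠ 0 ∧
      ⟪Ω, U.smear T f Ψ⟫_ℂ = 0 := by
  by_contra! hcon
  refine (U.flow.notMem_spectrumOn_iff hT _ p).2 ⟨r, hr, fun Ψ hΨ φ _ f hf => ?_⟩ hp
  obtain ⟨Φ, hΦ⟩ := exists_forall_eq_inner φ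
  simp only [UnitaryGroup.flow_act, hΦ]
  have hΩΨ : ⟪Ω, Ψ⟫_ℂ = 0 := (mem_continuousSubspace_iff_inner_eq_zero hGNS h1 hker hU Ψ).1 hΨ.2
  have h0 : U.smear T f Ψ = 0 := by
    by_contra hne
    refine hcon f Ψ hf hne ?_
    -- `Ω` is invariant, so smearing maps its orthogonal complement into itself.
    rw [U.inner_smear]
    simp only [hU.inner_omega, hΩΨ, mul_zero, integral_zero]
  rw [U.fourierPairing_inner hT, h0, inner_zero_right, mul_zero]

lemma exists_schwartz_eq_one_on_ball (p : E d) {r R : ℝ} (hr : 0 < r) (hrR : r < R) :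
    ∃ f : 𝓢(E d, ℂ), tsupport f ⊆ Metric.closedBall p R ∧ ∀ x ∈ Metric.closedBall p r, f x = 1 := by
  let η : ContDiffBump p := ⟨r, R, hr, hrR⟩
  have hc : HasCompactSupport (Complex.ofRealCLM ∘ η) := η.hasCompactSupport.comp_left rfl
  refine ⟨hc.toSchwartzMap (Complex.ofRealCLM.contDiff.comp η.contDiff), ?_, fun x hx => ?_⟩
  · have h : tsupport (Complex.ofRealCLM ∘ η) ⊆ Metric.closedBall p R :=
      (tsupport_comp_subset rfl _).trans η.tsupport_eq.subset
    exact h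
  · change ((η x : ℝ) : ℂ) = 1
    rw [η.one_of_mem_closedBall hx, Complex.ofReal_one]

/-- An operator with nonzero matrix element from momentum near `q` to momentum near `p` must
transfer momentum near `p - q`. Irreducibility of `π` provides such an operator inside `ker ω`. -/
lemma cSpectrum_sub_cSpectrum_subset (hT : IsFrequencyEquiv β T) (hω : IsPureState ω)
    (hGNS : IsGNSTriple ω π Ω)
    (hker : ∀ A, ω A = 0 → A ∈ (α.flow (predual π)).continuousSubspace β K)
    (hU : Implements α π Ω U) :
    U.flow.cSpectrum β K ⊤ - U.flow.cSpectrum β K ⊤ ⊆ (α.flow (predual π)).cSpectrum β K ⊤ := by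
  rintro _ ⟨p, hp, q, hq, rfl⟩
  have h1 : ω 1 = 1 := hω.1.2
  by_contra hpq
  rw [IsometricFlow.cSpectrum, IsometricFlow.notMem_spectrumOn_iff _ hT] at hpq
  obtain ⟨r, hr, hvan⟩ := hpq
  -- Supports of radius `r/8` have differences within `r/4` of `p - q`, where `f` equals `1`, while
  -- `f` is supported within `r/2 < r`.
  obtain ⟨f₁, Φ, hf₁, hΦ0, hΦΩ⟩ := exists_smear_ne_zero hT hGNS h1 hker hU hp
    (r := r / 8) (by positivity)
  obtain ⟨f₂, Ψ, hf₂, hΨ0, hΨΩ⟩ := exists_smear_ne_zero hT hGNS h1 hker hU hq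
    (r := r / 8) (by positivity)
  obtain ⟨f, hf, hf1⟩ := exists_schwartz_eq_one_on_ball (p - q) (r := r / 4) (R := r / 2)
    (by positivity) (by linarith)
  obtain ⟨A, hA, hne⟩ := hω.exists_inner_ne_zero hGNS hΦ0 hΨ0 hΦΩ hΨΩ
  have hone : ∀ a b, f₁ a ≠ 0 → f₂ b ≠ 0 → f (a - b) = 1 := by
    intro a b ha hb
    have h2 := hf₁ (subset_tsupport _ (Function.mem_support.2 ha))
    have h3 := hf₂ (subset_tsupport _ (Function.mem_support.2 hb))
    rw [Metric.mem_ball] at h2 h3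
    refine hf1 _ ?_
    rw [Metric.mem_closedBall]
    have := dist_sub_sub_le a b p q
    linarith
  have h := hvan A ⟨trivial, hker A hA⟩ _
    (vectorFunctional_mem_predual (U.smear T f₁ Φ) (U.smear T f₂ Ψ)) f
    (hf.trans (Metric.closedBall_subset_ball (by linarith)))
  simp only [AutomorphismGroup.flow_act, hU.vectorFunctional_act] at h
  rw [fourierPairing_eq hT] at h
  have h' := (mul_eq_zero.1 h).resolve_left (pairingConst_ne_zero hT)
  simp only [mul_comm _ (𝓕 f _)] at h'
  rw [U.integral_fourier_mul_inner_smear T (π A) hone] at h'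
  exact hne h'

end ContinuousSpectrum

end ArvesonSpectral
end

theorem mainTheorem3 {d : ℕ} {𝔄 : Type*} [CStarAlgebra 𝔄]
    {H : Type*} [NormedAddCommGroup H] [InnerProductSpace ℂ H] [CompleteSpace H]
    (β : LinearMap.BilinForm ℝ (E d)) (hβ : β.Nondegenerate) (hβs : β.IsSymm)
    (K : CuboidFamily d) (α : AutomorphismGroup d 𝔄)
    (ω₀ : StrongDual ℂ 𝔄) (hω₀ : IsPureState ω₀)
    (π : 𝔄 →⋆ₐ[ℂ] (H →L[ℂ] H)) (Ω : H) (hGNS : IsGNSTriple ω₀ π Ω)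
    (hnorm : IsNorming (predual π))
    (hker : ∀ A, ω₀ A = 0 → A ∈ (α.flow (predual π)).continuousSubspace β K)
    (Phat : Submodule ℂ (StrongDual ℂ 𝔄)) (hPhat : DenseCondition π Ω Phat)
    (Ahat : Submodule ℂ 𝔄) (hAhat : Dense (Ahat : Set 𝔄)) :
    (∃! U : UnitaryGroup d H, Implements α π Ω U) ∧
    ∀ U : UnitaryGroup d H, Implements α π Ω U →
      (U.flow.ppSpectrum β ⊤ = {0} ∧
        (α.flow (predual π)).ppSpectrum β ⊤ = {0} ∧
        α.transposed.ppSpectrum β (predual π) = {0}) ∧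
      U.flow.cSpectrum β K ⊤ - U.flow.cSpectrum β K ⊤ ⊆
        (α.flow (predual π)).cSpectrum β K ⊤ ∧
      (U.flow.acSpectrum β K ⊤ ⊤ ⊆
          α.transposed.acSpectrum β K (predual π) (AutomorphismGroup.evaluations Ahat) ∧
        -U.flow.acSpectrum β K ⊤ ⊤ ⊆
          α.transposed.acSpectrum β K (predual π) (AutomorphismGroup.evaluations Ahat)) ∧
      (U.flow.scSpectrum β K ⊤ ⊆ (α.flow (predual π)).scSpectrum β K Phat ∧
        -U.flow.scSpectrum β K ⊤ ⊆ (α.flow (predual π)).scSpectrum β K Phat) := by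
  obtain ⟨T, hT⟩ : ∃ T, IsFrequencyEquiv β T := exists_frequencyEquiv β hβ hβs
  have h1 : ω₀ 1 = 1 := hω₀.1.2
  refine ⟨?_, fun U hU => ⟨⟨ppSpectrum_unitary hT hGNS h1 hker hU,
      ppSpectrum_automorphism hT hGNS h1 hker hnorm, ppSpectrum_transposed hT hGNS h1 hker⟩,
    cSpectrum_sub_cSpectrum_subset hT hω₀ hGNS hker hU,
    ⟨acSpectrum_subset hT hGNS h1 hker hU Ahat, neg_acSpectrum_subset hT hGNS h1 hker hU Ahat⟩,
    ⟨scSpectrum_subset hT hGNS h1 hker hU hPhat,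
      neg_scSpectrum_subset hT hGNS h1 hker hU hPhat⟩⟩⟩
  obtain ⟨U, hU⟩ := exists_implements hGNS (apply_toFun_eq_of_ker_le hGNS h1 hker)
  exact ⟨U, hU, fun V hV => hU.unique hGNS hV⟩
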